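/- Let $\mathcal V$ be a symmetric monoidal category and let $(\mathcal F,*,J,\circ,\mathbf 1,\gamma,\mu,\delta,\tau)$ be a duoidal $\mathcal V$-category: $(*,J)$ (horizontal) and $(\circ,\mathbf 1)$ (vertical) are monoidal structures on the $\mathcal V$-category $\mathcal F$, with a $\mathcal V$-natural interchange $\gamma:(A\circ B)*(C\circ D)\to(A*C)\circ(B*D)$ and maps $\mu:\mathbf 1*\mathbf 1\to\mathbf 1$, $\delta:J\to J\circ J$, $\tau:J\to\mathbf 1$, satisfying the usual axioms: $\gamma$ is compatible with both associativities, $(\mathbf 1,\mu,\tau)$ is a horizontal monoid, $(J,\delta,\tau)$ is a vertical comonoid, and $\gamma$ is compatible with the unit constraints through $\delta$ and $\mu$. Assume that $\mathcal F$ is horizontally left closed, $\mathcal F(X*Y,Z)\cong\mathcal F(X,[Y,Z])$ ($\mathcal V$-naturally), and write $\mathcal F_h=(\mathcal F,*,J)$; then $\mathcal F$ is an $\mathcal F_h$-category with hom-objects $[X,Y]$. $\mathcal F_h$-categories have compositions $\mathcal A(Y,Z)*\mathcal A(X,Y)\to\mathcal A(X,Z)$. They have a tensor product $\mathcal A\circ\mathcal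 B$ with objects the pairs and hom-objects $\mathcal A(X,X')\circ\mathcal B(Y,Y')$, identities and compositions being formed with $\delta$ and $\gamma$; its unit $\bar{\mathbf 1}$ has one object, with endomorphism object $\mathbf 1$. A monoidal structure on an $\mathcal F_h$-category $\mathcal A$ consists of $\mathcal F_h$-functors $\mathcal A\circ\mathcal A\to\mathcal A$ and $\bar{\mathbf 1}\to\mathcal A$ with invertible $\mathcal F_h$-natural associativity and unit constraints satisfying the pentagon and triangle axioms. In particular $\mathcal F$ is monoidal, by the $\mathcal F_h$-functors $\hat\circ:\mathcal F\circ\mathcal F\to\mathcal F$, $(X,Y)\mapsto X\circ Y$, and $\ulcorner\mathbf 1\urcorner:\bar{\mathbf 1}\to\mathcal F$ induced by $\gamma$ and $\mu$, with the constraints of the vertical structure. Let $M$ be a monoid in $\mathcal F_h$. Assume that for all right $M$-modules $(A,\alpha),(B,\beta)$ the equalizer of the two morphisms $[\alpha,1],\ [1,\beta]\cdot(-*M):[A,B]\rightrightarrows[A*M,B]$ exists (for instance, that $\mathcal F$ has equalizers). These equalizers are the hom-objects of the $\mathcal F_h$-category $\mathcal F^{*M}$ of right $M$-modules; let $U_M:\mathcal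 F^{*M}\to\mathcal F$ be the forgetful $\mathcal F_h$-functor. A bimonoid structure on $M$ is a vertical comonoid structure $(\delta_M:M\to M\circ M,\ \varepsilon_M:M\to\mathbf 1)$ for which $\delta_M$ and $\varepsilon_M$ are morphisms of horizontal monoids (where $M\circ M$ is a monoid by means of $\gamma$ and $\delta$). By a monoidal structure on $\mathcal F^{*M}$ over $\mathcal F$ we mean a monoidal structure $(\otimes,I)$ on the $\mathcal F_h$-category $\mathcal F^{*M}$ together with a strong monoidal structure $\varphi_{A,B}:U_MA\circ U_MB\cong U_M(A\otimes B)$, $\varphi_0:\mathbf 1\cong U_MI$ on $U_M$, as an $\mathcal F_h$-functor into $(\mathcal F,\hat\circ,\ulcorner\mathbf 1\urcorner)$. An isomorphism between two such structures is a strong monoidal structure on the identity functor of $\mathcal F^{*M}$ (that is, invertible natural comparisons between the two tensor products and between the two units, compatible with the constraints) which is compatible, via $U_M$, with the strong monoidal structures of $U_M$. **Theorem.** There is a bijection between the bimonoid structures on $M$ and the isomorphism classes of monoidal structures on $\mathcal F^{*M}$ over $\mathcal F$. Under it, $(\delta_M,\varepsilon_M)$ corresponds to the class of $(\otimes,I,\varphi,\varphi_0)$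 if and only if, for all right $M$-modules $(A,\alpha)$ and $(B,\beta)$, $\varphi_{A,B}$ is a morphism of $M$-modules when $A\circ B$ is given the action $$(A\circ B)*M\xrightarrow{1*\delta_M}(A\circ B)*(M\circ M)\xrightarrow{\ \gamma\ }(A*M)\circ(B*M)\xrightarrow{\alpha\circ\beta}A\circ B,$$ and $\varphi_0$ is a morphism of $M$-modules when $\mathbf 1$ is given the action $$\mathbf 1*M\xrightarrow{1*\varepsilon_M}\mathbf 1*\mathbf 1\xrightarrow{\ \mu\ }\mathbf 1 .$$ -/

import Mathlib

open CategoryTheory MonoidalCategory Category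

universe v u v' u' w w₁ w₂ w₃ w₄

namespace Duo

/-! ### Duoidal categories -/

/-- The vertical monoidal structure `(∘, 𝟭)` on a category. It is kept apart from the instance
`MonoidalCategory F`, which is always the horizontal structure `(∗, J)`, written `⊗`, `𝟙_ F`. -/
class VerticalMonoidal (F : Type u) [Category.{v} F] where
  vert : MonoidalCategory F

section Vertical

variable {F : Type u} [Category.{v} F] [VerticalMonoidal F]

/-- The vertical tensor product of objects. -/
abbrev vObj (A B : F) : F := VerticalMonoidal.vert.tensorObj A B

/-- The vertical tensor product of morphisms. -/
abbrev vHom {A A' B B' : F} (f : A ⟶ A') (g : B ⟶ B') : vObj A B ⟶ vObj A' B' :=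
  VerticalMonoidal.vert.tensorHom f g

/-- The vertical unit. -/
abbrev vUnit (F : Type u) [Category.{v} F] [VerticalMonoidal F] : F :=
  (VerticalMonoidal.vert (F := F)).tensorUnit

end Vertical

infixr:70 " ∘ᵥ " => vObj
infixr:70 " ∘ᵥₘ " => vHom

section Vertical

variable {F : Type u} [Category.{v} F] [VerticalMonoidal F]

/-- The associativity constraint of the vertical structure. -/
abbrev vα (A B C : F) : (A ∘ᵥ B) ∘ᵥ C ≅ A ∘ᵥ (B ∘ᵥ C) := VerticalMonoidal.vert.associator A B C

/-- The left unit constraint of the vertical structure. -/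
abbrev vl (A : F) : vUnit F ∘ᵥ A ≅ A := VerticalMonoidal.vert.leftUnitor A

/-- The right unit constraint of the vertical structure. -/
abbrev vr (A : F) : A ∘ᵥ vUnit F ≅ A := VerticalMonoidal.vert.rightUnitor A

lemma vHom_comp {A A' A'' B B' B'' : F} (f : A ⟶ A') (f' : A' ⟶ A'') (g : B ⟶ B')
    (g' : B' ⟶ B'') : (f ∘ᵥₘ g) ≫ (f' ∘ᵥₘ g') = (f ≫ f') ∘ᵥₘ (g ≫ g') :=
  VerticalMonoidal.vert.tensorHom_comp_tensorHom f g f' g'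

lemma vHom_id (A B : F) : (𝟙 A ∘ᵥₘ 𝟙 B) = 𝟙 (A ∘ᵥ B) :=
  VerticalMonoidal.vert.id_tensorHom_id A B

lemma vα_nat {A A' B B' C C' : F} (f : A ⟶ A') (g : B ⟶ B') (h : C ⟶ C') :
    ((f ∘ᵥₘ g) ∘ᵥₘ h) ≫ (vα A' B' C').hom = (vα A B C).hom ≫ (f ∘ᵥₘ (g ∘ᵥₘ h)) :=
  VerticalMonoidal.vert.associator_naturality f g h

lemma vl_nat {A A' : F} (f : A ⟶ A') :
    (𝟙 (vUnit F) ∘ᵥₘ f) ≫ (vl A').hom = (vl A).hom ≫ f := by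
  let _ := VerticalMonoidal.vert (F := F)
  exact (by simp : (𝟙 (𝟙_ F) ⊗ₘ f) ≫ (λ_ A').hom = (λ_ A).hom ≫ f)

lemma vr_nat {A A' : F} (f : A ⟶ A') :
    (f ∘ᵥₘ 𝟙 (vUnit F)) ≫ (vr A').hom = (vr A).hom ≫ f := by
  let _ := VerticalMonoidal.vert (F := F)
  exact (by simp : (f ⊗ₘ 𝟙 (𝟙_ F)) ≫ (ρ_ A').hom = (ρ_ A).hom ≫ f)

lemma v_pentagon (A B C D : F) :
    ((vα A B C).hom ∘ᵥₘ 𝟙 D) ≫ (vα A (B ∘ᵥ C) D).hom ≫ (𝟙 A ∘ᵥₘ (vα B C D).hom) =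
      (vα (A ∘ᵥ B) C D).hom ≫ (vα A B (C ∘ᵥ D)).hom := by
  let _ := VerticalMonoidal.vert (F := F)
  exact (by simp : ((α_ A B C).hom ⊗ₘ 𝟙 D) ≫ (α_ A (B ⊗ C) D).hom ≫ (𝟙 A ⊗ₘ (α_ B C D).hom) =
    (α_ (A ⊗ B) C D).hom ≫ (α_ A B (C ⊗ D)).hom)

lemma v_triangle (A B : F) :
    (vα A (vUnit F) B).hom ≫ (𝟙 A ∘ᵥₘ (vl B).hom) = ((vr A).hom ∘ᵥₘ 𝟙 B) := by
  let _ := VerticalMonoidal.vert (F := F)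
  exact (by simp : (α_ A (𝟙_ F) B).hom ≫ (𝟙 A ⊗ₘ (λ_ B).hom) = ((ρ_ A).hom ⊗ₘ 𝟙 B))

end Vertical

/-- A duoidal structure: two monoidal structures, the horizontal one `(⊗, 𝟙_ F)` (in the
literature `∗`, `J`) and the vertical one `(∘ᵥ, vUnit F)`, with middle-of-four interchange `γ`,
such that the vertical unit is a horizontal monoid `(μ, τ)` and the horizontal unit is a vertical
comonoid `(δ, τ)`. -/
class Duoidal (F : Type u) [Category.{v} F] [MonoidalCategory F] [VerticalMonoidal F] where
  γ (A B C D : F) : (A ∘ᵥ B) ⊗ (C ∘ᵥ D) ⟶ (A ⊗ C) ∘ᵥ (B ⊗ D)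
  /-- The horizontal monoid `(𝟭, μ, τ)`. -/
  unitMon : MonObj (vUnit F)
  /-- The vertical comonoid `(J, δ, τ)`. -/
  unitComon : @ComonObj F _ VerticalMonoidal.vert (𝟙_ F)
  /-- Both structures have the same `τ : J ⟶ 𝟭`. -/
  counit_eq_one : unitComon.counit = unitMon.one
  γ_nat {A A' B B' C C' D D' : F} (f : A ⟶ A') (g : B ⟶ B') (h : C ⟶ C') (k : D ⟶ D') :
    ((f ∘ᵥₘ g) ⊗ₘ (h ∘ᵥₘ k)) ≫ γ A' B' C' D' = γ A B C D ≫ ((f ⊗ₘ h) ∘ᵥₘ (g ⊗ₘ k))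
  γ_assoc_h (A B C D E G : F) :
    (γ A B C D ▷ (E ∘ᵥ G)) ≫ γ (A ⊗ C) (B ⊗ D) E G ≫ ((α_ A C E).hom ∘ᵥₘ (α_ B D G).hom) =
      (α_ (A ∘ᵥ B) (C ∘ᵥ D) (E ∘ᵥ G)).hom ≫ ((A ∘ᵥ B) ◁ γ C D E G) ≫ γ A B (C ⊗ E) (D ⊗ G)
  γ_assoc_v (A B C D E G : F) :
    γ (A ∘ᵥ B) C (D ∘ᵥ E) G ≫ (γ A B D E ∘ᵥₘ 𝟙 (C ⊗ G)) ≫ (vα (A ⊗ D) (B ⊗ E) (C ⊗ G)).hom =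
      ((vα A B C).hom ⊗ₘ (vα D E G).hom) ≫ γ A (B ∘ᵥ C) D (E ∘ᵥ G) ≫
        (𝟙 (A ⊗ D) ∘ᵥₘ γ B C E G)
  δ_left (A B : F) :
    (unitComon.comul ▷ (A ∘ᵥ B)) ≫ γ (𝟙_ F) (𝟙_ F) A B ≫ ((λ_ A).hom ∘ᵥₘ (λ_ B).hom) =
      (λ_ (A ∘ᵥ B)).hom
  δ_right (A B : F) :
    ((A ∘ᵥ B) ◁ unitComon.comul) ≫ γ A B (𝟙_ F) (𝟙_ F) ≫ ((ρ_ A).hom ∘ᵥₘ (ρ_ B).hom) =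
      (ρ_ (A ∘ᵥ B)).hom
  μ_left (A B : F) :
    γ (vUnit F) A (vUnit F) B ≫ (unitMon.mul ∘ᵥₘ 𝟙 (A ⊗ B)) ≫ (vl (A ⊗ B)).hom =
      ((vl A).hom ⊗ₘ (vl B).hom)
  μ_right (A B : F) :
    γ A (vUnit F) B (vUnit F) ≫ (𝟙 (A ⊗ B) ∘ᵥₘ unitMon.mul) ≫ (vr (A ⊗ B)).hom =
      ((vr A).hom ⊗ₘ (vr B).hom)

section DuoidalBasic

variable {F : Type u} [Category.{v} F] [MonoidalCategory F] [VerticalMonoidal F] [Duoidal F]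

/-- Middle-of-four interchange. -/
abbrev γ (A B C D : F) : (A ∘ᵥ B) ⊗ (C ∘ᵥ D) ⟶ (A ⊗ C) ∘ᵥ (B ⊗ D) := Duoidal.γ A B C D

/-- `μ : 𝟭 ∗ 𝟭 ⟶ 𝟭`. -/
abbrev μ₁ (F : Type u) [Category.{v} F] [MonoidalCategory F] [VerticalMonoidal F] [Duoidal F] :
    vUnit F ⊗ vUnit F ⟶ vUnit F := (Duoidal.unitMon (F := F)).mul

/-- `δ : J ⟶ J ∘ J`. -/
abbrev δJ (F : Type u) [Category.{v} F] [MonoidalCategory F] [VerticalMonoidal F] [Duoidal F] :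
    𝟙_ F ⟶ 𝟙_ F ∘ᵥ 𝟙_ F := (Duoidal.unitComon (F := F)).comul

/-- `τ : J ⟶ 𝟭`. -/
abbrev τ (F : Type u) [Category.{v} F] [MonoidalCategory F] [VerticalMonoidal F] [Duoidal F] :
    𝟙_ F ⟶ vUnit F := (Duoidal.unitMon (F := F)).one

lemma γ_nat {A A' B B' C C' D D' : F} (f : A ⟶ A') (g : B ⟶ B') (h : C ⟶ C') (k : D ⟶ D') :
    ((f ∘ᵥₘ g) ⊗ₘ (h ∘ᵥₘ k)) ≫ γ A' B' C' D' = γ A B C D ≫ ((f ⊗ₘ h) ∘ᵥₘ (g ⊗ₘ k)) :=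
  Duoidal.γ_nat f g h k

lemma γ_nat_assoc {A A' B B' C C' D D' Z : F} (f : A ⟶ A') (g : B ⟶ B') (h : C ⟶ C') (k : D ⟶ D')
    (z : (A' ⊗ C') ∘ᵥ (B' ⊗ D') ⟶ Z) :
    ((f ∘ᵥₘ g) ⊗ₘ (h ∘ᵥₘ k)) ≫ γ A' B' C' D' ≫ z =
      γ A B C D ≫ ((f ⊗ₘ h) ∘ᵥₘ (g ⊗ₘ k)) ≫ z := by
  rw [← Category.assoc, γ_nat, Category.assoc]

lemma γ_nat_left {A A' B B' : F} (f : A ⟶ A') (g : B ⟶ B') (C D : F) :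
    ((f ∘ᵥₘ g) ▷ (C ∘ᵥ D)) ≫ γ A' B' C D = γ A B C D ≫ ((f ▷ C) ∘ᵥₘ (g ▷ D)) := by
  have := γ_nat f g (𝟙 C) (𝟙 D)
  rwa [vHom_id, tensorHom_id, tensorHom_id, tensorHom_id] at this

lemma γ_nat_left_assoc {A A' B B' Z : F} (f : A ⟶ A') (g : B ⟶ B') (C D : F)
    (z : (A' ⊗ C) ∘ᵥ (B' ⊗ D) ⟶ Z) :
    ((f ∘ᵥₘ g) ▷ (C ∘ᵥ D)) ≫ γ A' B' C D ≫ z =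
      γ A B C D ≫ ((f ▷ C) ∘ᵥₘ (g ▷ D)) ≫ z := by
  rw [← Category.assoc, γ_nat_left, Category.assoc]

lemma γ_nat_right (A B : F) {C C' D D' : F} (h : C ⟶ C') (k : D ⟶ D') :
    ((A ∘ᵥ B) ◁ (h ∘ᵥₘ k)) ≫ γ A B C' D' = γ A B C D ≫ ((A ◁ h) ∘ᵥₘ (B ◁ k)) := by
  have := γ_nat (𝟙 A) (𝟙 B) h k
  rwa [vHom_id, id_tensorHom, id_tensorHom, id_tensorHom] at this

lemma γ_nat_right_assoc (A B : F) {C C' D D' Z : F} (h : C ⟶ C') (k : D ⟶ D')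
    (z : (A ⊗ C') ∘ᵥ (B ⊗ D') ⟶ Z) :
    ((A ∘ᵥ B) ◁ (h ∘ᵥₘ k)) ≫ γ A B C' D' ≫ z =
      γ A B C D ≫ ((A ◁ h) ∘ᵥₘ (B ◁ k)) ≫ z := by
  rw [← Category.assoc, γ_nat_right, Category.assoc]

lemma δ_left (A B : F) :
    (δJ F ▷ (A ∘ᵥ B)) ≫ γ (𝟙_ F) (𝟙_ F) A B ≫ ((λ_ A).hom ∘ᵥₘ (λ_ B).hom) =
      (λ_ (A ∘ᵥ B)).hom := Duoidal.δ_left A B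

lemma δ_left_assoc (A B : F) {Z : F} (z : A ∘ᵥ B ⟶ Z) :
    (δJ F ▷ (A ∘ᵥ B)) ≫ γ (𝟙_ F) (𝟙_ F) A B ≫ ((λ_ A).hom ∘ᵥₘ (λ_ B).hom) ≫ z =
      (λ_ (A ∘ᵥ B)).hom ≫ z := by
  rw [← δ_left, Category.assoc, Category.assoc]

lemma δ_right (A B : F) :
    ((A ∘ᵥ B) ◁ δJ F) ≫ γ A B (𝟙_ F) (𝟙_ F) ≫ ((ρ_ A).hom ∘ᵥₘ (ρ_ B).hom) =
      (ρ_ (A ∘ᵥ B)).hom := Duoidal.δ_right A B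

lemma δJ_counit_left : δJ F ≫ (τ F ∘ᵥₘ 𝟙 (𝟙_ F)) = (vl (𝟙_ F)).inv := by
  have h := @ComonObj.counit_comul F _ VerticalMonoidal.vert (𝟙_ F) Duoidal.unitComon
  rw [Duoidal.counit_eq_one (F := F)] at h
  rw [vHom, @tensorHom_id F _ VerticalMonoidal.vert]
  exact h

lemma δJ_counit_right : δJ F ≫ (𝟙 (𝟙_ F) ∘ᵥₘ τ F) = (vr (𝟙_ F)).inv := by
  have h := @ComonObj.comul_counit F _ VerticalMonoidal.vert (𝟙_ F) Duoidal.unitComon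
  rw [Duoidal.counit_eq_one (F := F)] at h
  rw [vHom, @id_tensorHom F _ VerticalMonoidal.vert]
  exact h

lemma δJ_coassoc : δJ F ≫ (δJ F ∘ᵥₘ 𝟙 (𝟙_ F)) ≫ (vα _ _ _).hom =
    δJ F ≫ (𝟙 (𝟙_ F) ∘ᵥₘ δJ F) := by
  have h := @ComonObj.comul_assoc F _ VerticalMonoidal.vert (𝟙_ F) Duoidal.unitComon
  rw [vHom, vHom, @id_tensorHom F _ VerticalMonoidal.vert, @tensorHom_id F _ VerticalMonoidal.vert]
  exact h.symm

end DuoidalBasic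

/-! ### Categories enriched in the horizontal monoidal category -/

section Enriched

variable (F : Type u) [Category.{v} F] [MonoidalCategory F]

/-- A category enriched in `(F, ∗, J)`, with composition
`𝒜(Y,Z) ∗ 𝒜(X,Y) ⟶ 𝒜(X,Z)`. (Mathlib's `EnrichedCategory` composes in the opposite order, which
is a different notion over a base that is not symmetric.) -/
class HCategory (A : Type w) where
  Hom : A → A → F
  id (X : A) : 𝟙_ F ⟶ Hom X X
  comp (X Y Z : A) : Hom Y Z ⊗ Hom X Y ⟶ Hom X Z
  id_comp (X Y : A) : (id Y ▷ Hom X Y) ≫ comp X Y Y = (λ_ (Hom X Y)).hom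
  comp_id (X Y : A) : (Hom X Y ◁ id X) ≫ comp X X Y = (ρ_ (Hom X Y)).hom
  assoc (X Y Z T : A) : (comp Y Z T ▷ Hom X Y) ≫ comp X Y T =
    (α_ (Hom Z T) (Hom Y Z) (Hom X Y)).hom ≫ (Hom Z T ◁ comp X Y Z) ≫ comp X Z T

variable {A : Type w₁} {B : Type w₂} {C : Type w₃} {D : Type w₄}
  [HCategory F A] [HCategory F B] [HCategory F C] [HCategory F D]

/-- The hom-object in `F`. -/
abbrev hom (X Y : A) : F := HCategory.Hom X Y

/-- The identity element. -/
abbrev hId (X : A) : 𝟙_ F ⟶ hom F X X := HCategory.id X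

/-- The composition. -/
abbrev hComp (X Y Z : A) : hom F Y Z ⊗ hom F X Y ⟶ hom F X Z := HCategory.comp X Y Z

/-- Morphisms `X ⟶ Y` of the underlying ordinary category: elements `J ⟶ 𝒜(X,Y)`. -/
abbrev UHom (X Y : A) := 𝟙_ F ⟶ hom F X Y

variable {F}

/-- Composition in the underlying ordinary category (first `f`, then `g`). -/
def ucomp {X Y Z : A} (f : UHom F X Y) (g : UHom F Y Z) : UHom F X Z :=
  (λ_ (𝟙_ F)).inv ≫ (g ⊗ₘ f) ≫ hComp F X Y Z

/-- Composition with `g : Y ⟶ Z` on the left, `𝒜(X,Y) ⟶ 𝒜(X,Z)`. -/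
def post (X : A) {Y Z : A} (g : UHom F Y Z) : hom F X Y ⟶ hom F X Z :=
  (λ_ (hom F X Y)).inv ≫ (g ▷ hom F X Y) ≫ hComp F X Y Z

/-- Composition with `f : X ⟶ Y` on the right, `𝒜(Y,Z) ⟶ 𝒜(X,Z)`. -/
def pre {X Y : A} (f : UHom F X Y) (Z : A) : hom F Y Z ⟶ hom F X Z :=
  (ρ_ (hom F Y Z)).inv ≫ (hom F Y Z ◁ f) ≫ hComp F X Y Z

lemma ucomp_eq_post {X Y Z : A} (f : UHom F X Y) (g : UHom F Y Z) : ucomp f g = f ≫ post X g := by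
  rw [ucomp, post, MonoidalCategory.tensorHom_def', leftUnitor_inv_naturality_assoc,
    Category.assoc]

lemma ucomp_eq_pre {X Y Z : A} (f : UHom F X Y) (g : UHom F Y Z) : ucomp f g = g ≫ pre f Z := by
  rw [ucomp, pre, MonoidalCategory.tensorHom_def, rightUnitor_inv_naturality_assoc,
    Category.assoc, unitors_inv_equal]

lemma post_id (X Y : A) : post X (hId F Y) = 𝟙 (hom F X Y) := by
  rw [post, HCategory.id_comp, Iso.inv_hom_id]

lemma pre_id (X Y : A) : pre (hId F X) Y = 𝟙 (hom F X Y) := by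
  rw [pre, HCategory.comp_id, Iso.inv_hom_id]

lemma hAssoc (X Y Z T : A) : (hComp F Y Z T ▷ hom F X Y) ≫ hComp F X Y T =
    (α_ (hom F Z T) (hom F Y Z) (hom F X Y)).hom ≫ (hom F Z T ◁ hComp F X Y Z) ≫ hComp F X Z T :=
  HCategory.assoc X Y Z T

lemma post_comp (X : A) {Y Z T : A} (g : UHom F Y Z) (h : UHom F Z T) :
    post X g ≫ post X h = post X (ucomp g h) := by
  rw [post, post, post, ucomp]
  simp only [comp_whiskerRight, Category.assoc]
  rw [hAssoc, leftUnitor_inv_naturality_assoc, whisker_exchange_assoc,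
    leftUnitor_inv_naturality_assoc, whisker_exchange_assoc, MonoidalCategory.tensorHom_def]
  monoidal

lemma pre_comp {X Y Z : A} (f : UHom F X Y) (g : UHom F Y Z) (T : A) :
    pre g T ≫ pre f T = pre (ucomp f g) T := by
  rw [pre, pre, pre, ucomp]
  simp only [MonoidalCategory.whiskerLeft_comp, Category.assoc]
  rw [rightUnitor_inv_naturality_assoc, ← whisker_exchange_assoc, hAssoc,
    rightUnitor_inv_naturality_assoc, ← whisker_exchange_assoc, MonoidalCategory.tensorHom_def']
  monoidal

lemma post_pre {X Y Z T : A} (f : UHom F X Y) (h : UHom F Z T) :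
    post Y h ≫ pre f T = pre f Z ≫ post X h := by
  rw [post, pre, pre, post]
  simp only [Category.assoc]
  rw [rightUnitor_inv_naturality_assoc, ← whisker_exchange_assoc, hAssoc,
    leftUnitor_inv_naturality_assoc, whisker_exchange_assoc,
    leftUnitor_inv_naturality_assoc, whisker_exchange_assoc]
  monoidal

lemma id_ucomp {X Y : A} (f : UHom F X Y) : ucomp (hId F X) f = f := by
  rw [ucomp_eq_pre, pre_id, Category.comp_id]

lemma ucomp_id {X Y : A} (f : UHom F X Y) : ucomp f (hId F Y) = f := by
  rw [ucomp_eq_post, post_id, Category.comp_id]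

lemma ucomp_assoc {X Y Z T : A} (f : UHom F X Y) (g : UHom F Y Z) (h : UHom F Z T) :
    ucomp (ucomp f g) h = ucomp f (ucomp g h) := by
  rw [ucomp_eq_post f (ucomp g h), ← post_comp, ← Category.assoc, ← ucomp_eq_post, ← ucomp_eq_post]

variable (F A B) in
/-- A functor of `F`-enriched categories. -/
structure HFunctor where
  obj : A → B
  map (X Y : A) : hom F X Y ⟶ hom F (obj X) (obj Y)
  map_id (X : A) : hId F X ≫ map X X = hId F (obj X)
  map_comp (X Y Z : A) : hComp F X Y Z ≫ map X Z =
    (map Y Z ⊗ₘ map X Y) ≫ hComp F (obj X) (obj Y) (obj Z)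

namespace HFunctor

variable (F A) in
/-- The identity functor. -/
@[simps]
def id : HFunctor F A A where
  obj X := X
  map _ _ := 𝟙 _
  map_id _ := by simp
  map_comp _ _ _ := by simp

/-- The composite functor (first `S`, then `T`). -/
@[simps]
def comp (S : HFunctor F A B) (T : HFunctor F B C) : HFunctor F A C where
  obj X := T.obj (S.obj X)
  map X Y := S.map X Y ≫ T.map _ _
  map_id X := by rw [← Category.assoc, S.map_id, T.map_id]
  map_comp X Y Z := by
    rw [← Category.assoc, S.map_comp, Category.assoc, T.map_comp, tensorHom_comp_tensorHom_assoc]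

/-- The action of a functor on morphisms of the underlying categories. -/
def umap (S : HFunctor F A B) {X Y : A} (f : UHom F X Y) : UHom F (S.obj X) (S.obj Y) :=
  f ≫ S.map X Y

lemma umap_hId (U : HFunctor F A B) (X : A) : U.umap (hId F X) = hId F (U.obj X) :=
  U.map_id X

lemma umap_ucomp (U : HFunctor F A B) {X Y Z : A} (f : UHom F X Y) (g : UHom F Y Z) :
    U.umap (ucomp f g) = ucomp (U.umap f) (U.umap g) := by
  simp only [umap, ucomp, Category.assoc, U.map_comp, tensorHom_comp_tensorHom_assoc]

lemma umap_one {X Y : A} (f : UHom F X Y) : (HFunctor.id F A).umap f = f :=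
  Category.comp_id f

end HFunctor

/-- Invertible `F`-natural transformations `S ⟹ T`. -/
structure HNatIso (S T : HFunctor F A B) where
  hom (X : A) : UHom F (S.obj X) (T.obj X)
  inv (X : A) : UHom F (T.obj X) (S.obj X)
  hom_inv (X : A) : ucomp (hom X) (inv X) = hId F (S.obj X)
  inv_hom (X : A) : ucomp (inv X) (hom X) = hId F (T.obj X)
  naturality (X Y : A) : S.map X Y ≫ post (S.obj X) (hom Y) = T.map X Y ≫ pre (hom X) (T.obj Y)

lemma HNatIso.unat {S T : HFunctor F A B} (θ : HNatIso S T) {X Y : A} (f : UHom F X Y) :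
    ucomp (S.umap f) (θ.hom Y) = ucomp (θ.hom X) (T.umap f) := by
  rw [ucomp_eq_post, ucomp_eq_pre, HFunctor.umap, HFunctor.umap, Category.assoc, θ.naturality,
    Category.assoc]

end Enriched

/-! ### The vertical tensor product of enriched categories -/

section VerticalTensor

variable {F : Type u} [Category.{v} F] [MonoidalCategory F] [VerticalMonoidal F] [Duoidal F]
variable {A : Type w₁} {B : Type w₂} {C : Type w₃} {D : Type w₄}
  [HCategory F A] [HCategory F B] [HCategory F C] [HCategory F D]

/-- The tensor product `𝒜 ∘ ℬ`, with objects the pairs and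
`(𝒜 ∘ ℬ)((X,Y),(X',Y')) = 𝒜(X,X') ∘ ℬ(Y,Y')`. -/
instance prodHCategory : HCategory F (A × B) where
  Hom X Y := hom F X.1 Y.1 ∘ᵥ hom F X.2 Y.2
  id X := δJ F ≫ (hId F X.1 ∘ᵥₘ hId F X.2)
  comp X Y Z := γ (hom F Y.1 Z.1) (hom F Y.2 Z.2) (hom F X.1 Y.1) (hom F X.2 Y.2) ≫
    (hComp F X.1 Y.1 Z.1 ∘ᵥₘ hComp F X.2 Y.2 Z.2)
  id_comp X Y := by
    rw [comp_whiskerRight, Category.assoc, γ_nat_left_assoc, vHom_comp, HCategory.id_comp,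
      HCategory.id_comp, δ_left]
  comp_id X Y := by
    rw [MonoidalCategory.whiskerLeft_comp, Category.assoc, γ_nat_right_assoc, vHom_comp,
      HCategory.comp_id, HCategory.comp_id, δ_right]
  assoc X Y Z T := by
    rw [comp_whiskerRight, MonoidalCategory.whiskerLeft_comp, Category.assoc, Category.assoc,
      γ_nat_left_assoc, γ_nat_right_assoc, vHom_comp, vHom_comp,
      HCategory.assoc, HCategory.assoc]
    have h := Duoidal.γ_assoc_h (hom F Z.1 T.1) (hom F Z.2 T.2) (hom F Y.1 Z.1) (hom F Y.2 Z.2)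
      (hom F X.1 Y.1) (hom F X.2 Y.2)
    rw [← vHom_comp, reassoc_of% h]

/-- The unit `𝟭̄` for `∘`: one object, with hom-object the vertical unit `𝟭`. -/
instance unitHCategory : HCategory F Unit where
  Hom _ _ := vUnit F
  id _ := τ F
  comp _ _ _ := μ₁ F
  id_comp _ _ := Duoidal.unitMon.one_mul
  comp_id _ _ := Duoidal.unitMon.mul_one
  assoc _ _ _ _ := Duoidal.unitMon.mul_assoc

namespace HFunctor

/-- The functor `S ∘ T : 𝒜 ∘ ℬ ⟶ 𝒞 ∘ 𝒟`. -/
@[simps]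
def prod (S : HFunctor F A C) (T : HFunctor F B D) : HFunctor F (A × B) (C × D) where
  obj X := (S.obj X.1, T.obj X.2)
  map X Y := S.map X.1 Y.1 ∘ᵥₘ T.map X.2 Y.2
  map_id X := by
    dsimp only [hId, HCategory.id]
    rw [Category.assoc, vHom_comp, S.map_id, T.map_id]
  map_comp X Y Z := by
    dsimp only [hComp, HCategory.comp]
    rw [Category.assoc, vHom_comp, S.map_comp, T.map_comp, γ_nat_assoc, vHom_comp]

variable (F A B C) in
/-- The associativity isomorphism `(𝒜 ∘ ℬ) ∘ 𝒞 ⟶ 𝒜 ∘ (ℬ ∘ 𝒞)`. -/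
@[simps]
def associator : HFunctor F ((A × B) × C) (A × (B × C)) where
  obj X := (X.1.1, (X.1.2, X.2))
  map X Y := (vα (hom F X.1.1 Y.1.1) (hom F X.1.2 Y.1.2) (hom F X.2 Y.2)).hom
  map_id X := by
    dsimp only [hId, HCategory.id]
    have h1 : ((δJ F ≫ (hId F X.1.1 ∘ᵥₘ hId F X.1.2)) ∘ᵥₘ hId F X.2) =
        (δJ F ∘ᵥₘ 𝟙 (𝟙_ F)) ≫ ((hId F X.1.1 ∘ᵥₘ hId F X.1.2) ∘ᵥₘ hId F X.2) := by
      rw [vHom_comp, Category.id_comp]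
    have h2 : (hId F X.1.1 ∘ᵥₘ (δJ F ≫ (hId F X.1.2 ∘ᵥₘ hId F X.2))) =
        (𝟙 (𝟙_ F) ∘ᵥₘ δJ F) ≫ (hId F X.1.1 ∘ᵥₘ (hId F X.1.2 ∘ᵥₘ hId F X.2)) := by
      rw [vHom_comp, Category.id_comp]
    rw [h1, h2, ← reassoc_of% δJ_coassoc (F := F), ← vα_nat]
    simp only [Category.assoc]
  map_comp X Y Z := by
    dsimp only [hComp, HCategory.comp]
    have h1 : ((γ (hom F Y.1.1 Z.1.1) (hom F Y.1.2 Z.1.2) (hom F X.1.1 Y.1.1) (hom F X.1.2 Y.1.2) ≫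
        (hComp F X.1.1 Y.1.1 Z.1.1 ∘ᵥₘ hComp F X.1.2 Y.1.2 Z.1.2)) ∘ᵥₘ hComp F X.2 Y.2 Z.2) =
        (γ _ _ _ _ ∘ᵥₘ 𝟙 _) ≫ ((hComp F X.1.1 Y.1.1 Z.1.1 ∘ᵥₘ hComp F X.1.2 Y.1.2 Z.1.2) ∘ᵥₘ
          hComp F X.2 Y.2 Z.2) := by
      rw [vHom_comp, Category.id_comp]
    have h2 : (hComp F X.1.1 Y.1.1 Z.1.1 ∘ᵥₘ (γ (hom F Y.1.2 Z.1.2) (hom F Y.2 Z.2)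
        (hom F X.1.2 Y.1.2) (hom F X.2 Y.2) ≫
        (hComp F X.1.2 Y.1.2 Z.1.2 ∘ᵥₘ hComp F X.2 Y.2 Z.2))) =
        (𝟙 _ ∘ᵥₘ γ _ _ _ _) ≫ (hComp F X.1.1 Y.1.1 Z.1.1 ∘ᵥₘ (hComp F X.1.2 Y.1.2 Z.1.2 ∘ᵥₘ
          hComp F X.2 Y.2 Z.2)) := by
      rw [vHom_comp, Category.id_comp]
    rw [h1, h2, Category.assoc, Category.assoc, vα_nat]
    have := Duoidal.γ_assoc_v (hom F Y.1.1 Z.1.1) (hom F Y.1.2 Z.1.2) (hom F Y.2 Z.2)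
      (hom F X.1.1 Y.1.1) (hom F X.1.2 Y.1.2) (hom F X.2 Y.2)
    simp only [← Category.assoc] at this ⊢
    exact congrArg (fun f => f ≫ _) this

variable (F A) in
/-- The isomorphism `𝒜 ⟶ 𝟭̄ ∘ 𝒜`. -/
@[simps]
def leftUnitorInv : HFunctor F A (Unit × A) where
  obj X := ((), X)
  map X Y := (vl (hom F X Y)).inv
  map_id X := by
    dsimp only [hId, HCategory.id]
    rw [Iso.comp_inv_eq, Category.assoc, ← Category.comp_id (τ F),
      ← Category.id_comp (HCategory.id X), ← vHom_comp, Category.assoc, vl_nat,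
      reassoc_of% δJ_counit_left (F := F)]
    simp
  map_comp X Y Z := by
    dsimp only [hComp, HCategory.comp]
    have := Duoidal.μ_left (hom F Y Z) (hom F X Y)
    have h : (μ₁ F ∘ᵥₘ hComp F X Y Z) = (μ₁ F ∘ᵥₘ 𝟙 _) ≫ (𝟙 _ ∘ᵥₘ hComp F X Y Z) := by
      rw [vHom_comp, Category.id_comp, Category.comp_id]
    rw [h, Iso.comp_inv_eq, Category.assoc, Category.assoc, Category.assoc, vl_nat]
    refine Eq.trans ?_ (congrArg (fun f => ((vl (hom F Y Z)).inv ⊗ₘ (vl (hom F X Y)).inv) ≫ f ≫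
      hComp F X Y Z) this).symm |>.trans (by simp only [Category.assoc]; rfl)
    rw [tensorHom_comp_tensorHom_assoc]
    simp

variable (F A) in
/-- The isomorphism `𝒜 ⟶ 𝒜 ∘ 𝟭̄`. -/
@[simps]
def rightUnitorInv : HFunctor F A (A × Unit) where
  obj X := (X, ())
  map X Y := (vr (hom F X Y)).inv
  map_id X := by
    dsimp only [hId, HCategory.id]
    rw [Iso.comp_inv_eq, Category.assoc, ← Category.comp_id (τ F),
      ← Category.id_comp (HCategory.id X), ← vHom_comp, Category.assoc, vr_nat,
      reassoc_of% δJ_counit_right (F := F)]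
    simp
  map_comp X Y Z := by
    dsimp only [hComp, HCategory.comp]
    have := Duoidal.μ_right (hom F Y Z) (hom F X Y)
    have h : (hComp F X Y Z ∘ᵥₘ μ₁ F) = (𝟙 _ ∘ᵥₘ μ₁ F) ≫ (hComp F X Y Z ∘ᵥₘ 𝟙 _) := by
      rw [vHom_comp, Category.id_comp, Category.comp_id]
    rw [h, Iso.comp_inv_eq, Category.assoc, Category.assoc, Category.assoc, vr_nat]
    refine Eq.trans ?_ (congrArg (fun f => ((vr (hom F Y Z)).inv ⊗ₘ (vr (hom F X Y)).inv) ≫ f ≫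
      hComp F X Y Z) this).symm |>.trans (by simp only [Category.assoc]; rfl)
    rw [tensorHom_comp_tensorHom_assoc]
    simp

end HFunctor

/-- The morphism `(f, g)` of the underlying category of `𝒜 ∘ ℬ`. -/
def upair {X X' : A} {Y Y' : B} (f : UHom F X X') (g : UHom F Y Y') : UHom F (X, Y) (X', Y') :=
  δJ F ≫ (f ∘ᵥₘ g)

lemma upair_id (X : A) (Y : B) : upair (hId F X) (hId F Y) = hId F (X, Y) := rfl

lemma upair_ucomp {X X' X'' : A} {Y Y' Y'' : B} (f : UHom F X X') (f' : UHom F X' X'')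
    (g : UHom F Y Y') (g' : UHom F Y' Y'') :
    upair (ucomp f f') (ucomp g g') = ucomp (upair f g) (upair f' g') := by
  have h : (δJ F ▷ (𝟙_ F ∘ᵥ 𝟙_ F)) ≫ γ (𝟙_ F) (𝟙_ F) (𝟙_ F) (𝟙_ F) =
      (λ_ (𝟙_ F ∘ᵥ 𝟙_ F)).hom ≫ ((λ_ (𝟙_ F)).inv ∘ᵥₘ (λ_ (𝟙_ F)).inv) := by
    rw [← δ_left_assoc, vHom_comp, Iso.hom_inv_id, vHom_id]
    exact congrArg (fun k => _ ≫ k) (Category.comp_id _).symm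
  simp only [upair, ucomp]
  dsimp only [hComp, HCategory.comp]
  rw [← tensorHom_comp_tensorHom_assoc]
  refine Eq.trans ?_ (congrArg (fun k => _ ≫ _ ≫ k) (γ_nat_assoc _ _ _ _ _)).symm
  rw [MonoidalCategory.tensorHom_def' (δJ F), Category.assoc, reassoc_of% h,
    ← leftUnitor_inv_naturality_assoc, Iso.inv_hom_id_assoc, vHom_comp, vHom_comp]

namespace HFunctor

/-- The action on underlying morphisms of a functor of two variables. -/
def umap₂ (T : HFunctor F (A × B) C) {X X' : A} {Y Y' : B} (f : UHom F X X') (g : UHom F Y Y') :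
    UHom F (T.obj (X, Y)) (T.obj (X', Y')) := T.umap (upair f g)

end HFunctor

/-! ### Monoidal enriched categories -/

variable (F A) in
/-- A monoidal structure on an `F`-category `𝒜`: the structure of a pseudomonoid (monoidale) on
`𝒜` in the 2-category of `F`-categories with tensor product `∘` and unit `𝟭̄`. -/
structure HMonoidal where
  tensor : HFunctor F (A × A) A
  unit : HFunctor F Unit A
  assoc : HNatIso ((tensor.prod (HFunctor.id F A)).comp tensor)
    ((HFunctor.associator F A A A).comp (((HFunctor.id F A).prod tensor).comp tensor))
  left : HNatIso ((HFunctor.leftUnitorInv F A).comp ((unit.prod (HFunctor.id F A)).comp tensor))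
    (HFunctor.id F A)
  right : HNatIso ((HFunctor.rightUnitorInv F A).comp (((HFunctor.id F A).prod unit).comp tensor))
    (HFunctor.id F A)
  pentagon (X Y Z T : A) :
    ucomp (tensor.umap₂ (assoc.hom ((X, Y), Z)) (hId F T))
      (ucomp (assoc.hom ((X, tensor.obj (Y, Z)), T))
        (tensor.umap₂ (hId F X) (assoc.hom ((Y, Z), T)))) =
    ucomp (assoc.hom ((tensor.obj (X, Y), Z), T)) (assoc.hom ((X, Y), tensor.obj (Z, T)))
  triangle (X Y : A) :
    ucomp (assoc.hom ((X, unit.obj ()), Y)) (tensor.umap₂ (hId F X) (left.hom Y)) =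
      tensor.umap₂ (right.hom X) (hId F Y)

/-- A strong monoidal structure on an `F`-functor `T` between monoidal `F`-categories: invertible
`F`-natural `TX ∘ TY ⟶ T(X ∘ Y)` and `𝟭 ⟶ T𝟭`, compatible with the constraints. -/
structure StrongMonoidal (T : HFunctor F A B) (m : HMonoidal F A) (n : HMonoidal F B) where
  φ : HNatIso ((T.prod T).comp n.tensor) (m.tensor.comp T)
  φ₀ : HNatIso n.unit (m.unit.comp T)
  assoc (X Y Z : A) :
    ucomp (n.tensor.umap₂ (φ.hom (X, Y)) (hId F (T.obj Z)))
      (ucomp (φ.hom (m.tensor.obj (X, Y), Z)) (T.umap (m.assoc.hom ((X, Y), Z)))) =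
    ucomp (n.assoc.hom ((T.obj X, T.obj Y), T.obj Z))
      (ucomp (n.tensor.umap₂ (hId F (T.obj X)) (φ.hom (Y, Z))) (φ.hom (X, m.tensor.obj (Y, Z))))
  left (X : A) :
    ucomp (n.tensor.umap₂ (φ₀.hom ()) (hId F (T.obj X)))
      (ucomp (φ.hom (m.unit.obj (), X)) (T.umap (m.left.hom X))) = n.left.hom (T.obj X)
  right (X : A) :
    ucomp (n.tensor.umap₂ (hId F (T.obj X)) (φ₀.hom ()))
      (ucomp (φ.hom (X, m.unit.obj ())) (T.umap (m.right.hom X))) = n.right.hom (T.obj X)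

end VerticalTensor

/-! ### Left closedness and the self-enrichment -/

section Closed

/-- The horizontal structure is left closed: `F(X ∗ Y, Z) ≅ F(X, [Y, Z])`, with evaluation
`[Y, Z] ∗ Y ⟶ Z`. -/
class LeftClosed (F : Type u) [Category.{v} F] [MonoidalCategory F] where
  ihom : F → F → F
  ev (Y Z : F) : ihom Y Z ⊗ Y ⟶ Z
  curry {X Y Z : F} : (X ⊗ Y ⟶ Z) → (X ⟶ ihom Y Z)
  curry_ev {X Y Z : F} (f : X ⊗ Y ⟶ Z) : (curry f ▷ Y) ≫ ev Y Z = f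
  curry_uniq {X Y Z : F} (g : X ⟶ ihom Y Z) : curry ((g ▷ Y) ≫ ev Y Z) = g

variable {F : Type u} [Category.{v} F] [MonoidalCategory F] [LeftClosed F]

/-- The left internal hom `[Y, Z]`. -/
abbrev ihom (Y Z : F) : F := LeftClosed.ihom Y Z

/-- Evaluation. -/
abbrev ev (Y Z : F) : ihom Y Z ⊗ Y ⟶ Z := LeftClosed.ev Y Z

/-- The transpose of `X ∗ Y ⟶ Z`. -/
abbrev curry {X Y Z : F} (f : X ⊗ Y ⟶ Z) : X ⟶ ihom Y Z := LeftClosed.curry f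

lemma curry_ev {X Y Z : F} (f : X ⊗ Y ⟶ Z) : (curry f ▷ Y) ≫ ev Y Z = f := LeftClosed.curry_ev f

/-- The transpose `X ∗ Y ⟶ Z` of `X ⟶ [Y, Z]`. -/
def unc {X Y Z : F} (g : X ⟶ ihom Y Z) : X ⊗ Y ⟶ Z := (g ▷ Y) ≫ ev Y Z

lemma ihom_ext {X Y Z : F} {g g' : X ⟶ ihom Y Z} (h : unc g = unc g') : g = g' := by
  rw [← LeftClosed.curry_uniq g, ← LeftClosed.curry_uniq g']
  exact congrArg _ h

lemma unc_curry {X Y Z : F} (f : X ⊗ Y ⟶ Z) : unc (curry f) = f := LeftClosed.curry_ev f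

lemma unc_id (Y Z : F) : unc (𝟙 (ihom Y Z)) = ev Y Z := by simp [unc]

lemma unc_comp {W X Y Z : F} (h : W ⟶ X) (g : X ⟶ ihom Y Z) :
    unc (h ≫ g) = (h ▷ Y) ≫ unc g := by simp [unc]

/-- Composition of internal homs. -/
def icomp (X Y Z : F) : ihom Y Z ⊗ ihom X Y ⟶ ihom X Z :=
  curry ((α_ (ihom Y Z) (ihom X Y) X).hom ≫ (ihom Y Z ◁ ev X Y) ≫ ev Y Z)

lemma unc_icomp {P Q X Y Z : F} (f : P ⟶ ihom Y Z) (g : Q ⟶ ihom X Y) :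
    unc ((f ⊗ₘ g) ≫ icomp X Y Z) = (α_ P Q X).hom ≫ (P ◁ unc g) ≫ unc f := by
  rw [unc_comp, icomp, unc_curry, MonoidalCategory.tensorHom_def']
  simp only [comp_whiskerRight, Category.assoc, unc]
  rw [associator_naturality_left_assoc, ← whisker_exchange_assoc,
    associator_naturality_middle_assoc]
  simp

lemma unc_icomp_left {P X Y Z : F} (f : P ⟶ ihom Y Z) :
    unc ((f ▷ ihom X Y) ≫ icomp X Y Z) = (α_ P _ X).hom ≫ (P ◁ ev X Y) ≫ unc f := by
  rw [← tensorHom_id, unc_icomp, unc_id]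

lemma unc_icomp_right {Q X Y Z : F} (g : Q ⟶ ihom X Y) :
    unc ((ihom Y Z ◁ g) ≫ icomp X Y Z) = (α_ _ Q X).hom ≫ (_ ◁ unc g) ≫ ev Y Z := by
  rw [← id_tensorHom, unc_icomp, unc_id]

/-- `F` as a category enriched in itself. -/
instance selfHCategory : HCategory F F where
  Hom X Y := ihom X Y
  id X := curry (λ_ X).hom
  comp X Y Z := icomp X Y Z
  id_comp X Y := ihom_ext (by
    rw [unc_icomp_left, unc_curry]
    simp [unc])
  comp_id X Y := ihom_ext (by
    rw [unc_icomp_right, unc_curry]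
    simp [unc])
  assoc X Y Z T := ihom_ext (by
    rw [unc_icomp_left, unc_comp, unc_icomp_right]
    simp only [icomp, unc_curry]
    simp)

lemma unc_hComp {P Q X Y Z : F} (f : P ⟶ ihom Y Z) (g : Q ⟶ ihom X Y) :
    unc ((f ⊗ₘ g) ≫ hComp F X Y Z) = (α_ P Q X).hom ≫ (P ◁ unc g) ≫ unc f := unc_icomp f g

/-- The element `J ⟶ [X, Y]` corresponding to a morphism `X ⟶ Y`. -/
def elem {X Y : F} (f : X ⟶ Y) : UHom F X Y := curry ((λ_ X).hom ≫ f)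

/-- The morphism `X ⟶ Y` corresponding to an element `J ⟶ [X, Y]`. -/
def ofElem {X Y : F} (g : UHom F X Y) : X ⟶ Y := (λ_ X).inv ≫ (g ▷ X) ≫ ev X Y

lemma unc_elem {X Y : F} (f : X ⟶ Y) : unc (elem f) = (λ_ X).hom ≫ f := unc_curry _

lemma elem_id (X : F) : elem (𝟙 X) = hId F X := by
  rw [elem, Category.comp_id]; rfl

lemma ucomp_elem {X Y Z : F} (f : X ⟶ Y) (g : Y ⟶ Z) :
    ucomp (elem f) (elem g) = elem (f ≫ g) := ihom_ext (by
  refine (unc_comp _ _).trans ?_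
  rw [unc_hComp, unc_elem, unc_elem, unc_elem]
  simp)

/-- A natural isomorphism of functors with values in the self-enriched category `F`, from a family
of isomorphisms in `F` that is natural in the transposed form. -/
def HNatIso.ofIso {A : Type w} [HCategory F A] {S T : HFunctor F A F}
    (e : ∀ X, S.obj X ≅ T.obj X)
    (nat : ∀ X Y, unc (S.map X Y) ≫ (e Y).hom = (Duo.hom F X Y ◁ (e X).hom) ≫ unc (T.map X Y)) :
    HNatIso S T where
  hom X := elem (e X).hom
  inv X := elem (e X).inv
  hom_inv X := by rw [ucomp_elem, Iso.hom_inv_id, elem_id]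
  inv_hom X := by rw [ucomp_elem, Iso.inv_hom_id, elem_id]
  naturality X Y := ihom_ext (by
    rw [post, pre, leftUnitor_inv_naturality_assoc, rightUnitor_inv_naturality_assoc,
      ← MonoidalCategory.tensorHom_def'_assoc, ← MonoidalCategory.tensorHom_def_assoc]
    refine (unc_comp _ _).trans (Eq.trans ?_ (unc_comp _ _).symm)
    rw [unc_hComp, unc_hComp, unc_elem, unc_elem]
    have := nat X Y
    simp only [id_whiskerLeft, MonoidalCategory.whiskerLeft_comp, Category.assoc,
      Iso.inv_hom_id_assoc] at this ⊢
    rw [← this]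
    simp)

end Closed

section SelfMonoidal

variable (F : Type u) [Category.{v} F] [MonoidalCategory F] [VerticalMonoidal F] [Duoidal F]
  [LeftClosed F]

variable {F} in
/-- The transpose `[X,X'] ∘ [Y,Y'] ⟶ [X ∘ Y, X' ∘ Y']` of
`([X,X'] ∘ [Y,Y']) ∗ (X ∘ Y) ⟶ ([X,X'] ∗ X) ∘ ([Y,Y'] ∗ Y) ⟶ X' ∘ Y'`. -/
def vMap (X X' Y Y' : F) : ihom X X' ∘ᵥ ihom Y Y' ⟶ ihom (X ∘ᵥ Y) (X' ∘ᵥ Y') :=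
  curry (γ (ihom X X') (ihom Y Y') X Y ≫ (ev X X' ∘ᵥₘ ev Y Y'))

lemma unc_vMap {R P Q : F} {X X' Y Y' : F} (h : R ⟶ P ∘ᵥ Q) (f : P ⟶ ihom X X')
    (g : Q ⟶ ihom Y Y') :
    unc ((h ≫ (f ∘ᵥₘ g)) ≫ vMap X X' Y Y') =
      (h ▷ (X ∘ᵥ Y)) ≫ γ P Q X Y ≫ (unc f ∘ᵥₘ unc g) := by
  rw [unc_comp, vMap, unc_curry, comp_whiskerRight, Category.assoc, γ_nat_left_assoc, vHom_comp]
  rfl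

/-- The functor `∘̂ : F ∘ F ⟶ F`. -/
@[simps obj]
def vTensor : HFunctor F (F × F) F where
  obj X := X.1 ∘ᵥ X.2
  map X Y := vMap X.1 Y.1 X.2 Y.2
  map_id X := ihom_ext (by
    refine (unc_vMap F _ _ _).trans (Eq.trans ?_ (unc_curry _).symm)
    rw [show unc (hId F X.1) = (λ_ X.1).hom from unc_curry _,
      show unc (hId F X.2) = (λ_ X.2).hom from unc_curry _]
    exact δ_left X.1 X.2)
  map_comp X Y Z := ihom_ext (by
    refine (unc_vMap F _ _ _).trans (Eq.trans ?_ (unc_hComp _ _).symm)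
    dsimp only [hComp, HCategory.comp]
    have h := Duoidal.γ_assoc_h (ihom Y.1 Z.1) (ihom Y.2 Z.2) (ihom X.1 Y.1) (ihom X.2 Y.2) X.1 X.2
    rw [icomp, icomp, unc_curry, unc_curry, ← vHom_comp]
    refine ((reassoc_of% h) _).trans ?_
    rw [vMap, vMap, unc_curry, unc_curry, MonoidalCategory.whiskerLeft_comp, Category.assoc,
      ← vHom_comp]
    exact congrArg (fun k => _ ≫ _ ≫ k) (γ_nat_right_assoc _ _ _ _ _).symm)

/-- The functor `⌜𝟭⌝ : 𝟭̄ ⟶ F`, given on homs by the transpose of `μ : 𝟭 ∗ 𝟭 ⟶ 𝟭`. -/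
@[simps obj]
def vUnitFunctor : HFunctor F Unit F where
  obj _ := vUnit F
  map _ _ := curry (μ₁ F)
  map_id _ := ihom_ext (by
    refine (unc_comp _ _).trans (Eq.trans ?_ (unc_curry _).symm)
    rw [unc_curry]
    exact Duoidal.unitMon.one_mul)
  map_comp _ _ _ := ihom_ext (by
    refine (unc_comp _ _).trans (Eq.trans ?_ (unc_hComp _ _).symm)
    rw [unc_curry]
    exact Duoidal.unitMon.mul_assoc)

lemma unc_vUnitFunctor (X Y : Unit) : unc ((vUnitFunctor F).map X Y) = μ₁ F := unc_curry _

lemma umap₂_elem {X X' Y Y' : F} (f : X ⟶ X') (g : Y ⟶ Y') :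
    (vTensor F).umap₂ (elem f) (elem g) = elem (f ∘ᵥₘ g) := ihom_ext (by
  rw [HFunctor.umap₂, HFunctor.umap, upair]
  refine (unc_vMap F _ _ _).trans (Eq.trans ?_ (unc_elem _).symm)
  rw [unc_elem, unc_elem, ← vHom_comp]
  exact δ_left_assoc _ _ _)

/-- `F` as a monoidal `F`-category `(F, ∘̂, ⌜𝟭⌝)`, with the constraints of the vertical
structure. -/
def selfMonoidal : HMonoidal F F where
  tensor := vTensor F
  unit := vUnitFunctor F
  assoc := HNatIso.ofIso (fun X => vα X.1.1 X.1.2 X.2) (fun X Y => by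
    have h := Duoidal.γ_assoc_v (ihom X.1.1 Y.1.1) (ihom X.1.2 Y.1.2) (ihom X.2 Y.2)
      X.1.1 X.1.2 X.2
    have e1 : unc ((vMap X.1.1 Y.1.1 X.1.2 Y.1.2 ∘ᵥₘ 𝟙 (ihom X.2 Y.2)) ≫
        vMap (X.1.1 ∘ᵥ X.1.2) (Y.1.1 ∘ᵥ Y.1.2) X.2 Y.2) = γ _ _ _ _ ≫
          ((γ _ _ _ _ ≫ (ev X.1.1 Y.1.1 ∘ᵥₘ ev X.1.2 Y.1.2)) ∘ᵥₘ ev X.2 Y.2) := by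
      have := unc_vMap F (𝟙 _) (vMap X.1.1 Y.1.1 X.1.2 Y.1.2) (𝟙 (ihom X.2 Y.2))
      rw [Category.id_comp, id_whiskerRight, Category.id_comp, unc_id] at this
      rw [this, vMap, unc_curry]
    have e2 : unc ((vα (ihom X.1.1 Y.1.1) (ihom X.1.2 Y.1.2) (ihom X.2 Y.2)).hom ≫
        (𝟙 (ihom X.1.1 Y.1.1) ∘ᵥₘ vMap X.1.2 Y.1.2 X.2 Y.2) ≫
        vMap X.1.1 Y.1.1 (X.1.2 ∘ᵥ X.2) (Y.1.2 ∘ᵥ Y.2)) = ((vα _ _ _).hom ▷ _) ≫ γ _ _ _ _ ≫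
          (ev X.1.1 Y.1.1 ∘ᵥₘ (γ _ _ _ _ ≫ (ev X.1.2 Y.1.2 ∘ᵥₘ ev X.2 Y.2))) := by
      rw [← Category.assoc, unc_vMap, unc_id, vMap, unc_curry]
    have h1 : (γ (ihom X.1.1 Y.1.1) (ihom X.1.2 Y.1.2) X.1.1 X.1.2 ≫
        (ev X.1.1 Y.1.1 ∘ᵥₘ ev X.1.2 Y.1.2) ∘ᵥₘ ev X.2 Y.2) =
        (γ _ _ _ _ ∘ᵥₘ 𝟙 _) ≫ ((ev X.1.1 Y.1.1 ∘ᵥₘ ev X.1.2 Y.1.2) ∘ᵥₘ ev X.2 Y.2) := by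
      rw [vHom_comp, Category.id_comp]
    have h2 : (ev X.1.1 Y.1.1 ∘ᵥₘ (γ (ihom X.1.2 Y.1.2) (ihom X.2 Y.2) X.1.2 X.2 ≫
        (ev X.1.2 Y.1.2 ∘ᵥₘ ev X.2 Y.2))) =
        (𝟙 _ ∘ᵥₘ γ _ _ _ _) ≫ (ev X.1.1 Y.1.1 ∘ᵥₘ (ev X.1.2 Y.1.2 ∘ᵥₘ ev X.2 Y.2)) := by
      rw [vHom_comp, Category.id_comp]
    rw [h1] at e1
    rw [h2] at e2
    refine (congrArg (fun k => k ≫ (vα Y.1.1 Y.1.2 Y.2).hom) e1).trans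
      (Eq.trans ?_ (congrArg (fun k => _ ≫ k) e2).symm)
    rw [Category.assoc, Category.assoc, vα_nat, reassoc_of% h,
      MonoidalCategory.tensorHom_def', Category.assoc]
    rfl)
  left := HNatIso.ofIso (fun X => vl X) (fun X Y => by
    have h := Duoidal.μ_left (ihom X Y) X
    have e1 : unc ((vl (ihom X Y)).inv ≫ (curry (μ₁ F) ∘ᵥₘ 𝟙 (ihom X Y)) ≫
        vMap (vUnit F) (vUnit F) X Y) = ((vl (ihom X Y)).inv ▷ _) ≫ γ _ _ _ _ ≫
          (μ₁ F ∘ᵥₘ ev X Y) := by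
      rw [← Category.assoc, unc_vMap, unc_id, unc_curry]
    have h1 : (μ₁ F ∘ᵥₘ ev X Y) = (μ₁ F ∘ᵥₘ 𝟙 _) ≫ (𝟙 _ ∘ᵥₘ ev X Y) := by
      rw [vHom_comp, Category.id_comp, Category.comp_id]
    refine (congrArg (fun k => k ≫ (vl Y).hom) e1).trans ?_
    rw [h1, Category.assoc, Category.assoc, Category.assoc, vl_nat, reassoc_of% h,
      MonoidalCategory.tensorHom_def, Category.assoc, inv_hom_whiskerRight_assoc]
    exact congrArg (fun k => _ ≫ k) (unc_id _ _).symm)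
  right := HNatIso.ofIso (fun X => vr X) (fun X Y => by
    have h := Duoidal.μ_right (ihom X Y) X
    have e1 : unc ((vr (ihom X Y)).inv ≫ (𝟙 (ihom X Y) ∘ᵥₘ curry (μ₁ F)) ≫
        vMap X Y (vUnit F) (vUnit F)) = ((vr (ihom X Y)).inv ▷ _) ≫ γ _ _ _ _ ≫
          (ev X Y ∘ᵥₘ μ₁ F) := by
      rw [← Category.assoc, unc_vMap, unc_id, unc_curry]
    have h1 : (ev X Y ∘ᵥₘ μ₁ F) = (𝟙 _ ∘ᵥₘ μ₁ F) ≫ (ev X Y ∘ᵥₘ 𝟙 _) := by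
      rw [vHom_comp, Category.id_comp, Category.comp_id]
    refine (congrArg (fun k => k ≫ (vr Y).hom) e1).trans ?_
    rw [h1, Category.assoc, Category.assoc, Category.assoc, vr_nat, reassoc_of% h,
      MonoidalCategory.tensorHom_def, Category.assoc, inv_hom_whiskerRight_assoc]
    exact congrArg (fun k => _ ≫ k) (unc_id _ _).symm)
  pentagon X Y Z T := by
    have h := congrArg elem (v_pentagon X Y Z T)
    rw [← ucomp_elem, ← ucomp_elem, ← ucomp_elem, ← umap₂_elem, ← umap₂_elem, elem_id, elem_id] at h
    exact h
  triangle X Y := by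
    have h := congrArg elem (v_triangle X Y)
    rw [← ucomp_elem, ← umap₂_elem, ← umap₂_elem, elem_id, elem_id] at h
    exact h

end SelfMonoidal

/-! ### Modules over a horizontal monoid -/

section Modules

open Limits

variable {F : Type u} [Category.{v} F] [MonoidalCategory F]

/-- A right module over a horizontal monoid `M`, that is, an algebra for the monad `- ∗ M`. -/
structure RMod (M : F) [MonObj M] where
  X : F
  act : X ⊗ M ⟶ X
  act_one : (X ◁ MonObj.one) ≫ act = (ρ_ X).hom
  act_mul : (X ◁ MonObj.mul) ≫ act = (α_ X M M).inv ≫ (act ▷ M) ≫ act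

variable [LeftClosed F]

/-- `[f, 1] : [X', Z] ⟶ [X, Z]`. -/
def preHom {X X' : F} (f : X ⟶ X') (Z : F) : ihom X' Z ⟶ ihom X Z :=
  curry ((ihom X' Z ◁ f) ≫ ev X' Z)

/-- `[1, g] : [X, Z] ⟶ [X, Z']`. -/
def postHom (X : F) {Z Z' : F} (g : Z ⟶ Z') : ihom X Z ⟶ ihom X Z' :=
  curry (ev X Z ≫ g)

/-- `- ∗ M : [X, Y] ⟶ [X ∗ M, Y ∗ M]`. -/
def starHom (M X Y : F) : ihom X Y ⟶ ihom (X ⊗ M) (Y ⊗ M) :=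
  curry ((α_ (ihom X Y) X M).inv ≫ (ev X Y ▷ M))

variable {M : F} [MonObj M]

lemma mod_condition_iff {P : F} {A B : RMod M} (f : P ⟶ ihom A.X B.X) :
    f ≫ preHom A.act B.X = f ≫ starHom M A.X B.X ≫ postHom (A.X ⊗ M) B.act ↔
      (P ◁ A.act) ≫ unc f = (α_ P A.X M).inv ≫ (unc f ▷ M) ≫ B.act := by
  have h1 : unc (f ≫ preHom A.act B.X) = (P ◁ A.act) ≫ unc f := by
    rw [unc_comp, preHom, unc_curry, ← whisker_exchange_assoc]
    rfl
  have h2 : unc (f ≫ starHom M A.X B.X ≫ postHom (A.X ⊗ M) B.act) =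
      (α_ P A.X M).inv ≫ (unc f ▷ M) ≫ B.act := by
    rw [unc_comp, unc_comp, postHom, unc_curry]
    have h3 : starHom M A.X B.X ▷ (A.X ⊗ M) ≫ ev (A.X ⊗ M) (B.X ⊗ M) =
      (α_ (ihom A.X B.X) A.X M).inv ≫ (ev A.X B.X ▷ M) := unc_curry _
    rw [reassoc_of% h3]
    simp [unc]
  rw [← h1, ← h2]
  exact ⟨fun h => congrArg _ h, fun h => ihom_ext h⟩

variable (M) in
/-- The equalizers of `[α, 1], [1, β] (- ∗ M) : [A, B] ⇉ [A ∗ M, B]`, for all right `M`-modules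
`(A, α)` and `(B, β)`, exist; these are the hom-objects of the Eilenberg-Moore category. -/
class HasModHoms : Prop where
  hasEqualizer (A B : RMod M) :
    HasEqualizer (preHom A.act B.X) (starHom M A.X B.X ≫ postHom (A.X ⊗ M) B.act)

attribute [instance] HasModHoms.hasEqualizer

variable [HasModHoms M]

/-- The hom-object of the Eilenberg-Moore category. -/
noncomputable def modHom (A B : RMod M) : F :=
  equalizer (preHom A.act B.X) (starHom M A.X B.X ≫ postHom (A.X ⊗ M) B.act)

/-- The inclusion of the hom-object of modules in `[A, B]`. -/
noncomputable def modι (A B : RMod M) : modHom A B ⟶ ihom A.X B.X := equalizer.ι _ _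

instance (A B : RMod M) : Mono (modι A B) := inferInstanceAs (Mono (equalizer.ι _ _))

lemma modι_condition (A B : RMod M) :
    (modHom A B ◁ A.act) ≫ unc (modι A B) = (α_ _ A.X M).inv ≫ (unc (modι A B) ▷ M) ≫ B.act :=
  (mod_condition_iff _).1 (equalizer.condition _ _)

/-- The universal property of the hom-object of modules. -/
noncomputable def modLift {P : F} {A B : RMod M} (f : P ⟶ ihom A.X B.X)
    (h : (P ◁ A.act) ≫ unc f = (α_ P A.X M).inv ≫ (unc f ▷ M) ≫ B.act) : P ⟶ modHom A B :=
  equalizer.lift f ((mod_condition_iff f).2 h)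

lemma modLift_ι {P : F} {A B : RMod M} (f : P ⟶ ihom A.X B.X)
    (h : (P ◁ A.act) ≫ unc f = (α_ P A.X M).inv ≫ (unc f ▷ M) ≫ B.act) :
    modLift f h ≫ modι A B = f := equalizer.lift_ι _ _

/-- Composition of hom-objects of modules. -/
noncomputable def modComp (A B C : RMod M) : modHom B C ⊗ modHom A B ⟶ modHom A C :=
  modLift ((modι B C ⊗ₘ modι A B) ≫ hComp F A.X B.X C.X) (by
    rw [unc_hComp]
    have h1 := modι_condition A B
    have h2 := modι_condition B C
    rw [associator_naturality_right_assoc, ← MonoidalCategory.whiskerLeft_comp_assoc, h1]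
    simp only [MonoidalCategory.whiskerLeft_comp, Category.assoc, h2]
    simp)

lemma modComp_ι (A B C : RMod M) :
    modComp A B C ≫ modι A C = (modι B C ⊗ₘ modι A B) ≫ hComp F A.X B.X C.X := modLift_ι _ _

/-- The Eilenberg-Moore `F`-category `F^{∗M}` of right `M`-modules: hom-objects are the equalizers
`modHom`, with the identities and composition of the self-enriched category `F`. -/
noncomputable instance modHCategory : HCategory F (RMod M) where
  Hom A B := modHom A B
  id A := modLift (hId F A.X) (by
    rw [show unc (hId F A.X) = (λ_ A.X).hom from unc_curry _]
    simp)
  comp A B C := modComp A B C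
  id_comp A B := by
    rw [← cancel_mono (modι A B), Category.assoc, modComp_ι, ← Category.assoc,
      MonoidalCategory.tensorHom_def, ← comp_whiskerRight_assoc, modLift_ι,
      ← whisker_exchange, Category.assoc]
    refine (congrArg (fun k => _ ≫ k) (HCategory.id_comp (F := F) A.X B.X)).trans ?_
    exact leftUnitor_naturality _
  comp_id A B := by
    rw [← cancel_mono (modι A B), Category.assoc, modComp_ι, ← Category.assoc,
      MonoidalCategory.tensorHom_def', ← MonoidalCategory.whiskerLeft_comp_assoc, modLift_ι,
      whisker_exchange, Category.assoc]
    refine (congrArg (fun k => _ ≫ k) (HCategory.comp_id (F := F) A.X B.X)).trans ?_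
    exact rightUnitor_naturality _
  assoc A B C D := by
    rw [← cancel_mono (modι A D)]
    simp only [Category.assoc, modComp_ι]
    rw [← tensorHom_id, ← id_tensorHom, tensorHom_comp_tensorHom_assoc,
      tensorHom_comp_tensorHom_assoc, modComp_ι, modComp_ι, Category.id_comp, Category.id_comp,
      ← Category.comp_id (modι A B), ← Category.comp_id (modι C D),
      ← tensorHom_comp_tensorHom_assoc, ← tensorHom_comp_tensorHom_assoc, tensorHom_id,
      id_tensorHom, Category.comp_id, Category.comp_id, ← associator_naturality_assoc]
    exact congrArg (fun k => _ ≫ k) (HCategory.assoc (F := F) A.X B.X C.X D.X)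

/-- The forgetful functor `U_M : F^{∗M} ⟶ F`. -/
noncomputable def forgetMod (M : F) [MonObj M] [HasModHoms M] : HFunctor F (RMod M) F where
  obj A := A.X
  map A B := modι A B
  map_id _ := modLift_ι _ _
  map_comp A B C := modComp_ι A B C

end Modules

/-! ### Isomorphism classes of monoidal structures over a functor -/

section Over

variable {F : Type u} [Category.{v} F] [MonoidalCategory F] [VerticalMonoidal F] [Duoidal F]
variable {A : Type w₁} {B : Type w₂} [HCategory F A] [HCategory F B]

/-- A monoidal structure on `𝒜` for which `U : 𝒜 ⟶ ℬ` is strong monoidal. -/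
structure MonoidalOver (U : HFunctor F A B) (n : HMonoidal F B) where
  mon : HMonoidal F A
  strong : StrongMonoidal U mon n

/-- An isomorphism of monoidal structures over `U`: the identity functor of `𝒜` is strong monoidal
from the first structure to the second, by constraints which `U` sends to the comparison of the
strong monoidal constraints of `U`. -/
structure OverIso {U : HFunctor F A B} {n : HMonoidal F B} (S T : MonoidalOver U n) where
  iso : StrongMonoidal (HFunctor.id F A) S.mon T.mon
  φ_comp (X Y : A) : S.strong.φ.hom (X, Y) =
    ucomp (T.strong.φ.hom (X, Y)) (U.umap (iso.φ.hom (X, Y)))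
  φ₀_comp : S.strong.φ₀.hom () = ucomp (T.strong.φ₀.hom ()) (U.umap (iso.φ₀.hom ()))

lemma HMonoidal.tensor_id (m : HMonoidal F A) (X Y : A) :
    m.tensor.umap₂ (hId F X) (hId F Y) = hId F (m.tensor.obj (X, Y)) := by
  rw [HFunctor.umap₂, upair_id, HFunctor.umap_hId]

lemma HMonoidal.tensor_ucomp (m : HMonoidal F A) {X X' X'' Y Y' Y'' : A} (f : UHom F X X')
    (f' : UHom F X' X'') (g : UHom F Y Y') (g' : UHom F Y' Y'') :
    m.tensor.umap₂ (ucomp f f') (ucomp g g') =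
      ucomp (m.tensor.umap₂ f g) (m.tensor.umap₂ f' g') := by
  rw [HFunctor.umap₂, upair_ucomp, HFunctor.umap_ucomp]
  rfl

lemma HMonoidal.tensor_ucomp_left (m : HMonoidal F A) {X X' X'' : A} (f : UHom F X X')
    (f' : UHom F X' X'') (Y : A) : m.tensor.umap₂ (ucomp f f') (hId F Y) =
      ucomp (m.tensor.umap₂ f (hId F Y)) (m.tensor.umap₂ f' (hId F Y)) := by
  rw [← m.tensor_ucomp, id_ucomp]

lemma HMonoidal.tensor_ucomp_right (m : HMonoidal F A) (X : A) {Y Y' Y'' : A} (g : UHom F Y Y')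
    (g' : UHom F Y' Y'') : m.tensor.umap₂ (hId F X) (ucomp g g') =
      ucomp (m.tensor.umap₂ (hId F X) g) (m.tensor.umap₂ (hId F X) g') := by
  rw [← m.tensor_ucomp, id_ucomp]

/-- The components of the associativity constraint. -/
def HMonoidal.a (m : HMonoidal F A) (X Y Z : A) :
    UHom F (m.tensor.obj (m.tensor.obj (X, Y), Z)) (m.tensor.obj (X, m.tensor.obj (Y, Z))) :=
  m.assoc.hom ((X, Y), Z)

/-- The components of the left unit constraint. -/
def HMonoidal.l (m : HMonoidal F A) (X : A) : UHom F (m.tensor.obj (m.unit.obj (), X)) X :=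
  m.left.hom X

/-- The components of the right unit constraint. -/
def HMonoidal.r (m : HMonoidal F A) (X : A) : UHom F (m.tensor.obj (X, m.unit.obj ())) X :=
  m.right.hom X

namespace StrongMonoidal

variable {l m n : HMonoidal F A}

/-- The tensor constraint of an identity functor. -/
def c (s : StrongMonoidal (HFunctor.id F A) m n) (X Y : A) :
    UHom F (n.tensor.obj (X, Y)) (m.tensor.obj (X, Y)) := s.φ.hom (X, Y)

/-- The inverse tensor constraint of an identity functor. -/
def d (s : StrongMonoidal (HFunctor.id F A) m n) (X Y : A) :
    UHom F (m.tensor.obj (X, Y)) (n.tensor.obj (X, Y)) := s.φ.inv (X, Y)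

/-- The unit constraint of an identity functor. -/
def c₀ (s : StrongMonoidal (HFunctor.id F A) m n) : UHom F (n.unit.obj ()) (m.unit.obj ()) :=
  s.φ₀.hom ()

/-- The inverse unit constraint of an identity functor. -/
def d₀ (s : StrongMonoidal (HFunctor.id F A) m n) : UHom F (m.unit.obj ()) (n.unit.obj ()) :=
  s.φ₀.inv ()

lemma c_nat (s : StrongMonoidal (HFunctor.id F A) m n) {X X' Y Y' : A} (f : UHom F X X')
    (g : UHom F Y Y') :
    ucomp (n.tensor.umap₂ f g) (s.c X' Y') = ucomp (s.c X Y) (m.tensor.umap₂ f g) := by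
  have h := s.φ.unat (upair f g)
  have e1 : (((HFunctor.id F A).prod (HFunctor.id F A)).comp n.tensor).umap (upair f g) =
      n.tensor.umap₂ f g := congrArg (fun k => upair f g ≫ k)
    ((congrArg (fun k => k ≫ n.tensor.map (X, Y) (X', Y')) (vHom_id _ _)).trans (Category.id_comp _))
  have e2 : (m.tensor.comp (HFunctor.id F A)).umap (upair f g) = m.tensor.umap₂ f g :=
    congrArg (fun k => upair f g ≫ k) (Category.comp_id _)
  rw [e1, e2] at h
  exact h

lemma c_enat (s : StrongMonoidal (HFunctor.id F A) m n) (X Y : A × A) :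
    n.tensor.map X Y ≫ post (n.tensor.obj X) (s.c Y.1 Y.2) =
      m.tensor.map X Y ≫ pre (s.c X.1 X.2) (m.tensor.obj Y) := by
  have h := s.φ.naturality X Y
  have e1 : (((HFunctor.id F A).prod (HFunctor.id F A)).comp n.tensor).map X Y =
      n.tensor.map X Y :=
    (congrArg (fun k => k ≫ n.tensor.map X Y) (vHom_id _ _)).trans (Category.id_comp _)
  have e2 : (m.tensor.comp (HFunctor.id F A)).map X Y = m.tensor.map X Y := Category.comp_id _
  rw [e1, e2] at h
  exact h

lemma c₀_enat (s : StrongMonoidal (HFunctor.id F A) m n) :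
    n.unit.map () () ≫ post (n.unit.obj ()) s.c₀ = m.unit.map () () ≫ pre s.c₀ (m.unit.obj ()) := by
  have h := s.φ₀.naturality () ()
  have e2 : (m.unit.comp (HFunctor.id F A)).map () () = m.unit.map () () := Category.comp_id _
  rw [e2] at h
  exact h

lemma c_d (s : StrongMonoidal (HFunctor.id F A) m n) (X Y : A) :
    ucomp (s.c X Y) (s.d X Y) = hId F _ := s.φ.hom_inv (X, Y)

lemma d_c (s : StrongMonoidal (HFunctor.id F A) m n) (X Y : A) :
    ucomp (s.d X Y) (s.c X Y) = hId F _ := s.φ.inv_hom (X, Y)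

lemma d_nat (s : StrongMonoidal (HFunctor.id F A) m n) {X X' Y Y' : A} (f : UHom F X X')
    (g : UHom F Y Y') :
    ucomp (s.d X Y) (n.tensor.umap₂ f g) = ucomp (m.tensor.umap₂ f g) (s.d X' Y') := by
  rw [← ucomp_id (ucomp (s.d X Y) _), ← s.c_d, ← ucomp_assoc, ucomp_assoc (s.d X Y), s.c_nat,
    ← ucomp_assoc (s.d X Y), s.d_c, id_ucomp]

lemma c₀_d₀ (s : StrongMonoidal (HFunctor.id F A) m n) : ucomp s.c₀ s.d₀ = hId F _ :=
  s.φ₀.hom_inv ()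

lemma d₀_c₀ (s : StrongMonoidal (HFunctor.id F A) m n) : ucomp s.d₀ s.c₀ = hId F _ :=
  s.φ₀.inv_hom ()

lemma c_assoc (s : StrongMonoidal (HFunctor.id F A) m n) (X Y Z : A) :
    ucomp (n.tensor.umap₂ (s.c X Y) (hId F Z))
      (ucomp (s.c (m.tensor.obj (X, Y)) Z) (m.a X Y Z)) =
    ucomp (n.a X Y Z)
      (ucomp (n.tensor.umap₂ (hId F X) (s.c Y Z)) (s.c X (m.tensor.obj (Y, Z)))) :=
  (congrArg (fun k => ucomp (n.tensor.umap₂ (s.c X Y) (hId F Z))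
    (ucomp (s.c (m.tensor.obj (X, Y)) Z) k)) (HFunctor.umap_one (m.a X Y Z)).symm).trans
    (s.assoc X Y Z)

lemma c_left (s : StrongMonoidal (HFunctor.id F A) m n) (X : A) :
    ucomp (n.tensor.umap₂ s.c₀ (hId F X)) (ucomp (s.c (m.unit.obj ()) X) (m.l X)) = n.l X :=
  (congrArg (fun k => ucomp (n.tensor.umap₂ s.c₀ (hId F X)) (ucomp (s.c (m.unit.obj ()) X) k))
    (HFunctor.umap_one (m.l X)).symm).trans (s.left X)

lemma c_right (s : StrongMonoidal (HFunctor.id F A) m n) (X : A) :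
    ucomp (n.tensor.umap₂ (hId F X) s.c₀) (ucomp (s.c X (m.unit.obj ())) (m.r X)) = n.r X :=
  (congrArg (fun k => ucomp (n.tensor.umap₂ (hId F X) s.c₀) (ucomp (s.c X (m.unit.obj ())) k))
    (HFunctor.umap_one (m.r X)).symm).trans (s.right X)

/-- A constructor for strong monoidal structures on an identity functor. -/
def mkId (c : ∀ X Y : A, UHom F (n.tensor.obj (X, Y)) (m.tensor.obj (X, Y)))
    (d : ∀ X Y : A, UHom F (m.tensor.obj (X, Y)) (n.tensor.obj (X, Y)))
    (c₀ : UHom F (n.unit.obj ()) (m.unit.obj ())) (d₀ : UHom F (m.unit.obj ()) (n.unit.obj ()))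
    (c_d : ∀ X Y, ucomp (c X Y) (d X Y) = hId F _) (d_c : ∀ X Y, ucomp (d X Y) (c X Y) = hId F _)
    (c₀_d₀ : ucomp c₀ d₀ = hId F _) (d₀_c₀ : ucomp d₀ c₀ = hId F _)
    (c_enat : ∀ X Y : A × A, n.tensor.map X Y ≫ post (n.tensor.obj X) (c Y.1 Y.2) =
      m.tensor.map X Y ≫ pre (c X.1 X.2) (m.tensor.obj Y))
    (c₀_enat : n.unit.map () () ≫ post (n.unit.obj ()) c₀ =
      m.unit.map () () ≫ pre c₀ (m.unit.obj ()))
    (c_assoc : ∀ X Y Z : A, ucomp (n.tensor.umap₂ (c X Y) (hId F Z))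
        (ucomp (c (m.tensor.obj (X, Y)) Z) (m.a X Y Z)) =
      ucomp (n.a X Y Z)
        (ucomp (n.tensor.umap₂ (hId F X) (c Y Z)) (c X (m.tensor.obj (Y, Z)))))
    (c_left : ∀ X : A, ucomp (n.tensor.umap₂ c₀ (hId F X))
      (ucomp (c (m.unit.obj ()) X) (m.l X)) = n.l X)
    (c_right : ∀ X : A, ucomp (n.tensor.umap₂ (hId F X) c₀)
      (ucomp (c X (m.unit.obj ())) (m.r X)) = n.r X) :
    StrongMonoidal (HFunctor.id F A) m n where
  φ :=
    { hom X := c X.1 X.2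
      inv X := d X.1 X.2
      hom_inv X := c_d X.1 X.2
      inv_hom X := d_c X.1 X.2
      naturality X Y := by
        have e1 : (((HFunctor.id F A).prod (HFunctor.id F A)).comp n.tensor).map X Y =
            n.tensor.map X Y :=
          (congrArg (fun k => k ≫ n.tensor.map X Y) (vHom_id _ _)).trans (Category.id_comp _)
        have e2 : (m.tensor.comp (HFunctor.id F A)).map X Y = m.tensor.map X Y :=
          Category.comp_id _
        rw [e1, e2]
        exact c_enat X Y }
  φ₀ :=
    { hom _ := c₀
      inv _ := d₀
      hom_inv _ := c₀_d₀
      inv_hom _ := d₀_c₀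
      naturality _ _ := by
        have e2 : (m.unit.comp (HFunctor.id F A)).map () () = m.unit.map () () :=
          Category.comp_id _
        rw [e2]
        exact c₀_enat }
  assoc X Y Z := (congrArg (fun k => ucomp (n.tensor.umap₂ (c X Y) (hId F Z))
    (ucomp (c (m.tensor.obj (X, Y)) Z) k)) (HFunctor.umap_one (m.a X Y Z))).trans (c_assoc X Y Z)
  left X := (congrArg (fun k => ucomp (n.tensor.umap₂ c₀ (hId F X))
    (ucomp (c (m.unit.obj ()) X) k)) (HFunctor.umap_one (m.l X))).trans (c_left X)
  right X := (congrArg (fun k => ucomp (n.tensor.umap₂ (hId F X) c₀)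
    (ucomp (c X (m.unit.obj ())) k)) (HFunctor.umap_one (m.r X))).trans (c_right X)

/-- The identity. -/
def refl (m : HMonoidal F A) : StrongMonoidal (HFunctor.id F A) m m :=
  mkId (fun _ _ => hId F _) (fun _ _ => hId F _) (hId F _) (hId F _)
    (fun _ _ => id_ucomp _) (fun _ _ => id_ucomp _) (id_ucomp _) (id_ucomp _)
    (fun _ _ => by rw [post_id, pre_id]) (by rw [post_id, pre_id])
    (fun X Y Z => by rw [m.tensor_id, m.tensor_id, id_ucomp, id_ucomp, id_ucomp, ucomp_id])
    (fun X => by rw [m.tensor_id, id_ucomp, id_ucomp])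
    (fun X => by rw [m.tensor_id, id_ucomp, id_ucomp])

/-- The inverse of a strong monoidal structure on an identity functor. -/
def symm (s : StrongMonoidal (HFunctor.id F A) m n) : StrongMonoidal (HFunctor.id F A) n m :=
  mkId s.d s.c s.d₀ s.c₀ s.d_c s.c_d s.d₀_c₀ s.c₀_d₀
    (fun X Y => by
      have h := s.c_enat X Y
      calc m.tensor.map X Y ≫ post (m.tensor.obj X) (s.d Y.1 Y.2)
          = m.tensor.map X Y ≫ pre (s.c X.1 X.2) (m.tensor.obj Y) ≫ pre (s.d X.1 X.2) _ ≫
              post (m.tensor.obj X) (s.d Y.1 Y.2) := by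
            rw [← Category.assoc (pre _ _), pre_comp, s.d_c, pre_id, Category.id_comp]
        _ = n.tensor.map X Y ≫ post _ (s.c Y.1 Y.2) ≫ post _ (s.d Y.1 Y.2) ≫
              pre (s.d X.1 X.2) _ := by
            rw [post_pre, ← Category.assoc, ← h, Category.assoc]
        _ = _ := by rw [← Category.assoc (post _ _), post_comp, s.c_d, post_id, Category.id_comp])
    (by
      have h := s.c₀_enat
      calc m.unit.map () () ≫ post (m.unit.obj ()) s.d₀
          = m.unit.map () () ≫ pre s.c₀ (m.unit.obj ()) ≫ pre s.d₀ _ ≫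
              post (m.unit.obj ()) s.d₀ := by
            rw [← Category.assoc (pre _ _), pre_comp, s.d₀_c₀, pre_id, Category.id_comp]
        _ = n.unit.map () () ≫ post _ s.c₀ ≫ post _ s.d₀ ≫ pre s.d₀ _ := by
            rw [post_pre, ← Category.assoc, ← h, Category.assoc]
        _ = _ := by rw [← Category.assoc (post _ _), post_comp, s.c₀_d₀, post_id, Category.id_comp])
    (fun X Y Z => by
      have h := s.c_assoc X Y Z
      rw [← ucomp_assoc, ← s.d_nat, ucomp_assoc]
      have h1 : n.a X Y Z = ucomp (n.tensor.umap₂ (s.c X Y) (hId F Z))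
          (ucomp (s.c (m.tensor.obj (X, Y)) Z) (ucomp (m.a X Y Z)
            (ucomp (s.d X (m.tensor.obj (Y, Z))) (n.tensor.umap₂ (hId F X) (s.d Y Z))))) := by
        rw [← ucomp_assoc (s.c _ _), ← ucomp_assoc, h, ucomp_assoc, ucomp_assoc,
          ← ucomp_assoc (s.c _ _) (s.d _ _), s.c_d, id_ucomp, ← n.tensor_ucomp_right, s.c_d,
          n.tensor_id, ucomp_id]
      rw [h1, ← ucomp_assoc (n.tensor.umap₂ _ _) (n.tensor.umap₂ _ _), ← n.tensor_ucomp_left,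
        s.d_c, n.tensor_id, id_ucomp, ← ucomp_assoc (s.d _ _) (s.c _ _), s.d_c, id_ucomp, s.d_nat])
    (fun X => by
      rw [← s.c_left X, ← ucomp_assoc, ← s.d_nat, ucomp_assoc,
        ← ucomp_assoc (n.tensor.umap₂ _ _) (n.tensor.umap₂ _ _), ← n.tensor_ucomp_left,
        s.d₀_c₀, n.tensor_id, id_ucomp, ← ucomp_assoc, s.d_c, id_ucomp])
    (fun X => by
      rw [← s.c_right X, ← ucomp_assoc, ← s.d_nat, ucomp_assoc,
        ← ucomp_assoc (n.tensor.umap₂ _ _) (n.tensor.umap₂ _ _), ← n.tensor_ucomp_right,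
        s.d₀_c₀, n.tensor_id, id_ucomp, ← ucomp_assoc, s.d_c, id_ucomp])

/-- The composite of strong monoidal structures on identity functors. -/
def trans (s : StrongMonoidal (HFunctor.id F A) l m) (t : StrongMonoidal (HFunctor.id F A) m n) :
    StrongMonoidal (HFunctor.id F A) l n :=
  mkId (fun X Y => ucomp (t.c X Y) (s.c X Y)) (fun X Y => ucomp (s.d X Y) (t.d X Y))
    (ucomp t.c₀ s.c₀) (ucomp s.d₀ t.d₀)
    (fun X Y => by rw [ucomp_assoc, ← ucomp_assoc _ (s.d X Y), s.c_d, id_ucomp, t.c_d])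
    (fun X Y => by rw [ucomp_assoc, ← ucomp_assoc _ (t.c X Y), t.d_c, id_ucomp, s.d_c])
    (by rw [ucomp_assoc, ← ucomp_assoc _ s.d₀, s.c₀_d₀, id_ucomp, t.c₀_d₀])
    (by rw [ucomp_assoc, ← ucomp_assoc _ t.c₀, t.d₀_c₀, id_ucomp, s.d₀_c₀])
    (fun X Y => by
      rw [← post_comp, ← pre_comp, ← Category.assoc, t.c_enat, Category.assoc, ← post_pre,
        ← Category.assoc, s.c_enat, Category.assoc])
    (by
      rw [← post_comp, ← pre_comp, ← Category.assoc, t.c₀_enat, Category.assoc, ← post_pre,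
        ← Category.assoc, s.c₀_enat, Category.assoc])
    (fun X Y Z => by
      rw [n.tensor_ucomp_left, n.tensor_ucomp_right, ucomp_assoc, ucomp_assoc, ucomp_assoc,
        ← ucomp_assoc (n.tensor.umap₂ (s.c X Y) _), t.c_nat, ucomp_assoc, s.c_assoc,
        ← ucomp_assoc (t.c _ _), ← ucomp_assoc (n.tensor.umap₂ _ _), t.c_assoc]
      rw [ucomp_assoc, ucomp_assoc, ← ucomp_assoc (t.c X _), ← t.c_nat, ucomp_assoc])
    (fun X => by
      rw [n.tensor_ucomp_left, ucomp_assoc, ucomp_assoc,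
        ← ucomp_assoc (n.tensor.umap₂ s.c₀ _), t.c_nat, ucomp_assoc, s.c_left, t.c_left])
    (fun X => by
      rw [n.tensor_ucomp_right, ucomp_assoc, ucomp_assoc,
        ← ucomp_assoc (n.tensor.umap₂ _ s.c₀), t.c_nat, ucomp_assoc, s.c_right, t.c_right])

end StrongMonoidal

/-- Isomorphism of monoidal structures over `U` is an equivalence relation. -/
instance overSetoid (U : HFunctor F A B) (n : HMonoidal F B) : Setoid (MonoidalOver U n) where
  r S T := Nonempty (OverIso S T)
  iseqv :=
    { refl S := ⟨⟨StrongMonoidal.refl S.mon,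
        fun X Y => by
          refine Eq.trans ?_ (congrArg (fun k => ucomp _ k) (U.umap_hId _).symm)
          exact (ucomp_id _).symm,
        by
          refine Eq.trans ?_ (congrArg (fun k => ucomp _ k) (U.umap_hId _).symm)
          exact (ucomp_id _).symm⟩⟩
      symm := fun {S T} ⟨i⟩ => ⟨⟨i.iso.symm,
        fun X Y => by
          refine Eq.trans ?_ (congrArg (fun k => ucomp k (U.umap (i.iso.d X Y)))
            (i.φ_comp X Y).symm)
          refine Eq.trans ?_ (ucomp_assoc _ _ _).symm
          refine Eq.trans ?_ (congrArg (fun k => ucomp _ k) (U.umap_ucomp (i.iso.c X Y) _))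
          rw [i.iso.c_d, U.umap_hId]
          exact (ucomp_id _).symm,
        by
          refine Eq.trans ?_ (congrArg (fun k => ucomp k (U.umap i.iso.d₀)) i.φ₀_comp.symm)
          refine Eq.trans ?_ (ucomp_assoc _ _ _).symm
          refine Eq.trans ?_ (congrArg (fun k => ucomp _ k) (U.umap_ucomp i.iso.c₀ _))
          rw [i.iso.c₀_d₀, U.umap_hId]
          exact (ucomp_id _).symm⟩⟩
      trans := fun {R S T} ⟨i⟩ ⟨j⟩ => ⟨⟨i.iso.trans j.iso,
        fun X Y => by
          refine (i.φ_comp X Y).trans ?_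
          refine (congrArg (fun k => ucomp k _) (j.φ_comp X Y)).trans ?_
          refine (ucomp_assoc _ _ _).trans ?_
          exact congrArg (fun k => ucomp _ k) (U.umap_ucomp (j.iso.c X Y) (i.iso.c X Y)).symm,
        by
          refine i.φ₀_comp.trans ?_
          refine (congrArg (fun k => ucomp k _) j.φ₀_comp).trans ?_
          refine (ucomp_assoc _ _ _).trans ?_
          exact congrArg (fun k => ucomp _ k) (U.umap_ucomp j.iso.c₀ i.iso.c₀).symm⟩⟩ }

end Over

/-! ### Bimonoids and the corresponding tensor products of modules -/

section Bimonoids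

variable {F : Type u} [Category.{v} F] [MonoidalCategory F] [VerticalMonoidal F] [Duoidal F]

/-- A bimonoid structure on a horizontal monoid `M`: a vertical comonoid structure `(δ, ε)` such
that `δ` and `ε` are morphisms of horizontal monoids. -/
structure BimonoidStr (M : F) [MonObj M] where
  comon : @ComonObj F _ VerticalMonoidal.vert M
  mul_comul : (MonObj.mul : M ⊗ M ⟶ M) ≫ comon.comul =
    (comon.comul ⊗ₘ comon.comul) ≫ γ M M M M ≫ (MonObj.mul ∘ᵥₘ MonObj.mul)
  mul_counit : (MonObj.mul : M ⊗ M ⟶ M) ≫ comon.counit = (comon.counit ⊗ₘ comon.counit) ≫ μ₁ F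
  one_comul : (MonObj.one : 𝟙_ F ⟶ M) ≫ comon.comul = δJ F ≫ (MonObj.one ∘ᵥₘ MonObj.one)
  one_counit : (MonObj.one : 𝟙_ F ⟶ M) ≫ comon.counit = τ F

/-- The comultiplication `δ : M ⟶ M ∘ M`. -/
abbrev BimonoidStr.δ {M : F} [MonObj M] (b : BimonoidStr M) : M ⟶ M ∘ᵥ M := b.comon.comul

/-- The counit `ε : M ⟶ 𝟭`. -/
abbrev BimonoidStr.ε {M : F} [MonObj M] (b : BimonoidStr M) : M ⟶ vUnit F := b.comon.counit

variable [LeftClosed F] {M : F} [MonObj M] [HasModHoms M]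

/-- The monoidal structures on `F^{∗M}` for which `U_M` is strong monoidal into `(F, ∘̂, ⌜𝟭⌝)`. -/
abbrev ModMonoidal (M : F) [MonObj M] [HasModHoms M] :=
  MonoidalOver (forgetMod M) (selfMonoidal F)

/-- The constraint `U_M A ∘ U_M B ⟶ U_M (A ∘ B)`, as a morphism of `F`. -/
noncomputable def ModMonoidal.φ (S : ModMonoidal M) (A B : RMod M) :
    A.X ∘ᵥ B.X ⟶ (S.mon.tensor.obj (A, B)).X :=
  ofElem (X := A.X ∘ᵥ B.X) (Y := (S.mon.tensor.obj (A, B)).X) (S.strong.φ.hom (A, B))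

/-- The constraint `𝟭 ⟶ U_M I`, as a morphism of `F`. -/
noncomputable def ModMonoidal.φ₀ (S : ModMonoidal M) : vUnit F ⟶ (S.mon.unit.obj ()).X :=
  ofElem (X := vUnit F) (Y := (S.mon.unit.obj ()).X) (S.strong.φ₀.hom ())

/-- The bimonoid structure `b` corresponds to the monoidal structure `S`: through the constraints
of `U_M`, the action of `M` on the tensor product of two modules is
`(A ∘ B) ∗ M ⟶ (A ∘ B) ∗ (M ∘ M) ⟶ (A ∗ M) ∘ (B ∗ M) ⟶ A ∘ B`, and the action on the unit module
is `𝟭 ∗ M ⟶ 𝟭 ∗ 𝟭 ⟶ 𝟭`. -/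
structure Realizes (b : BimonoidStr M) (S : ModMonoidal M) : Prop where
  tensor (A B : RMod M) :
    (S.φ A B ▷ M) ≫ (S.mon.tensor.obj (A, B)).act =
      ((A.X ∘ᵥ B.X) ◁ b.δ) ≫ γ A.X B.X M M ≫ (A.act ∘ᵥₘ B.act) ≫ S.φ A B
  unit : (S.φ₀ ▷ M) ≫ (S.mon.unit.obj ()).act = (vUnit F ◁ b.ε) ≫ μ₁ F ≫ S.φ₀

end Bimonoids

/-! ### Enrichment of the base -/

section BaseEnrichment

variable (V : Type u') [Category.{v'} V] [MonoidalCategory V] [SymmetricCategory V]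
variable (F : Type u) [Category.{v} F] [EnrichedOrdinaryCategory V F]

/-- A monoidal structure on the underlying category of a `V`-category is the underlying one of a
monoidal `V`-category: the tensor product is given a structure of `V`-functor
`F ⊗ F ⟶ F`, and the constraints are `V`-natural. -/
structure VMonoidal (m : MonoidalCategory F) where
  map (A A' B B' : F) :
    (A ⟶[V] A') ⊗ (B ⟶[V] B') ⟶ (m.tensorObj A B ⟶[V] m.tensorObj A' B')
  map_comp (A A' A'' B B' B'' : F) :
    tensorμ (A ⟶[V] A') (A' ⟶[V] A'') (B ⟶[V] B') (B' ⟶[V] B'') ≫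
        (map A A' B B' ⊗ₘ map A' A'' B' B'') ≫ eComp V _ _ _ =
      (eComp V A A' A'' ⊗ₘ eComp V B B' B'') ≫ map A A'' B B''
  /-- On underlying morphisms the `V`-functor is the given tensor product; in particular it
  preserves identities. -/
  map_elem {A A' B B' : F} (f : A ⟶ A') (g : B ⟶ B') :
    (λ_ (𝟙_ V)).inv ≫ (eHomEquiv V f ⊗ₘ eHomEquiv V g) ≫ map A A' B B' =
      eHomEquiv V (m.tensorHom f g)
  assoc_nat (A A' B B' C C' : F) :
    (map A A' B B' ▷ (C ⟶[V] C')) ≫ map (m.tensorObj A B) (m.tensorObj A' B') C C' ≫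
        eHomWhiskerLeft V _ (m.associator A' B' C').hom =
      (α_ _ _ _).hom ≫ ((A ⟶[V] A') ◁ map B B' C C') ≫
        map A A' (m.tensorObj B C) (m.tensorObj B' C') ≫
          eHomWhiskerRight V (m.associator A B C).hom _
  left_nat (A A' : F) :
    (λ_ (A ⟶[V] A')).inv ≫ (eId V m.tensorUnit ▷ (A ⟶[V] A')) ≫
        map m.tensorUnit m.tensorUnit A A' ≫ eHomWhiskerLeft V _ (m.leftUnitor A').hom =
      eHomWhiskerRight V (m.leftUnitor A).hom A'
  right_nat (A A' : F) :
    (ρ_ (A ⟶[V] A')).inv ≫ ((A ⟶[V] A') ◁ eId V m.tensorUnit) ≫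
        map A A' m.tensorUnit m.tensorUnit ≫ eHomWhiskerLeft V _ (m.rightUnitor A').hom =
      eHomWhiskerRight V (m.rightUnitor A).hom A'

/-- A duoidal `V`-category: both monoidal structures are `V`-monoidal and the interchange `γ` is
`V`-natural. -/
class VDuoidal [MonoidalCategory F] [VerticalMonoidal F] [Duoidal F] where
  horiz : VMonoidal V F inferInstance
  vert : VMonoidal V F VerticalMonoidal.vert
  γ_nat (A A' B B' C C' D D' : F) :
    (vert.map A A' B B' ⊗ₘ vert.map C C' D D') ≫
        horiz.map (A ∘ᵥ B) (A' ∘ᵥ B') (C ∘ᵥ D) (C' ∘ᵥ D') ≫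
          eHomWhiskerLeft V ((A ∘ᵥ B) ⊗ (C ∘ᵥ D)) (γ A' B' C' D') =
      tensorμ (A ⟶[V] A') (B ⟶[V] B') (C ⟶[V] C') (D ⟶[V] D') ≫
        (horiz.map A A' C C' ⊗ₘ horiz.map B B' D D') ≫
          vert.map (A ⊗ C) (A' ⊗ C') (B ⊗ D) (B' ⊗ D') ≫
            eHomWhiskerRight V (γ A B C D) ((A' ⊗ C') ∘ᵥ (B' ⊗ D'))

/-- The left internal homs of a duoidal `V`-category represent `V`-enriched: the canonical
`F(X, [Y, Z]) ⟶ F(X ∗ Y, Z)` in `V` is invertible. -/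
class VLeftClosed [MonoidalCategory F] [VerticalMonoidal F] [Duoidal F] [VDuoidal V F]
    [LeftClosed F] : Prop where
  isIso (X Y Z : F) : IsIso ((ρ_ (X ⟶[V] ihom Y Z)).inv ≫ ((X ⟶[V] ihom Y Z) ◁ eId V Y) ≫
    (VDuoidal.horiz (V := V)).map X (ihom Y Z) Y Y ≫ eHomWhiskerLeft V (X ⊗ Y) (ev Y Z))

end BaseEnrichment
end Duo

namespace Duo

/-! ### Functors that are monomorphic on hom-objects -/

section Enriched

variable {F : Type u} [Category.{v} F] [MonoidalCategory F]
variable {A : Type w₁} {B : Type w₂} [HCategory F A] [HCategory F B]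

/-! The forgetful functor `U_M` is monic on hom-objects, so what is built on `F^{∗M}` over `F` is
determined by its image in `F`, and identities between constraints may be checked there.
Transporting along `φ` and `φ₀`, a monoidal structure over `F` amounts to actions of `M` on the
objects `A ∘ B` and `𝟭` themselves, such that `∘̂` and `⌜𝟭⌝` restrict to the hom-objects of modules
and the vertical constraints are module morphisms.

Enriched functoriality forces the form of the actions, by a Yoneda argument. A map `P ⟶ modHom A B`
is a family, parametrized by `P`, of module morphisms (`RMod.IsParamHom`), and functoriality says
that `γ ≫ (f ∘ g)` is such a family whenever `f` and `g` are (`ModMonoidal.tensor_isParamHom`). The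
action `α : A ∗ M ⟶ A` is a family of morphisms from the regular module `M`, parametrized by `A`
itself. Hence `γ ≫ (α ∘ β) : (A ∘ B) ∗ (M ∘ M) ⟶ A ∘ B` is a family of module morphisms out of `M ∘
M`. Put `δ_M(m) = (1 ∘ 1)m`. The family is equivariant and reduces to a unit constraint at `1 ∘ 1`,
so the action on `A ∘ B` is the one induced by `δ_M` (`ModMonoidal.tensorMod_act`). The same
argument with `μ` and `ε_M(m) = 1m` settles the unit. Maps of this orbit form respect the
multiplication and unit of `M`; evaluating the vertical constraints, which are module morphisms, at
units gives the comonoid axioms.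

Conversely, for a bimonoid the monoid-morphism axioms make the induced actions associative and
unital, horizontal associativity of `γ` gives enriched functoriality, and coassociativity and
counitality, with the vertical axioms of `γ`, make the constraints module morphisms. The remaining
structure lifts from `F` along `U_M`.

The bijection is read off from the relation `Realizes`. Every bimonoid structure is realized, and
every monoidal structure realizes exactly one, because `δ_M` and `ε_M` are recovered as orbits of
units. Realization is invariant under isomorphism; and if `S` and `T` realize the same structure,
they induce the same actions, so the comparison `φ_T⁻¹ ≫ φ_S` consists of module morphisms and lifts
to an isomorphism over `F`. -/

lemma comp_post {P : F} {X Y Z : A} (f : P ⟶ hom F X Y) (g : UHom F Y Z) :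
    f ≫ post X g = (λ_ P).inv ≫ (g ⊗ₘ f) ≫ hComp F X Y Z := by
  rw [post, leftUnitor_inv_naturality_assoc, ← MonoidalCategory.tensorHom_def'_assoc]

lemma comp_pre {P : F} {X Y Z : A} (f : P ⟶ hom F Y Z) (g : UHom F X Y) :
    f ≫ pre g Z = (ρ_ P).inv ≫ (f ⊗ₘ g) ≫ hComp F X Y Z := by
  rw [pre, rightUnitor_inv_naturality_assoc, ← MonoidalCategory.tensorHom_def_assoc]

lemma HFunctor.post_map (U : HFunctor F A B) (X : A) {Y Z : A} (g : UHom F Y Z) :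
    post X g ≫ U.map X Z = U.map X Y ≫ post (U.obj X) (U.umap g) := by
  rw [comp_post, post, Category.assoc, Category.assoc, U.map_comp, HFunctor.umap, ← tensorHom_id,
    tensorHom_comp_tensorHom_assoc, Category.id_comp]

lemma HFunctor.pre_map (U : HFunctor F A B) {X Y : A} (f : UHom F X Y) (Z : A) :
    pre f Z ≫ U.map X Z = U.map Y Z ≫ pre (U.umap f) (U.obj Z) := by
  rw [comp_pre, pre, Category.assoc, Category.assoc, U.map_comp, HFunctor.umap, ← id_tensorHom,
    tensorHom_comp_tensorHom_assoc, Category.id_comp]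

/-- Applied to `U_M`, this reduces coherence conditions between modules, such as the pentagon and
the triangle, to equations in `F`. -/
lemma HFunctor.umap_injective (U : HFunctor F A B) [∀ X Y, Mono (U.map X Y)] {X Y : A}
    {f g : UHom F X Y} (h : U.umap f = U.umap g) : f = g :=
  (cancel_mono (U.map X Y)).1 h

lemma ucomp_left_cancel {X Y Z : A} {i : UHom F X Y} {j : UHom F Y X}
    (hij : ucomp j i = hId F Y) {f g : UHom F Y Z} (h : ucomp i f = ucomp i g) : f = g := by
  rw [← id_ucomp f, ← hij, ucomp_assoc, h, ← ucomp_assoc, hij, id_ucomp]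

lemma pre_cancel {X Y : A} {i : UHom F X Y} {j : UHom F Y X} (hij : ucomp j i = hId F Y) {Z : A}
    {P : F} {f g : P ⟶ hom F Y Z} (h : f ≫ pre i Z = g ≫ pre i Z) : f = g := by
  have h' := congrArg (fun k => k ≫ pre j Z) h
  simpa only [Category.assoc, pre_comp, hij, pre_id, Category.comp_id] using h'

/-- An invertible natural transformation lifts along a functor that is monomorphic on hom-objects
if its components lift. -/
def HNatIso.lift {C : Type w₃} [HCategory F C] (U : HFunctor F A B) [∀ X Y, Mono (U.map X Y)]
    {S T : HFunctor F C A} (f : ∀ X, UHom F (S.obj X) (T.obj X))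
    (g : ∀ X, UHom F (T.obj X) (S.obj X))
    (θ : ∀ X, UHom F (U.obj (S.obj X)) (U.obj (T.obj X)))
    (θ' : ∀ X, UHom F (U.obj (T.obj X)) (U.obj (S.obj X)))
    (hf : ∀ X, U.umap (f X) = θ X) (hg : ∀ X, U.umap (g X) = θ' X)
    (fg : ∀ X, ucomp (θ X) (θ' X) = hId F _) (gf : ∀ X, ucomp (θ' X) (θ X) = hId F _)
    (nat : ∀ X Y, (S.map X Y ≫ U.map _ _) ≫ post _ (θ Y) =
      (T.map X Y ≫ U.map _ _) ≫ pre (θ X) _) : HNatIso S T where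
  hom := f
  inv := g
  hom_inv X := U.umap_injective (by rw [U.umap_ucomp, hf, hg, fg, U.umap_hId])
  inv_hom X := U.umap_injective (by rw [U.umap_ucomp, hf, hg, gf, U.umap_hId])
  naturality X Y := by
    -- The square is tested after the monomorphism `U.map`, past which composition with `f` becomes
    -- composition with `θ`.
    rw [← cancel_mono (U.map _ _), Category.assoc, Category.assoc, U.post_map, U.pre_map,
      ← Category.assoc, ← Category.assoc, hf, hf, nat]

lemma HFunctor.umap_ucomp_of (U : HFunctor F A B) {X Y Z : A} {f : UHom F X Y} {g : UHom F Y Z}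
    {f' : UHom F (U.obj X) (U.obj Y)} {g' : UHom F (U.obj Y) (U.obj Z)} (hf : U.umap f = f')
    (hg : U.umap g = g') : U.umap (ucomp f g) = ucomp f' g' := by
  rw [U.umap_ucomp, hf, hg]

end Enriched

/-! ### Comparison of monoidal structures over a functor -/

section Over

variable {F : Type u} [Category.{v} F] [MonoidalCategory F] [VerticalMonoidal F] [Duoidal F]
variable {A : Type w₁} {B : Type w₂} [HCategory F A] [HCategory F B]

namespace StrongMonoidal

variable {U : HFunctor F A B} {m : HMonoidal F A} {n : HMonoidal F B}

/-- Enriched naturality of the tensor constraint, evaluated at the element `upair f g`. -/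
lemma φ_unat (s : StrongMonoidal U m n) {X X' Y Y' : A} (f : UHom F X X') (g : UHom F Y Y') :
    ucomp (n.tensor.umap₂ (U.umap f) (U.umap g)) (s.φ.hom (X', Y')) =
      ucomp (s.φ.hom (X, Y)) (U.umap (m.tensor.umap₂ f g)) := by
  have h := s.φ.unat (upair f g)
  have e1 : ((U.prod U).comp n.tensor).umap (upair f g) =
      n.tensor.umap₂ (U.umap f) (U.umap g) := by
    simp only [HFunctor.umap, HFunctor.umap₂, upair, HFunctor.comp, HFunctor.prod, Category.assoc,
      ← vHom_comp]
  have e2 : (m.tensor.comp U).umap (upair f g) = U.umap (m.tensor.umap₂ f g) :=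
    (Category.assoc _ _ _).symm
  rw [e1, e2] at h
  exact h

end StrongMonoidal

lemma HMonoidal.tensor_left_inv (n : HMonoidal F B) {X X' : B} {f : UHom F X X'}
    {g : UHom F X' X} (h : ucomp f g = hId F X) (Y : B) :
    ucomp (n.tensor.umap₂ f (hId F Y)) (n.tensor.umap₂ g (hId F Y)) = hId F _ := by
  rw [← n.tensor_ucomp_left, h, n.tensor_id]

lemma HMonoidal.tensor_right_inv (n : HMonoidal F B) (X : B) {Y Y' : B} {f : UHom F Y Y'}
    {g : UHom F Y' Y} (h : ucomp f g = hId F Y) :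
    ucomp (n.tensor.umap₂ (hId F X) f) (n.tensor.umap₂ (hId F X) g) = hId F _ := by
  rw [← n.tensor_ucomp_right, h, n.tensor_id]

variable {U : HFunctor F A B} {n : HMonoidal F B}

namespace MonoidalOver

/-- The tensor constraint of `U`. -/
abbrev f (S : MonoidalOver U n) (X Y : A) :
    UHom F (n.tensor.obj (U.obj X, U.obj Y)) (U.obj (S.mon.tensor.obj (X, Y))) :=
  S.strong.φ.hom (X, Y)

/-- The unit constraint of `U`. -/
abbrev f₀ (S : MonoidalOver U n) : UHom F (n.unit.obj ()) (U.obj (S.mon.unit.obj ())) :=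
  S.strong.φ₀.hom ()

variable (S : MonoidalOver U n)

lemma f_nat {X X' Y Y' : A} (g : UHom F X X') (h : UHom F Y Y') :
    ucomp (n.tensor.umap₂ (U.umap g) (U.umap h)) (S.f X' Y') =
      ucomp (S.f X Y) (U.umap (S.mon.tensor.umap₂ g h)) := S.strong.φ_unat g h

lemma f_nat_left {X X' : A} (g : UHom F X X') (Y : A) :
    ucomp (S.f X Y) (U.umap (S.mon.tensor.umap₂ g (hId F Y))) =
      ucomp (n.tensor.umap₂ (U.umap g) (hId F (U.obj Y))) (S.f X' Y) := by
  rw [← f_nat, U.umap_hId]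

lemma f_nat_right (X : A) {Y Y' : A} (g : UHom F Y Y') :
    ucomp (S.f X Y) (U.umap (S.mon.tensor.umap₂ (hId F X) g)) =
      ucomp (n.tensor.umap₂ (hId F (U.obj X)) (U.umap g)) (S.f X Y') := by
  rw [← f_nat, U.umap_hId]

lemma f_assoc (X Y Z : A) :
    ucomp (n.tensor.umap₂ (S.f X Y) (hId F (U.obj Z)))
      (ucomp (S.f (S.mon.tensor.obj (X, Y)) Z) (U.umap (S.mon.a X Y Z))) =
    ucomp (n.a (U.obj X) (U.obj Y) (U.obj Z))
      (ucomp (n.tensor.umap₂ (hId F (U.obj X)) (S.f Y Z)) (S.f X (S.mon.tensor.obj (Y, Z)))) :=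
  S.strong.assoc X Y Z

lemma f_left (X : A) :
    ucomp (n.tensor.umap₂ S.f₀ (hId F (U.obj X)))
      (ucomp (S.f (S.mon.unit.obj ()) X) (U.umap (S.mon.l X))) = n.l (U.obj X) := S.strong.left X

lemma f_right (X : A) :
    ucomp (n.tensor.umap₂ (hId F (U.obj X)) S.f₀)
      (ucomp (S.f X (S.mon.unit.obj ())) (U.umap (S.mon.r X))) = n.r (U.obj X) := S.strong.right X

/-- The constraints of `U` are invertible, and so are their tensor products with identities. This
lemma and the four that follow allow an equation out of `U(X ⊗ Y)`, `U I`, or a tensor product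
containing one of them, to be tested on tensor products and units of `ℬ`. -/
lemma f_cancel {X Y : A} {Z : B} {g h : UHom F (U.obj (S.mon.tensor.obj (X, Y))) Z}
    (e : ucomp (S.f X Y) g = ucomp (S.f X Y) h) : g = h :=
  ucomp_left_cancel (S.strong.φ.inv_hom (X, Y)) e

lemma f₀_cancel {Z : B} {g h : UHom F (U.obj (S.mon.unit.obj ())) Z}
    (e : ucomp S.f₀ g = ucomp S.f₀ h) : g = h :=
  ucomp_left_cancel (S.strong.φ₀.inv_hom ()) e

lemma f_whisker_cancel {X Y : A} {W Z : B}
    {g h : UHom F (n.tensor.obj (U.obj (S.mon.tensor.obj (X, Y)), W)) Z}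
    (e : ucomp (n.tensor.umap₂ (S.f X Y) (hId F W)) g =
      ucomp (n.tensor.umap₂ (S.f X Y) (hId F W)) h) : g = h :=
  ucomp_left_cancel (n.tensor_left_inv (S.strong.φ.inv_hom (X, Y)) W) e

lemma f₀_whisker_left_cancel {W Z : B}
    {g h : UHom F (n.tensor.obj (U.obj (S.mon.unit.obj ()), W)) Z}
    (e : ucomp (n.tensor.umap₂ S.f₀ (hId F W)) g =
      ucomp (n.tensor.umap₂ S.f₀ (hId F W)) h) : g = h :=
  ucomp_left_cancel (n.tensor_left_inv (S.strong.φ₀.inv_hom ()) W) e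

lemma f₀_whisker_right_cancel {W Z : B}
    {g h : UHom F (n.tensor.obj (W, U.obj (S.mon.unit.obj ()))) Z}
    (e : ucomp (n.tensor.umap₂ (hId F W) S.f₀) g =
      ucomp (n.tensor.umap₂ (hId F W) S.f₀) h) : g = h :=
  ucomp_left_cancel (n.tensor_right_inv W (S.strong.φ₀.inv_hom ())) e

lemma f_enat (X Y : A × A) :
    (U.map X.1 Y.1 ∘ᵥₘ U.map X.2 Y.2) ≫ n.tensor.map (U.obj X.1, U.obj X.2) (U.obj Y.1, U.obj Y.2) ≫
        post _ (S.f Y.1 Y.2) =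
      S.mon.tensor.map X Y ≫ U.map _ _ ≫ pre (S.f X.1 X.2) _ := by
  have h := S.strong.φ.naturality X Y
  simp only [HFunctor.comp, Category.assoc] at h
  exact h

lemma f₀_enat :
    n.unit.map () () ≫ post _ S.f₀ = S.mon.unit.map () () ≫ U.map _ _ ≫ pre S.f₀ _ := by
  have h := S.strong.φ₀.naturality () ()
  simp only [HFunctor.comp, Category.assoc] at h
  exact h

end MonoidalOver

/-- Two monoidal structures over a functor that is monomorphic on hom-objects are isomorphic as
soon as the comparisons of their constraints lift along this functor. -/
def OverIso.ofLift [∀ X Y, Mono (U.map X Y)] (S T : MonoidalOver U n)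
    (c : ∀ X Y : A, UHom F (T.mon.tensor.obj (X, Y)) (S.mon.tensor.obj (X, Y)))
    (d : ∀ X Y : A, UHom F (S.mon.tensor.obj (X, Y)) (T.mon.tensor.obj (X, Y)))
    (c₀ : UHom F (T.mon.unit.obj ()) (S.mon.unit.obj ()))
    (d₀ : UHom F (S.mon.unit.obj ()) (T.mon.unit.obj ()))
    (hc : ∀ X Y, ucomp (T.f X Y) (U.umap (c X Y)) = S.f X Y)
    (hd : ∀ X Y, ucomp (S.f X Y) (U.umap (d X Y)) = T.f X Y)
    (hc₀ : ucomp T.f₀ (U.umap c₀) = S.f₀) (hd₀ : ucomp S.f₀ (U.umap d₀) = T.f₀) :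
    OverIso S T where
  iso := StrongMonoidal.mkId c d c₀ d₀
    (fun X Y => U.umap_injective (T.f_cancel (by
      rw [U.umap_ucomp, ← ucomp_assoc, hc, hd, U.umap_hId, ucomp_id])))
    (fun X Y => U.umap_injective (S.f_cancel (by
      rw [U.umap_ucomp, ← ucomp_assoc, hd, hc, U.umap_hId, ucomp_id])))
    (U.umap_injective (T.f₀_cancel (by
      rw [U.umap_ucomp, ← ucomp_assoc, hc₀, hd₀, U.umap_hId, ucomp_id])))
    (U.umap_injective (S.f₀_cancel (by
      rw [U.umap_ucomp, ← ucomp_assoc, hd₀, hc₀, U.umap_hId, ucomp_id])))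
    (fun X Y => by
      rw [← cancel_mono (U.map _ _), Category.assoc, Category.assoc, U.post_map, U.pre_map]
      -- Precomposing with the invertible constraint of `T` loses nothing. Since the constraint of
      -- `S` is that of `T` followed by `U c`, the square for `c` is then what remains of the square
      -- for `S` after the square for `T` is substituted.
      refine pre_cancel (i := T.f X.1 X.2) (j := T.strong.φ.inv X) (T.strong.φ.inv_hom X) ?_
      have hT := T.f_enat X Y
      have hS := S.f_enat X Y
      rw [← hc, ← hc, ← post_comp, ← pre_comp] at hS
      simp only [Category.assoc]
      refine Eq.trans ?_ hS
      refine Eq.trans ?_ (congrArg (fun k => k ≫ post _ (U.umap (c Y.1 Y.2))) hT).symm |>.trans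
        (by simp only [Category.assoc])
      simp only [Category.assoc]
      exact congrArg (fun k => _ ≫ _ ≫ k) (post_pre _ _))
    (by
      rw [← cancel_mono (U.map _ _), Category.assoc, Category.assoc, U.post_map, U.pre_map]
      refine pre_cancel (i := T.f₀) (j := T.strong.φ₀.inv ()) (T.strong.φ₀.inv_hom ()) ?_
      have hT := T.f₀_enat
      have hS := S.f₀_enat
      rw [← hc₀, ← post_comp, ← pre_comp] at hS
      simp only [Category.assoc]
      refine Eq.trans ?_ hS
      refine Eq.trans ?_ (congrArg (fun k => k ≫ post _ (U.umap c₀)) hT).symm |>.trans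
        (by simp only [Category.assoc])
      simp only [Category.assoc]
      exact congrArg (fun k => _ ≫ _ ≫ k) (post_pre _ _))
    -- Tested on `(UX ⊗ UY) ⊗ UZ`, each `U c` is absorbed by a constraint of `T` to give one of `S`,
    -- and the equation follows from the associativity axioms of `S` and `T`, which share the
    -- associator of `ℬ`.
    (fun X Y Z => U.umap_injective (T.f_cancel (T.f_whisker_cancel (by
      simp only [U.umap_ucomp]
      rw [← ucomp_assoc (T.f _ _), T.f_nat_left, ucomp_assoc, ← ucomp_assoc (T.f _ _), hc,
        ← ucomp_assoc (n.tensor.umap₂ _ _), ← n.tensor_ucomp_left, hc, S.f_assoc,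
        ← ucomp_assoc (T.f _ _), ← ucomp_assoc (n.tensor.umap₂ _ _), T.f_assoc]
      simp only [ucomp_assoc]
      rw [← ucomp_assoc (T.f _ _), T.f_nat_right, ucomp_assoc, hc,
        ← ucomp_assoc (n.tensor.umap₂ _ _), ← n.tensor_ucomp_right, hc]))))
    (fun X => U.umap_injective (T.f_cancel (T.f₀_whisker_left_cancel (by
      simp only [U.umap_ucomp]
      rw [← ucomp_assoc (T.f _ _), T.f_nat_left, ucomp_assoc, ← ucomp_assoc (T.f _ _), hc,
        ← ucomp_assoc (n.tensor.umap₂ _ _), ← n.tensor_ucomp_left, hc₀, S.f_left, T.f_left]))))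
    (fun X => U.umap_injective (T.f_cancel (T.f₀_whisker_right_cancel (by
      simp only [U.umap_ucomp]
      rw [← ucomp_assoc (T.f _ _), T.f_nat_right, ucomp_assoc, ← ucomp_assoc (T.f _ _), hc,
        ← ucomp_assoc (n.tensor.umap₂ _ _), ← n.tensor_ucomp_right, hc₀, S.f_right, T.f_right]))))
  φ_comp X Y := (hc X Y).symm
  φ₀_comp := hc₀.symm

end Over

/-! ### Elements of internal homs -/

section Closed

variable {F : Type u} [Category.{v} F] [MonoidalCategory F] [LeftClosed F]

lemma unc_eq_leftUnitor_ofElem {X Y : F} (g : UHom F X Y) :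
    unc (g : 𝟙_ F ⟶ ihom X Y) = (λ_ X).hom ≫ ofElem g := by
  rw [ofElem, Iso.hom_inv_id_assoc]
  rfl

lemma elem_ofElem {X Y : F} (g : UHom F X Y) : elem (ofElem g) = g :=
  ihom_ext (by rw [unc_elem, unc_eq_leftUnitor_ofElem])

lemma ofElem_elem {X Y : F} (f : X ⟶ Y) : ofElem (elem f) = f := by
  rw [← cancel_epi (λ_ X).hom, ← unc_eq_leftUnitor_ofElem, unc_elem]

lemma ofElem_hId (X : F) : ofElem (hId F X) = 𝟙 X := by rw [← elem_id, ofElem_elem]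

lemma ofElem_ucomp {X Y Z : F} (f : UHom F X Y) (g : UHom F Y Z) :
    ofElem (ucomp f g) = ofElem f ≫ ofElem g := by
  rw [← elem_ofElem f, ← elem_ofElem g, ucomp_elem]
  simp only [ofElem_elem]

lemma elem_hom_inv {X Y : F} (e : X ≅ Y) : ucomp (elem e.hom) (elem e.inv) = hId F X := by
  rw [ucomp_elem, e.hom_inv_id, elem_id]

lemma elem_inv_hom {X Y : F} (e : X ≅ Y) : ucomp (elem e.inv) (elem e.hom) = hId F Y :=
  elem_hom_inv e.symm

/-- Under transposition, enriched composition with an element is composition with the corresponding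
morphism of `F`. With `unc_comp_pre` this turns the enriched naturality of `φ` and `φ₀` into
equations in `F`. -/
lemma unc_comp_post {P X Y Z : F} (f : P ⟶ ihom X Y) (g : UHom F Y Z) :
    unc (f ≫ post X g) = unc f ≫ ofElem g := by
  have h : f ≫ post X g = (λ_ P).inv ≫ (g ⊗ₘ f) ≫ hComp F X Y Z := comp_post (A := F) f g
  rw [h]
  refine (unc_comp _ _).trans ?_
  rw [unc_hComp, unc_eq_leftUnitor_ofElem]
  simp

lemma unc_comp_pre {P X Y Z : F} (f : P ⟶ ihom Y Z) (g : UHom F X Y) :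
    unc (f ≫ pre g Z) = (P ◁ ofElem g) ≫ unc f := by
  have h : f ≫ pre g Z = (ρ_ P).inv ≫ (f ⊗ₘ g) ≫ hComp F X Y Z := comp_pre (A := F) f g
  rw [h]
  refine (unc_comp _ _).trans ?_
  rw [unc_hComp, unc_eq_leftUnitor_ofElem]
  simp

lemma ofElem_umap₂ [VerticalMonoidal F] [Duoidal F] {X X' Y Y' : F} (f : UHom F X X')
    (g : UHom F Y Y') : ofElem ((vTensor F).umap₂ f g) = (ofElem f ∘ᵥₘ ofElem g) := by
  have h := congrArg ofElem (umap₂_elem F (ofElem f) (ofElem g))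
  rw [elem_ofElem, elem_ofElem] at h
  exact h.trans (ofElem_elem _)

end Closed

/-! ### Morphisms of modules with parameters -/

section Modules

variable {F : Type u} [Category.{v} F] [MonoidalCategory F] {M : F} [MonObj M]

namespace RMod

/-- A family `A ⟶ B`, parametrized by `P`, of morphisms of modules. -/
def IsParamHom {P : F} (A B : RMod M) (f : P ⊗ A.X ⟶ B.X) : Prop :=
  (P ◁ A.act) ≫ f = (α_ P A.X M).inv ≫ (f ▷ M) ≫ B.act

/-- Morphisms of modules. -/
def IsHom (A B : RMod M) (f : A.X ⟶ B.X) : Prop := A.act ≫ f = (f ▷ M) ≫ B.act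

/-- Module morphisms are the families parametrized by `J`, up to the left unit constraint. -/
lemma IsHom.isParamHom {A B : RMod M} {f : A.X ⟶ B.X} (h : IsHom A B f) :
    IsParamHom A B ((λ_ A.X).hom ≫ f) := by
  unfold IsHom at h
  unfold IsParamHom
  rw [leftUnitor_naturality_assoc, h]
  simp

lemma IsParamHom.isHom {A B : RMod M} {f : A.X ⟶ B.X} (h : IsParamHom A B ((λ_ A.X).hom ≫ f)) :
    IsHom A B f := by
  unfold IsParamHom at h
  unfold IsHom
  rw [leftUnitor_naturality_assoc] at h
  rw [← cancel_epi (λ_ (A.X ⊗ M)).hom, h]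
  simp

lemma IsParamHom.comp_isHom {P : F} {A B C : RMod M} {f : P ⊗ A.X ⟶ B.X} {g : B.X ⟶ C.X}
    (hf : IsParamHom A B f) (hg : IsHom B C g) : IsParamHom A C (f ≫ g) := by
  unfold IsParamHom at *
  unfold IsHom at hg
  rw [reassoc_of% hf, hg]
  simp

lemma IsParamHom.whisker {P Q : F} (h : Q ⟶ P) {A B : RMod M} {f : P ⊗ A.X ⟶ B.X}
    (hf : IsParamHom A B f) : IsParamHom A B ((h ▷ A.X) ≫ f) := by
  unfold IsParamHom at *
  rw [whisker_exchange_assoc, hf]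
  simp

lemma IsHom.comp_isParamHom {P : F} {A B C : RMod M} {f : A.X ⟶ B.X} {g : P ⊗ B.X ⟶ C.X}
    (hf : IsHom A B f) (hg : IsParamHom B C g) : IsParamHom A C ((P ◁ f) ≫ g) := by
  unfold IsParamHom at *
  unfold IsHom at hf
  rw [← MonoidalCategory.whiskerLeft_comp_assoc, hf, MonoidalCategory.whiskerLeft_comp_assoc, hg]
  simp

lemma isHom_id (A : RMod M) : IsHom A A (𝟙 A.X) := by simp [IsHom]

lemma IsHom.comp {A B C : RMod M} {f : A.X ⟶ B.X} {g : B.X ⟶ C.X} (hf : IsHom A B f)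
    (hg : IsHom B C g) : IsHom A C (f ≫ g) := by
  unfold IsHom at *
  rw [reassoc_of% hf, hg]
  simp

lemma IsHom.inv {A B : RMod M} {e : A.X ≅ B.X} (h : IsHom A B e.hom) : IsHom B A e.inv := by
  unfold IsHom at *
  rw [← cancel_epi (e.hom ▷ M), ← reassoc_of% h]
  simp

/-- The module structure on `X` transported along an isomorphism. -/
abbrev transport (A : RMod M) {X : F} (e : X ≅ A.X) : RMod M where
  X := X
  act := (e.hom ▷ M) ≫ A.act ≫ e.inv
  act_one := by
    rw [whisker_exchange_assoc, reassoc_of% A.act_one]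
    simp
  act_mul := by
    rw [whisker_exchange_assoc, reassoc_of% A.act_mul]
    simp

lemma transport_isHom (A : RMod M) {X : F} (e : X ≅ A.X) : IsHom (A.transport e) A e.hom := by
  change ((e.hom ▷ M) ≫ A.act ≫ e.inv) ≫ e.hom = (e.hom ▷ M) ≫ A.act
  rw [Category.assoc, Category.assoc, Iso.inv_hom_id, Category.comp_id]

/-! ### The regular module and orbit maps -/

/-- The monoid `M` as a module over itself. -/
abbrev regular (M : F) [MonObj M] : RMod M where
  X := M
  act := MonObj.mul
  act_one := MonObj.mul_one M
  act_mul := by simp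

/-- Associativity of the action, read as: for each `x` in `A` the map `m ↦ xm` is a module morphism
`M ⟶ A`. The parameter object is `A` itself, which is what starts the Yoneda argument. -/
lemma act_isParamHom (A : RMod M) : IsParamHom (regular M) A A.act := by
  simp only [IsParamHom, regular]
  exact A.act_mul

/-- The morphism `M ⟶ A`, `m ↦ x m`. -/
def orbit (A : RMod M) (x : 𝟙_ F ⟶ A.X) : M ⟶ A.X := (λ_ M).inv ≫ (x ▷ M) ≫ A.act

lemma orbit_comp {A B : RMod M} {f : A.X ⟶ B.X} (hf : IsHom A B f) (x : 𝟙_ F ⟶ A.X) :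
    A.orbit x ≫ f = B.orbit (x ≫ f) := by
  unfold IsHom at hf
  simp [orbit, hf]

lemma orbit_one : (regular M).orbit (MonObj.one : 𝟙_ F ⟶ M) = 𝟙 M := by
  change (λ_ M).inv ≫ (MonObj.one ▷ M) ≫ MonObj.mul = 𝟙 M
  simp

lemma one_orbit (A : RMod M) (x : 𝟙_ F ⟶ A.X) : MonObj.one ≫ A.orbit x = x := by
  rw [orbit, leftUnitor_inv_naturality_assoc, whisker_exchange_assoc, A.act_one]
  simp [← unitors_equal]

/-- An orbit map is itself a morphism out of the regular module. For the orbits defining `comul` and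
`counit` this becomes their compatibility with multiplication. -/
lemma mul_orbit (A : RMod M) (x : 𝟙_ F ⟶ A.X) :
    MonObj.mul ≫ A.orbit x = (A.orbit x ▷ M) ≫ A.act := by
  rw [orbit, leftUnitor_inv_naturality_assoc, whisker_exchange_assoc, A.act_mul]
  simp

/-- Equivariance: `f(p, xm) = f(p, x)m`. A family of module morphisms is thus known on a whole orbit
from its value at the one element `x`; this is the Yoneda step that determines the actions on `A ∘
B` and `𝟭`. -/
lemma IsParamHom.whisker_orbit {P : F} {A B : RMod M} {f : P ⊗ A.X ⟶ B.X}
    (hf : IsParamHom A B f) (x : 𝟙_ F ⟶ A.X) :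
    (P ◁ A.orbit x) ≫ f = (((ρ_ P).inv ≫ (P ◁ x) ≫ f) ▷ M) ≫ B.act := by
  unfold IsParamHom at hf
  simp only [orbit, MonoidalCategory.whiskerLeft_comp, Category.assoc, comp_whiskerRight]
  have h : (P ◁ (λ_ M).inv) ≫ (α_ P (𝟙_ F) M).inv = (ρ_ P).inv ▷ M := by monoidal
  rw [hf, associator_inv_naturality_middle_assoc, reassoc_of% h]

/-! ### Elements of the hom-objects of modules -/

section

variable [LeftClosed F] [HasModHoms M]

/-- The morphism of the underlying category of `F^{∗M}` given by a morphism of modules. -/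
noncomputable def homElem {A B : RMod M} (f : A.X ⟶ B.X) (hf : IsHom A B f) : UHom F A B :=
  modLift (elem f) (by
    rw [unc_elem]
    exact hf.isParamHom)

lemma umap_homElem {A B : RMod M} (f : A.X ⟶ B.X) (hf : IsHom A B f) :
    (forgetMod M).umap (homElem f hf) = elem f := modLift_ι _ _

/-- The equalizer condition, restricted along `f`. Together with `modLift` it identifies maps into
`modHom A B` with families of module morphisms. -/
lemma isParamHom_unc_modι {P : F} {A B : RMod M} (f : P ⟶ modHom A B) :
    IsParamHom A B (unc (f ≫ modι A B)) := by
  rw [unc_comp]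
  exact IsParamHom.whisker f (modι_condition A B)

/-- The case of parameter `J`. It is applied to the constraints of an arbitrary monoidal structure
on modules and to the components of an isomorphism of such structures. -/
lemma isHom_ofElem {A B : RMod M} (f : UHom F A B) :
    IsHom A B (ofElem (X := A.X) (Y := B.X) ((forgetMod M).umap f)) := by
  apply IsParamHom.isHom
  have h := isParamHom_unc_modι f
  rwa [show unc (f ≫ modι A B) = _ from unc_eq_leftUnitor_ofElem (X := A.X) (Y := B.X)
    ((forgetMod M).umap f)] at h

end

end RMod

/-- Equalizer inclusions are monic, so the lifting criteria for functors that are monic on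
hom-objects apply to `U_M`. -/
noncomputable instance [LeftClosed F] [HasModHoms M] (A B : RMod M) :
    Mono ((forgetMod M).map A B) := inferInstanceAs (Mono (modι A B))

end Modules

/-! ### The vertical tensor product of modules -/

section VerticalModules

variable {F : Type u} [Category.{v} F] [MonoidalCategory F] [VerticalMonoidal F] [Duoidal F]

lemma γ_assoc_h_inv (A B C D E G : F) :
    ((A ∘ᵥ B) ◁ γ C D E G) ≫ γ A B (C ⊗ E) (D ⊗ G) ≫ ((α_ A C E).inv ∘ᵥₘ (α_ B D G).inv) =
      (α_ (A ∘ᵥ B) (C ∘ᵥ D) (E ∘ᵥ G)).inv ≫ (γ A B C D ▷ (E ∘ᵥ G)) ≫ γ (A ⊗ C) (B ⊗ D) E G := by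
  rw [Iso.eq_inv_comp, ← reassoc_of% (Duoidal.γ_assoc_h A B C D E G), vHom_comp, Iso.hom_inv_id,
    Iso.hom_inv_id, vHom_id, Category.comp_id]

variable {M : F} [MonObj M]

/-! ### Diagonal actions along a morphism `d : M ⟶ M ∘ M` -/

namespace RMod

/-- The morphism `(A ∘ B) ∗ M ⟶ (A ∘ B) ∗ (M ∘ M) ⟶ (A ∗ M) ∘ (B ∗ M) ⟶ A ∘ B`. -/
def tensorAct (d : M ⟶ M ∘ᵥ M) (A B : RMod M) : (A.X ∘ᵥ B.X) ⊗ M ⟶ A.X ∘ᵥ B.X :=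
  ((A.X ∘ᵥ B.X) ◁ d) ≫ γ A.X B.X M M ≫ (A.act ∘ᵥₘ B.act)

/-- Only naturality of `γ` enters, so `d` need not be a comultiplication; this permits its use for
`S.comul` before that map is known to satisfy any axiom. -/
lemma tensorAct_nat (d : M ⟶ M ∘ᵥ M) {A A' B B' : RMod M} {f : A.X ⟶ A'.X} {g : B.X ⟶ B'.X}
    (hf : IsHom A A' f) (hg : IsHom B B' g) :
    tensorAct d A B ≫ (f ∘ᵥₘ g) = ((f ∘ᵥₘ g) ▷ M) ≫ tensorAct d A' B' := by
  unfold IsHom at hf hg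
  simp only [tensorAct, Category.assoc]
  rw [vHom_comp, hf, hg, ← vHom_comp, ← γ_nat_left_assoc, whisker_exchange_assoc]

/-- Horizontal associativity of `γ`: acting in each factor after applying `f` and `g` is the
diagonal action after `γ ≫ (f ∘ g)`. With `f`, `g` actions it yields associativity of the diagonal
action; with `f`, `g` families of module morphisms it yields functoriality of the tensor product. -/
lemma param_tensorAct (d : M ⟶ M ∘ᵥ M) {P Q X Y : F} (A B : RMod M) (f : P ⊗ X ⟶ A.X)
    (g : Q ⊗ Y ⟶ B.X) :
    ((P ∘ᵥ Q) ◁ ((X ∘ᵥ Y) ◁ d)) ≫ ((P ∘ᵥ Q) ◁ γ X Y M M) ≫ γ P Q (X ⊗ M) (Y ⊗ M) ≫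
        (((α_ P X M).inv ≫ (f ▷ M) ≫ A.act) ∘ᵥₘ ((α_ Q Y M).inv ≫ (g ▷ M) ≫ B.act)) =
      (α_ (P ∘ᵥ Q) (X ∘ᵥ Y) M).inv ≫ ((γ P Q X Y ≫ (f ∘ᵥₘ g)) ▷ M) ≫ tensorAct d A B := by
  rw [← vHom_comp, ← vHom_comp, reassoc_of% (γ_assoc_h_inv P Q X Y M M), tensorAct,
    ← γ_nat_left_assoc, ← whisker_exchange_assoc]
  simp

lemma param_unit {P Q X Y : F} (f : P ⊗ M ⟶ X) (g : Q ⊗ M ⟶ Y) :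
    ((P ∘ᵥ Q) ◁ (δJ F ≫ (MonObj.one ∘ᵥₘ MonObj.one))) ≫ γ P Q M M ≫ (f ∘ᵥₘ g) =
      (ρ_ (P ∘ᵥ Q)).hom ≫ (((ρ_ P).inv ≫ (P ◁ MonObj.one) ≫ f) ∘ᵥₘ
        ((ρ_ Q).inv ≫ (Q ◁ MonObj.one) ≫ g)) := by
  rw [← δ_right, MonoidalCategory.whiskerLeft_comp, Category.assoc, γ_nat_right_assoc, vHom_comp,
    Category.assoc, Category.assoc, vHom_comp, Iso.hom_inv_id_assoc, Iso.hom_inv_id_assoc]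

/-- Right unit axiom of `γ` through `δ : J ⟶ J ∘ J`. It gives the unit law of the diagonal action,
and also the value at `1 ∘ 1` needed in the Yoneda argument. -/
lemma param_unit_act (A B : RMod M) :
    ((A.X ∘ᵥ B.X) ◁ (δJ F ≫ (MonObj.one ∘ᵥₘ MonObj.one))) ≫ γ A.X B.X M M ≫
      (A.act ∘ᵥₘ B.act) = (ρ_ (A.X ∘ᵥ B.X)).hom := by
  rw [param_unit, A.act_one, B.act_one, Iso.inv_hom_id, Iso.inv_hom_id, vHom_id, Category.comp_id]

/-- Left unit axiom of `γ`: `(x ∘ y)m` is computed by applying `d` to `m` and then the two orbit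
maps. On regular modules with `x = y = 1` it recovers `d` from the action. -/
lemma orbit_tensorAct (d : M ⟶ M ∘ᵥ M) (A B : RMod M) (x : 𝟙_ F ⟶ A.X) (y : 𝟙_ F ⟶ B.X) :
    (λ_ M).inv ≫ ((δJ F ≫ (x ∘ᵥₘ y)) ▷ M) ≫ tensorAct d A B =
      d ≫ (A.orbit x ∘ᵥₘ B.orbit y) := by
  rw [tensorAct, ← whisker_exchange_assoc, ← leftUnitor_inv_naturality_assoc,
    comp_whiskerRight, Category.assoc, γ_nat_left_assoc, vHom_comp]
  congr 1
  rw [Iso.inv_comp_eq, ← δ_left_assoc, vHom_comp, orbit, orbit, Iso.hom_inv_id_assoc,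
    Iso.hom_inv_id_assoc]

end RMod

/-! ### Tensor product, unit and constraints for modules over a bimonoid -/

namespace BimonoidStr

variable (b : BimonoidStr M)

lemma coassoc : b.δ ≫ (b.δ ∘ᵥₘ 𝟙 M) ≫ (vα M M M).hom = b.δ ≫ (𝟙 M ∘ᵥₘ b.δ) := by
  have h := @ComonObj.comul_assoc F _ VerticalMonoidal.vert M b.comon
  rw [vHom, vHom, @id_tensorHom F _ VerticalMonoidal.vert, @tensorHom_id F _ VerticalMonoidal.vert]
  exact h.symm

lemma counit_left : b.δ ≫ (b.ε ∘ᵥₘ 𝟙 M) = (vl M).inv := by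
  have h := @ComonObj.counit_comul F _ VerticalMonoidal.vert M b.comon
  rw [vHom, @tensorHom_id F _ VerticalMonoidal.vert]
  exact h

lemma counit_right : b.δ ≫ (𝟙 M ∘ᵥₘ b.ε) = (vr M).inv := by
  have h := @ComonObj.comul_counit F _ VerticalMonoidal.vert M b.comon
  rw [vHom, @id_tensorHom F _ VerticalMonoidal.vert]
  exact h

lemma ext {b b' : BimonoidStr M} (hδ : b.δ = b'.δ) (hε : b.ε = b'.ε) : b = b' := by
  obtain ⟨c, _, _, _, _⟩ := b
  obtain ⟨c', _, _, _, _⟩ := b'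
  obtain rfl : c = c' := by
    cases c
    cases c'
    cases hδ
    cases hε
    rfl
  rfl

/-- The vertical tensor product of two modules. -/
abbrev tensorMod (A B : RMod M) : RMod M where
  X := A.X ∘ᵥ B.X
  act := RMod.tensorAct b.δ A B
  act_one := by
    rw [RMod.tensorAct, ← MonoidalCategory.whiskerLeft_comp_assoc, b.one_comul,
      RMod.param_unit_act]
  act_mul := by
    have h : (α_ (A.X ∘ᵥ B.X) M M).inv ≫ (RMod.tensorAct b.δ A B ▷ M) =
        ((A.X ∘ᵥ B.X) ◁ (b.δ ▷ M)) ≫ (α_ (A.X ∘ᵥ B.X) (M ∘ᵥ M) M).inv ≫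
          ((γ A.X B.X M M ≫ (A.act ∘ᵥₘ B.act)) ▷ M) := by
      simp [RMod.tensorAct]
    -- `param_tensorAct` separates the iterated action into those on `A` and `B`; associativity of
    -- each, and multiplicativity of `δ`, bring both sides to the same form.
    rw [reassoc_of% h, ← RMod.param_tensorAct, ← A.act_mul, ← B.act_mul, RMod.tensorAct,
      ← MonoidalCategory.whiskerLeft_comp_assoc, b.mul_comul, MonoidalCategory.tensorHom_def]
    simp only [MonoidalCategory.whiskerLeft_comp, Category.assoc]
    rw [γ_nat_right_assoc, vHom_comp]

/-- The vertical unit as a module. -/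
abbrev unitMod : RMod M where
  X := vUnit F
  act := (vUnit F ◁ b.ε) ≫ μ₁ F
  act_one := by
    rw [← MonoidalCategory.whiskerLeft_comp_assoc, b.one_counit]
    exact Duoidal.unitMon.mul_one
  act_mul := by
    rw [← MonoidalCategory.whiskerLeft_comp_assoc, b.mul_counit, MonoidalCategory.tensorHom_def]
    have h : (μ₁ F ▷ vUnit F) ≫ μ₁ F = (α_ _ _ _).hom ≫ (vUnit F ◁ μ₁ F) ≫ μ₁ F :=
      Duoidal.unitMon.mul_assoc
    simp only [MonoidalCategory.whiskerLeft_comp, Category.assoc, comp_whiskerRight]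
    rw [← whisker_exchange_assoc, h]
    simp

/-- This is what makes `∘̂` restrict to the hom-objects of modules. Both sides reduce, by
`param_tensorAct` and naturality of `γ`, to the module conditions on `f` and `g` separately. -/
lemma tensor_isParamHom {P Q : F} {A A' B B' : RMod M} {f : P ⊗ A.X ⟶ A'.X} {g : Q ⊗ B.X ⟶ B'.X}
    (hf : A.IsParamHom A' f) (hg : B.IsParamHom B' g) :
    RMod.IsParamHom (P := P ∘ᵥ Q) (b.tensorMod A B) (b.tensorMod A' B')
      (γ P Q A.X B.X ≫ (f ∘ᵥₘ g)) := by
  unfold RMod.IsParamHom at hf hg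
  change ((P ∘ᵥ Q) ◁ RMod.tensorAct b.δ A B) ≫ γ P Q A.X B.X ≫ (f ∘ᵥₘ g) =
    (α_ (P ∘ᵥ Q) (A.X ∘ᵥ B.X) M).inv ≫ ((γ P Q A.X B.X ≫ (f ∘ᵥₘ g)) ▷ M) ≫
      RMod.tensorAct b.δ A' B'
  rw [← RMod.param_tensorAct, ← hf, ← hg, RMod.tensorAct]
  simp only [MonoidalCategory.whiskerLeft_comp, Category.assoc]
  rw [γ_nat_right_assoc, vHom_comp]

lemma unit_isParamHom : RMod.IsParamHom (P := vUnit F) b.unitMod b.unitMod (μ₁ F) := by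
  change (vUnit F ◁ ((vUnit F ◁ b.ε) ≫ μ₁ F)) ≫ μ₁ F =
    (α_ (vUnit F) (vUnit F) M).inv ≫ (μ₁ F ▷ M) ≫ (vUnit F ◁ b.ε) ≫ μ₁ F
  have h : (μ₁ F ▷ vUnit F) ≫ μ₁ F = (α_ _ _ _).hom ≫ (vUnit F ◁ μ₁ F) ≫ μ₁ F :=
    Duoidal.unitMon.mul_assoc
  rw [← whisker_exchange_assoc, h]
  simp

/-- Vertical associativity of `γ` exchanges the two iterated diagonal actions, up to the two
iterated comultiplications, which coassociativity identifies. -/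
lemma isHom_vα (A B C : RMod M) :
    RMod.IsHom (b.tensorMod (b.tensorMod A B) C) (b.tensorMod A (b.tensorMod B C))
      (vα A.X B.X C.X).hom := by
  -- The identity `C.X ◁ 𝟙 M` is inserted so that naturality of `γ` can carry the inner `δ` to the
  -- front as `δ ∘ 1`, next to the outer one.
  have h1 : (((A.X ∘ᵥ B.X) ◁ b.δ ≫ γ A.X B.X M M ≫ (A.act ∘ᵥₘ B.act)) ∘ᵥₘ C.act) =
      (((A.X ∘ᵥ B.X) ◁ b.δ) ∘ᵥₘ (C.X ◁ 𝟙 M)) ≫ (γ A.X B.X M M ∘ᵥₘ 𝟙 _) ≫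
        ((A.act ∘ᵥₘ B.act) ∘ᵥₘ C.act) := by
    rw [vHom_comp, vHom_comp, MonoidalCategory.whiskerLeft_id, Category.id_comp, Category.id_comp]
  have h2 : (A.act ∘ᵥₘ ((B.X ∘ᵥ C.X) ◁ b.δ ≫ γ B.X C.X M M ≫ (B.act ∘ᵥₘ C.act))) =
      ((A.X ◁ 𝟙 M) ∘ᵥₘ ((B.X ∘ᵥ C.X) ◁ b.δ)) ≫ (𝟙 _ ∘ᵥₘ γ B.X C.X M M) ≫
        (A.act ∘ᵥₘ (B.act ∘ᵥₘ C.act)) := by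
    rw [vHom_comp, vHom_comp, MonoidalCategory.whiskerLeft_id, Category.id_comp, Category.id_comp]
  change (((A.X ∘ᵥ B.X) ∘ᵥ C.X) ◁ b.δ ≫ γ (A.X ∘ᵥ B.X) C.X M M ≫
      (((A.X ∘ᵥ B.X) ◁ b.δ ≫ γ A.X B.X M M ≫ (A.act ∘ᵥₘ B.act)) ∘ᵥₘ C.act)) ≫
        (vα A.X B.X C.X).hom = ((vα A.X B.X C.X).hom ▷ M) ≫ (A.X ∘ᵥ (B.X ∘ᵥ C.X)) ◁ b.δ ≫
      γ A.X (B.X ∘ᵥ C.X) M M ≫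
        (A.act ∘ᵥₘ ((B.X ∘ᵥ C.X) ◁ b.δ ≫ γ B.X C.X M M ≫ (B.act ∘ᵥₘ C.act)))
  rw [h1, h2, Category.assoc, Category.assoc, Category.assoc, Category.assoc, vα_nat,
    ← γ_nat_right_assoc, ← γ_nat_right_assoc,
    reassoc_of% (Duoidal.γ_assoc_v A.X B.X C.X M M M), MonoidalCategory.tensorHom_def',
    ← whisker_exchange_assoc, ← whisker_exchange_assoc, Category.assoc,
    ← MonoidalCategory.whiskerLeft_comp_assoc, ← MonoidalCategory.whiskerLeft_comp_assoc,
    Category.assoc, b.coassoc]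
  simp

/-- Counitality reduces the action of `M` on the pair to its action on `A`, and compatibility of `γ`
with the vertical unit through `μ` removes the factor `𝟭`. -/
lemma isHom_vl (A : RMod M) :
    RMod.IsHom (b.tensorMod b.unitMod A) A (vl A.X).hom := by
  have h1 : ((vUnit F ◁ b.ε ≫ μ₁ F) ∘ᵥₘ A.act) =
      ((vUnit F ◁ b.ε) ∘ᵥₘ (A.X ◁ 𝟙 M)) ≫ (μ₁ F ∘ᵥₘ 𝟙 _) ≫ (𝟙 _ ∘ᵥₘ A.act) := by
    rw [vHom_comp, vHom_comp, MonoidalCategory.whiskerLeft_id, Category.id_comp, Category.id_comp,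
      Category.comp_id]
  change ((vUnit F ∘ᵥ A.X) ◁ b.δ ≫ γ (vUnit F) A.X M M ≫
    ((vUnit F ◁ b.ε ≫ μ₁ F) ∘ᵥₘ A.act)) ≫ (vl A.X).hom = ((vl A.X).hom ▷ M) ≫ A.act
  rw [h1, Category.assoc, Category.assoc, Category.assoc, Category.assoc, vl_nat,
    ← γ_nat_right_assoc, ← MonoidalCategory.whiskerLeft_comp_assoc, b.counit_left,
    reassoc_of% (Duoidal.μ_left A.X M), MonoidalCategory.tensorHom_def', Category.assoc,
    whiskerLeft_inv_hom_assoc]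

lemma isHom_vr (A : RMod M) :
    RMod.IsHom (b.tensorMod A b.unitMod) A (vr A.X).hom := by
  have h1 : (A.act ∘ᵥₘ (vUnit F ◁ b.ε ≫ μ₁ F)) =
      ((A.X ◁ 𝟙 M) ∘ᵥₘ (vUnit F ◁ b.ε)) ≫ (𝟙 _ ∘ᵥₘ μ₁ F) ≫ (A.act ∘ᵥₘ 𝟙 _) := by
    rw [vHom_comp, vHom_comp, MonoidalCategory.whiskerLeft_id, Category.id_comp, Category.id_comp,
      Category.comp_id]
  change ((A.X ∘ᵥ vUnit F) ◁ b.δ ≫ γ A.X (vUnit F) M M ≫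
    (A.act ∘ᵥₘ (vUnit F ◁ b.ε ≫ μ₁ F))) ≫ (vr A.X).hom = ((vr A.X).hom ▷ M) ≫ A.act
  rw [h1, Category.assoc, Category.assoc, Category.assoc, Category.assoc, vr_nat,
    ← γ_nat_right_assoc, ← MonoidalCategory.whiskerLeft_comp_assoc, b.counit_right,
    reassoc_of% (Duoidal.μ_right A.X M), MonoidalCategory.tensorHom_def', Category.assoc,
    whiskerLeft_inv_hom_assoc]

end BimonoidStr

end VerticalModules

/-! ### The bimonoid structure of a monoidal structure on modules -/

section OfModMonoidal

variable {F : Type u} [Category.{v} F] [MonoidalCategory F] [VerticalMonoidal F] [Duoidal F]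
  [LeftClosed F] {M : F} [MonObj M] [HasModHoms M]

namespace ModMonoidal

variable (S : ModMonoidal M)

/-- The tensor constraint of `U_M` as an isomorphism of `F`. -/
noncomputable def φIso (A B : RMod M) : A.X ∘ᵥ B.X ≅ (S.mon.tensor.obj (A, B)).X where
  hom := S.φ A B
  inv := ofElem (X := (S.mon.tensor.obj (A, B)).X) (Y := A.X ∘ᵥ B.X) (S.strong.φ.inv (A, B))
  hom_inv_id := by
    have h := congrArg (ofElem (X := A.X ∘ᵥ B.X) (Y := A.X ∘ᵥ B.X)) (S.strong.φ.hom_inv (A, B))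
    exact (ofElem_ucomp _ _).symm.trans (h.trans (ofElem_hId _))
  inv_hom_id := by
    have h := congrArg (ofElem (X := (S.mon.tensor.obj (A, B)).X)
      (Y := (S.mon.tensor.obj (A, B)).X)) (S.strong.φ.inv_hom (A, B))
    exact (ofElem_ucomp _ _).symm.trans (h.trans (ofElem_hId _))

/-- The unit constraint of `U_M` as an isomorphism of `F`. -/
noncomputable def φ₀Iso : vUnit F ≅ (S.mon.unit.obj ()).X where
  hom := S.φ₀
  inv := ofElem (X := (S.mon.unit.obj ()).X) (Y := vUnit F) (S.strong.φ₀.inv ())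
  hom_inv_id := by
    have h := congrArg (ofElem (X := vUnit F) (Y := vUnit F)) (S.strong.φ₀.hom_inv ())
    exact (ofElem_ucomp _ _).symm.trans (h.trans (ofElem_hId _))
  inv_hom_id := by
    have h := congrArg (ofElem (X := (S.mon.unit.obj ()).X)
      (Y := (S.mon.unit.obj ()).X)) (S.strong.φ₀.inv_hom ())
    exact (ofElem_ucomp _ _).symm.trans (h.trans (ofElem_hId _))

lemma φIso_hom (A B : RMod M) : (S.φIso A B).hom = S.φ A B := rfl

lemma φ₀Iso_hom : S.φ₀Iso.hom = S.φ₀ := rfl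

/-- The module structure of `A ∘ B`, transported along the tensor constraint. -/
noncomputable abbrev tensorMod (A B : RMod M) : RMod M :=
  (S.mon.tensor.obj (A, B)).transport (S.φIso A B)

/-- The module structure of `𝟭`, transported along the unit constraint. -/
noncomputable abbrev unitMod : RMod M := (S.mon.unit.obj ()).transport S.φ₀Iso

lemma isHom_φ (A B : RMod M) :
    RMod.IsHom (S.tensorMod A B) (S.mon.tensor.obj (A, B)) (S.φ A B) :=
  RMod.transport_isHom _ (S.φIso A B)

lemma isHom_φ₀ : RMod.IsHom S.unitMod (S.mon.unit.obj ()) S.φ₀ :=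
  RMod.transport_isHom _ S.φ₀Iso

lemma isHom_of_φ {A B C : RMod M} {f : A.X ⟶ B.X ∘ᵥ C.X}
    (h : RMod.IsHom A (S.mon.tensor.obj (B, C)) (f ≫ S.φ B C)) :
    RMod.IsHom A (S.tensorMod B C) f := by
  have := h.comp (RMod.IsHom.inv (A := S.tensorMod B C) (e := S.φIso B C) (S.isHom_φ B C))
  rwa [Category.assoc, ← φIso_hom, Iso.hom_inv_id, Category.comp_id] at this

/-- Enriched naturality of `φ` in transposed form: up to `φ`, the tensor functor can act on
hom-objects only by `γ ≫ (f ∘ g)`. -/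
lemma φ_enat {P Q : F} {A A' B B' : RMod M} (f : P ⟶ modHom A A') (g : Q ⟶ modHom B B') :
    γ P Q A.X B.X ≫ (unc (f ≫ modι A A') ∘ᵥₘ unc (g ≫ modι B B')) ≫ S.φ A' B' =
      ((P ∘ᵥ Q) ◁ S.φ A B) ≫
        unc (((f ∘ᵥₘ g) ≫ S.mon.tensor.map (A, B) (A', B')) ≫ modι _ _) := by
  have h : (f ∘ᵥₘ g) ≫ (modι A A' ∘ᵥₘ modι B B') ≫ vMap A.X A'.X B.X B'.X ≫
      post (A.X ∘ᵥ B.X) (Z := (S.mon.tensor.obj (A', B')).X) (S.strong.φ.hom (A', B')) =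
      (f ∘ᵥₘ g) ≫ S.mon.tensor.map (A, B) (A', B') ≫ modι _ _ ≫
        pre (X := A.X ∘ᵥ B.X) (Y := (S.mon.tensor.obj (A, B)).X) (S.strong.φ.hom (A, B))
          (S.mon.tensor.obj (A', B')).X :=
    congrArg (fun k => (f ∘ᵥₘ g) ≫ k) (MonoidalOver.f_enat S (A, B) (A', B'))
  have h1 := unc_vMap F (𝟙 _) (f ≫ modι A A') (g ≫ modι B B')
  rw [id_whiskerRight, Category.id_comp, Category.id_comp, ← vHom_comp] at h1
  have h2 := unc_comp_post (((f ∘ᵥₘ g) ≫ (modι A A' ∘ᵥₘ modι B B')) ≫ vMap A.X A'.X B.X B'.X)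
    (S.strong.φ.hom (A', B'))
  have h3 := unc_comp_pre (((f ∘ᵥₘ g) ≫ S.mon.tensor.map (A, B) (A', B')) ≫ modι _ _)
    (S.strong.φ.hom (A, B))
  rw [h1] at h2
  simp only [Category.assoc] at h2 h3 ⊢
  exact h2.symm.trans ((congrArg unc h).trans h3)

lemma φ₀_enat :
    μ₁ F ≫ S.φ₀ = (vUnit F ◁ S.φ₀) ≫ unc (S.mon.unit.map () () ≫ modι _ _) := by
  have h : curry (μ₁ F) ≫
      post (vUnit F) (Z := (S.mon.unit.obj ()).X) (S.strong.φ₀.hom ()) =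
      S.mon.unit.map () () ≫ modι _ _ ≫
        pre (X := vUnit F) (Y := (S.mon.unit.obj ()).X) (S.strong.φ₀.hom ())
          (S.mon.unit.obj ()).X := MonoidalOver.f₀_enat S
  have h2 := unc_comp_post (curry (μ₁ F)) (S.strong.φ₀.hom ())
  have h3 := unc_comp_pre (S.mon.unit.map () () ≫ modι _ _) (S.strong.φ₀.hom ())
  rw [unc_curry] at h2
  rw [Category.assoc] at h3
  exact h2.symm.trans ((congrArg unc h).trans h3)

/-- The tensor functor sends maps into hom-objects of modules to maps into hom-objects of modules,
so by `φ_enat` the family `γ ≫ (f ∘ g)` consists of module morphisms once the actions are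
transported along `φ`. -/
lemma tensor_isParamHom {P Q : F} {A A' B B' : RMod M} {f : P ⊗ A.X ⟶ A'.X} {g : Q ⊗ B.X ⟶ B'.X}
    (hf : A.IsParamHom A' f) (hg : B.IsParamHom B' g) :
    RMod.IsParamHom (P := P ∘ᵥ Q) (S.tensorMod A B) (S.tensorMod A' B')
      (γ P Q A.X B.X ≫ (f ∘ᵥₘ g)) := by
  obtain ⟨f', rfl⟩ : ∃ f' : P ⟶ modHom A A', unc (f' ≫ modι A A') = f :=
    ⟨modLift (curry f) (by rw [unc_curry]; exact hf), by rw [modLift_ι, unc_curry]⟩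
  obtain ⟨g', rfl⟩ : ∃ g' : Q ⟶ modHom B B', unc (g' ≫ modι B B') = g :=
    ⟨modLift (curry g) (by rw [unc_curry]; exact hg), by rw [modLift_ι, unc_curry]⟩
  have h := (S.isHom_φ A B).comp_isParamHom (RMod.isParamHom_unc_modι
    ((f' ∘ᵥₘ g') ≫ S.mon.tensor.map (A, B) (A', B')))
  replace h : RMod.IsParamHom (P := P ∘ᵥ Q) (S.tensorMod A B) (S.mon.tensor.obj (A', B'))
      ((γ P Q A.X B.X ≫ (unc (f' ≫ modι A A') ∘ᵥₘ unc (g' ≫ modι B B'))) ≫ S.φ A' B') := by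
    rw [Category.assoc, S.φ_enat]
    exact h
  have h' := h.comp_isHom (RMod.IsHom.inv (A := S.tensorMod A' B') (e := S.φIso A' B')
    (S.isHom_φ A' B'))
  rwa [Category.assoc, ← φIso_hom, Iso.hom_inv_id, Category.comp_id] at h'

/-- The unit functor supplies a map `𝟭 ⟶ modHom I I`, whose transpose is `μ` up to `φ₀`. -/
lemma unit_isParamHom : RMod.IsParamHom (P := vUnit F) S.unitMod S.unitMod (μ₁ F) := by
  have h := S.isHom_φ₀.comp_isParamHom (RMod.isParamHom_unc_modι (S.mon.unit.map () ()))
  replace h : RMod.IsParamHom (P := vUnit F) S.unitMod (S.mon.unit.obj ()) (μ₁ F ≫ S.φ₀) := by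
    rw [S.φ₀_enat]
    exact h
  have h' := h.comp_isHom (RMod.IsHom.inv (A := S.unitMod) (e := S.φ₀Iso) S.isHom_φ₀)
  rwa [Category.assoc, ← φ₀Iso_hom, Iso.hom_inv_id, Category.comp_id] at h'

/-! ### Comultiplication and counit extracted from the actions -/

/-- The comultiplication `m ↦ (1 ∘ 1) m`. -/
noncomputable def comul : M ⟶ M ∘ᵥ M :=
  (S.tensorMod (RMod.regular M) (RMod.regular M)).orbit (δJ F ≫ ((MonObj.one : 𝟙_ F ⟶ M) ∘ᵥₘ (MonObj.one : 𝟙_ F ⟶ M)))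

/-- The counit `m ↦ 1 m`. -/
noncomputable def counit : M ⟶ vUnit F := S.unitMod.orbit (τ F)

/-- Yoneda: `γ ≫ (α ∘ β)` is a family of module morphisms out of `M ∘ M`, and `comul` is the orbit
of `1 ∘ 1`, so equivariance expresses the composite through the value at `1 ∘ 1`. -/
lemma tensorMod_act (A B : RMod M) : (S.tensorMod A B).act = RMod.tensorAct S.comul A B := by
  have h := (S.tensor_isParamHom A.act_isParamHom B.act_isParamHom).whisker_orbit
    (δJ F ≫ ((MonObj.one : 𝟙_ F ⟶ M) ∘ᵥₘ (MonObj.one : 𝟙_ F ⟶ M)))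
  refine Eq.trans ?_ h.symm
  -- At `1 ∘ 1` the family is the identity of `A ∘ B`, up to the right unit constraint, so only the
  -- action itself is left.
  have h1 := A.param_unit_act B
  refine Eq.trans ?_ (congrArg (fun k => (((ρ_ (A.X ∘ᵥ B.X)).inv ≫ k) ▷ M) ≫
    (S.tensorMod A B).act) h1).symm
  simp only [Iso.inv_hom_id, id_whiskerRight]
  exact (Category.id_comp _).symm

lemma unitMod_act : S.unitMod.act = (vUnit F ◁ S.counit) ≫ μ₁ F := by
  have h := S.unit_isParamHom.whisker_orbit (τ F)
  refine Eq.trans ?_ h.symm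
  have h1 : (vUnit F ◁ τ F) ≫ μ₁ F = (ρ_ (vUnit F)).hom := Duoidal.unitMon.mul_one
  refine Eq.trans ?_ (congrArg (fun k => (((ρ_ (vUnit F)).inv ≫ k) ▷ M) ≫
    S.unitMod.act) h1).symm
  simp only [Iso.inv_hom_id, id_whiskerRight]
  exact (Category.id_comp _).symm

lemma tensor_isHom {A A' B B' : RMod M} {f : A.X ⟶ A'.X} {g : B.X ⟶ B'.X}
    (hf : A.IsHom A' f) (hg : B.IsHom B' g) :
    RMod.IsHom (S.tensorMod A B) (S.tensorMod A' B') (f ∘ᵥₘ g) := by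
  unfold RMod.IsHom
  rw [tensorMod_act, tensorMod_act]
  exact RMod.tensorAct_nat _ hf hg

lemma orbit_tensorMod (A B : RMod M) (x : 𝟙_ F ⟶ A.X) (y : 𝟙_ F ⟶ B.X) :
    (S.tensorMod A B).orbit (δJ F ≫ (x ∘ᵥₘ y)) = S.comul ≫ (A.orbit x ∘ᵥₘ B.orbit y) := by
  rw [RMod.orbit, tensorMod_act]
  exact RMod.orbit_tensorAct _ _ _ _ _

/-! ### The vertical constraints as morphisms of modules -/

lemma φ_assoc (A B C : RMod M) :
    (S.φ A B ∘ᵥₘ 𝟙 C.X) ≫ S.φ (S.mon.tensor.obj (A, B)) C ≫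
        ofElem (X := (S.mon.tensor.obj (S.mon.tensor.obj (A, B), C)).X)
          (Y := (S.mon.tensor.obj (A, S.mon.tensor.obj (B, C))).X)
          ((forgetMod M).umap (S.mon.a A B C)) =
      (vα A.X B.X C.X).hom ≫ (𝟙 A.X ∘ᵥₘ S.φ B C) ≫ S.φ A (S.mon.tensor.obj (B, C)) := by
  have h := congrArg (ofElem (X := (A.X ∘ᵥ B.X) ∘ᵥ C.X)
    (Y := (S.mon.tensor.obj (A, S.mon.tensor.obj (B, C))).X)) (MonoidalOver.f_assoc S A B C)
  have e1 : ofElem ((vTensor F).umap₂ (S.f A B) (hId F C.X)) = (S.φ A B ∘ᵥₘ 𝟙 C.X) :=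
    (ofElem_umap₂ _ _).trans (congrArg (fun k => (S.φ A B ∘ᵥₘ k)) (ofElem_hId _))
  have e2 : ofElem ((vTensor F).umap₂ (hId F A.X) (S.f B C)) = (𝟙 A.X ∘ᵥₘ S.φ B C) :=
    (ofElem_umap₂ _ _).trans (congrArg (fun k => (k ∘ᵥₘ S.φ B C)) (ofElem_hId _))
  have e3 : ofElem (HMonoidal.a (selfMonoidal F) A.X B.X C.X) = (vα A.X B.X C.X).hom :=
    ofElem_elem _
  rw [← e1, ← e2, ← e3]
  refine Eq.trans ?_ (h.trans ?_)
  · refine Eq.trans ?_ (ofElem_ucomp _ _).symm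
    exact congrArg (fun k => _ ≫ k) (ofElem_ucomp _ _).symm
  · refine (ofElem_ucomp _ _).trans ?_
    exact congrArg (fun k => _ ≫ k) (ofElem_ucomp _ _)

lemma φ_left (A : RMod M) :
    (S.φ₀ ∘ᵥₘ 𝟙 A.X) ≫ S.φ (S.mon.unit.obj ()) A ≫
        ofElem (X := (S.mon.tensor.obj (S.mon.unit.obj (), A)).X) (Y := A.X)
          ((forgetMod M).umap (S.mon.l A)) = (vl A.X).hom := by
  have h := congrArg (ofElem (X := vUnit F ∘ᵥ A.X) (Y := A.X)) (MonoidalOver.f_left S A)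
  have e1 : ofElem ((vTensor F).umap₂ S.f₀ (hId F A.X)) = (S.φ₀ ∘ᵥₘ 𝟙 A.X) :=
    (ofElem_umap₂ _ _).trans (congrArg (fun k => (S.φ₀ ∘ᵥₘ k)) (ofElem_hId _))
  rw [← e1]
  refine Eq.trans ?_ (h.trans (ofElem_elem _))
  refine Eq.trans ?_ (ofElem_ucomp _ _).symm
  exact congrArg (fun k => _ ≫ k) (ofElem_ucomp _ _).symm

lemma φ_right (A : RMod M) :
    (𝟙 A.X ∘ᵥₘ S.φ₀) ≫ S.φ A (S.mon.unit.obj ()) ≫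
        ofElem (X := (S.mon.tensor.obj (A, S.mon.unit.obj ())).X) (Y := A.X)
          ((forgetMod M).umap (S.mon.r A)) = (vr A.X).hom := by
  have h := congrArg (ofElem (X := A.X ∘ᵥ vUnit F) (Y := A.X)) (MonoidalOver.f_right S A)
  have e1 : ofElem ((vTensor F).umap₂ (hId F A.X) S.f₀) = (𝟙 A.X ∘ᵥₘ S.φ₀) :=
    (ofElem_umap₂ _ _).trans (congrArg (fun k => (k ∘ᵥₘ S.φ₀)) (ofElem_hId _))
  rw [← e1]
  refine Eq.trans ?_ (h.trans (ofElem_elem _))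
  refine Eq.trans ?_ (ofElem_ucomp _ _).symm
  exact congrArg (fun k => _ ≫ k) (ofElem_ucomp _ _).symm

/-- The unit axiom of `φ` presents the vertical constraint as a composite of module morphisms: `φ₀ ∘
1`, `φ`, and the image under `U_M` of the unit constraint for modules. -/
lemma isHom_vl (A : RMod M) :
    RMod.IsHom (S.tensorMod S.unitMod A) A (vl A.X).hom := by
  rw [← S.φ_left]
  exact (S.tensor_isHom S.isHom_φ₀ A.isHom_id).comp
    ((S.isHom_φ _ _).comp (RMod.isHom_ofElem _))

lemma isHom_vr (A : RMod M) :
    RMod.IsHom (S.tensorMod A S.unitMod) A (vr A.X).hom := by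
  rw [← S.φ_right]
  exact (S.tensor_isHom A.isHom_id S.isHom_φ₀).comp
    ((S.isHom_φ _ _).comp (RMod.isHom_ofElem _))

lemma isHom_vα (A B C : RMod M) :
    RMod.IsHom (S.tensorMod (S.tensorMod A B) C) (S.tensorMod A (S.tensorMod B C))
      (vα A.X B.X C.X).hom := by
  have h : RMod.IsHom (S.tensorMod (S.tensorMod A B) C) _ _ :=
    (S.tensor_isHom (S.isHom_φ A B) C.isHom_id).comp
      ((S.isHom_φ _ _).comp (RMod.isHom_ofElem (S.mon.a A B C)))
  have h1 := S.φ_assoc A B C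
  rw [h1, ← Category.assoc] at h
  -- The composite ends in `A ⊗ (B ⊗ C)`: the outer constraint is removed by `isHom_of_φ`, the inner
  -- one by the inverse of `φ` for `B` and `C`.
  have h2 := (S.isHom_of_φ h).comp (S.tensor_isHom A.isHom_id
    (RMod.IsHom.inv (A := S.tensorMod B C) (e := S.φIso B C) (S.isHom_φ B C)))
  rwa [Category.assoc, vHom_comp, ← φIso_hom, Iso.hom_inv_id, Category.comp_id, vHom_id,
    Category.comp_id] at h2

/-- By `orbit_tensorMod` the left side is the orbit of `τ ∘ 1` in `𝟭 ∘ M`. The module morphism `𝟭 ∘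
M ⟶ M` carries `τ ∘ 1` to `1`, whose orbit is the identity. -/
lemma counit_comul : S.comul ≫ (S.counit ∘ᵥₘ 𝟙 M) = (vl M).inv := by
  have h := RMod.orbit_comp (S.isHom_vl (RMod.regular M))
    (δJ F ≫ (τ F ∘ᵥₘ (MonObj.one : 𝟙_ F ⟶ M)))
  have e : (τ F ∘ᵥₘ (MonObj.one : 𝟙_ F ⟶ M)) = (τ F ∘ᵥₘ 𝟙 _) ≫ (𝟙 _ ∘ᵥₘ MonObj.one) := by
    rw [vHom_comp, Category.id_comp, Category.comp_id]
  have h1 : (δJ F ≫ (τ F ∘ᵥₘ (MonObj.one : 𝟙_ F ⟶ M))) ≫ (vl M).hom = MonObj.one := by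
    rw [e, reassoc_of% (δJ_counit_left (F := F)), Category.assoc, vl_nat, Iso.inv_hom_id_assoc]
  rw [S.orbit_tensorMod, h1, RMod.orbit_one] at h
  rw [← cancel_mono (vl M).hom]
  exact h.trans (Iso.inv_hom_id _).symm

lemma comul_counit : S.comul ≫ (𝟙 M ∘ᵥₘ S.counit) = (vr M).inv := by
  have h := RMod.orbit_comp (S.isHom_vr (RMod.regular M))
    (δJ F ≫ ((MonObj.one : 𝟙_ F ⟶ M) ∘ᵥₘ τ F))
  have e : ((MonObj.one : 𝟙_ F ⟶ M) ∘ᵥₘ τ F) = (𝟙 _ ∘ᵥₘ τ F) ≫ (MonObj.one ∘ᵥₘ 𝟙 _) := by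
    rw [vHom_comp, Category.id_comp, Category.comp_id]
  have h1 : (δJ F ≫ ((MonObj.one : 𝟙_ F ⟶ M) ∘ᵥₘ τ F)) ≫ (vr M).hom = MonObj.one := by
    rw [e, reassoc_of% (δJ_counit_right (F := F)), Category.assoc, vr_nat, Iso.inv_hom_id_assoc]
  rw [S.orbit_tensorMod, h1, RMod.orbit_one] at h
  rw [← cancel_mono (vr M).hom]
  exact h.trans (Iso.inv_hom_id _).symm

/-- Both sides are the orbit map of `1 ∘ (1 ∘ 1)`, since the associator is a module morphism and
carries `(1 ∘ 1) ∘ 1` there by coassociativity of `J`. -/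
lemma comul_coassoc : S.comul ≫ (S.comul ∘ᵥₘ 𝟙 M) ≫ (vα M M M).hom =
    S.comul ≫ (𝟙 M ∘ᵥₘ S.comul) := by
  let η : 𝟙_ F ⟶ M := MonObj.one
  have h := RMod.orbit_comp (S.isHom_vα (RMod.regular M) (RMod.regular M) (RMod.regular M))
    (δJ F ≫ ((δJ F ≫ (η ∘ᵥₘ η)) ∘ᵥₘ η))
  have e1 : ((δJ F ≫ (η ∘ᵥₘ η)) ∘ᵥₘ η) = (δJ F ∘ᵥₘ 𝟙 _) ≫ ((η ∘ᵥₘ η) ∘ᵥₘ η) := by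
    rw [vHom_comp, Category.id_comp]
  have e2 : (η ∘ᵥₘ (δJ F ≫ (η ∘ᵥₘ η))) = (𝟙 _ ∘ᵥₘ δJ F) ≫ (η ∘ᵥₘ (η ∘ᵥₘ η)) := by
    rw [vHom_comp, Category.id_comp]
  have h1 : (δJ F ≫ ((δJ F ≫ (η ∘ᵥₘ η)) ∘ᵥₘ η)) ≫ (vα M M M).hom =
      δJ F ≫ (η ∘ᵥₘ (δJ F ≫ (η ∘ᵥₘ η))) := by
    rw [e1, e2, Category.assoc, Category.assoc, vα_nat, ← reassoc_of% (δJ_coassoc (F := F))]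
  rw [S.orbit_tensorMod, h1, Category.assoc] at h
  have hη : (RMod.regular M).orbit η = 𝟙 M := RMod.orbit_one
  simp only [S.orbit_tensorMod, hη, vHom_id, Category.comp_id] at h
  exact h

/-- The bimonoid structure on `M` induced by a monoidal structure on its modules. -/
noncomputable def toBimonoid : BimonoidStr M where
  comon := @ComonObj.mk F _ VerticalMonoidal.vert M S.counit S.comul
    (by
      have h := S.counit_comul
      rwa [vHom, @tensorHom_id F _ VerticalMonoidal.vert] at h)
    (by
      have h := S.comul_counit
      rwa [vHom, @id_tensorHom F _ VerticalMonoidal.vert] at h)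
    (by
      have h := S.comul_coassoc
      rw [vHom, vHom, @id_tensorHom F _ VerticalMonoidal.vert,
        @tensorHom_id F _ VerticalMonoidal.vert] at h
      exact h.symm)
  mul_comul := by
    -- The orbit map commutes with the action, and the action on `M ∘ M` is the diagonal one along
    -- `comul`; this is multiplicativity.
    refine (RMod.mul_orbit (S.tensorMod (RMod.regular M) (RMod.regular M)) _).trans ?_
    rw [S.tensorMod_act, MonoidalCategory.tensorHom_def, Category.assoc]
    rfl
  mul_counit := by
    refine (RMod.mul_orbit S.unitMod _).trans ?_
    rw [S.unitMod_act, MonoidalCategory.tensorHom_def, Category.assoc]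
    rfl
  one_comul := RMod.one_orbit (S.tensorMod (RMod.regular M) (RMod.regular M)) _
  one_counit := RMod.one_orbit S.unitMod _

/-- Cancelling `φ` and `φ₀` turns the correspondence into equalities of actions on `A ∘ B` and `𝟭`
themselves. -/
lemma realizes_iff (b : BimonoidStr M) : Realizes b S ↔
    (∀ A B, (S.tensorMod A B).act = RMod.tensorAct b.δ A B) ∧
      S.unitMod.act = (vUnit F ◁ b.ε) ≫ μ₁ F := by
  constructor
  · rintro ⟨h, h₀⟩
    refine ⟨fun A B => ?_, ?_⟩
    · rw [← cancel_mono (S.φIso A B).hom]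
      have := h A B
      rw [← φIso_hom] at this
      simpa [RMod.tensorAct] using this
    · rw [← cancel_mono S.φ₀Iso.hom]
      rw [← φ₀Iso_hom] at h₀
      simpa using h₀
  · rintro ⟨h, h₀⟩
    refine ⟨fun A B => ?_, ?_⟩
    · have := S.isHom_φ A B
      rw [RMod.IsHom, h] at this
      simpa [RMod.tensorAct] using this.symm
    · have := S.isHom_φ₀
      rw [RMod.IsHom, h₀] at this
      simpa using this.symm

lemma realizes_toBimonoid : Realizes S.toBimonoid S :=
  (S.realizes_iff _).2 ⟨S.tensorMod_act, S.unitMod_act⟩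

/-- The actions determine the bimonoid: `b.δ` and `b.ε` must be the orbit maps of `1 ∘ 1` and `τ`.
-/
lemma eq_toBimonoid {b : BimonoidStr M} (h : Realizes b S) : b = S.toBimonoid := by
  obtain ⟨h, h₀⟩ := (S.realizes_iff b).1 h
  refine BimonoidStr.ext ?_ ?_
  · have e := RMod.orbit_tensorAct b.δ (RMod.regular M) (RMod.regular M) MonObj.one MonObj.one
    rw [← h, RMod.orbit_one, vHom_id, Category.comp_id] at e
    exact e.symm
  · have e : S.counit = b.ε := by
      -- Since `τ` is the unit for `μ`, the orbit of `τ` under the action through `b.ε` is `b.ε`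
      -- itself.
      have h1 : (τ F ▷ vUnit F) ≫ μ₁ F = (λ_ (vUnit F)).hom := Duoidal.unitMon.one_mul
      rw [counit, RMod.orbit, h₀, ← whisker_exchange_assoc, h1,
        ← leftUnitor_inv_naturality_assoc, Iso.inv_hom_id, Category.comp_id]
    exact e.symm

end ModMonoidal

/-! ### Comparison of monoidal structures realizing the same bimonoid -/

lemma Realizes.isHom_tensor {b : BimonoidStr M} {S T : ModMonoidal M} (hS : Realizes b S)
    (hT : Realizes b T) (A B : RMod M) :
    RMod.IsHom (T.mon.tensor.obj (A, B)) (S.mon.tensor.obj (A, B))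
      ((T.φIso A B).inv ≫ S.φ A B) := by
  -- Both transported actions on `A ∘ B` are the diagonal one along `b.δ`, so they coincide.
  have e : RMod.IsHom (T.tensorMod A B) (S.tensorMod A B) (𝟙 (A.X ∘ᵥ B.X)) := by
    unfold RMod.IsHom
    rw [((S.realizes_iff b).1 hS).1, ((T.realizes_iff b).1 hT).1, Category.comp_id,
      id_whiskerRight, Category.id_comp]
  have h := (RMod.IsHom.inv (A := T.tensorMod A B) (e := T.φIso A B) (T.isHom_φ A B)).comp
    (e.comp (S.isHom_φ A B))
  rwa [Category.id_comp] at h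

lemma Realizes.isHom_unit {b : BimonoidStr M} {S T : ModMonoidal M} (hS : Realizes b S)
    (hT : Realizes b T) :
    RMod.IsHom (T.mon.unit.obj ()) (S.mon.unit.obj ()) (T.φ₀Iso.inv ≫ S.φ₀) := by
  have e : RMod.IsHom T.unitMod S.unitMod (𝟙 (vUnit F)) := by
    unfold RMod.IsHom
    rw [((S.realizes_iff b).1 hS).2, ((T.realizes_iff b).1 hT).2, Category.comp_id,
      id_whiskerRight, Category.id_comp]
  have h := (RMod.IsHom.inv (A := T.unitMod) (e := T.φ₀Iso) T.isHom_φ₀).comp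
    (e.comp S.isHom_φ₀)
  rwa [Category.id_comp] at h

lemma Realizes.tensor_comparison {b : BimonoidStr M} {S T : ModMonoidal M} (hS : Realizes b S)
    (hT : Realizes b T) (A B : RMod M) :
    ucomp (MonoidalOver.f T A B) ((forgetMod M).umap (RMod.homElem _ (hS.isHom_tensor hT A B))) = MonoidalOver.f S A B := by
  rw [RMod.umap_homElem]
  have h := ucomp_elem (T.φ A B) ((T.φIso A B).inv ≫ S.φ A B)
  rw [← ModMonoidal.φIso_hom, Iso.hom_inv_id_assoc, ModMonoidal.φIso_hom] at h
  refine Eq.trans ?_ (h.trans (elem_ofElem _))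
  exact congrArg (fun k => ucomp k _) (elem_ofElem _).symm

lemma Realizes.unit_comparison {b : BimonoidStr M} {S T : ModMonoidal M} (hS : Realizes b S)
    (hT : Realizes b T) :
    ucomp (MonoidalOver.f₀ T) ((forgetMod M).umap (RMod.homElem _ (hS.isHom_unit hT))) = MonoidalOver.f₀ S := by
  rw [RMod.umap_homElem]
  have h := ucomp_elem T.φ₀ (T.φ₀Iso.inv ≫ S.φ₀)
  rw [← ModMonoidal.φ₀Iso_hom, Iso.hom_inv_id_assoc, ModMonoidal.φ₀Iso_hom] at h
  refine Eq.trans ?_ (h.trans (elem_ofElem _))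
  exact congrArg (fun k => ucomp k _) (elem_ofElem _).symm

/-- Monoidal structures on modules that realize the same bimonoid structure are isomorphic. -/
noncomputable def Realizes.overIso {b : BimonoidStr M} {S T : ModMonoidal M} (hS : Realizes b S)
    (hT : Realizes b T) : OverIso S T :=
  OverIso.ofLift S T (fun A B => RMod.homElem _ (hS.isHom_tensor hT A B))
    (fun A B => RMod.homElem _ (hT.isHom_tensor hS A B)) (RMod.homElem _ (hS.isHom_unit hT))
    (RMod.homElem _ (hT.isHom_unit hS)) (hS.tensor_comparison hT) (hT.tensor_comparison hS)
    (hS.unit_comparison hT) (hT.unit_comparison hS)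

/-- A bimonoid structure realized by a monoidal structure is realized by every isomorphic one. -/
lemma Realizes.of_overIso {b : BimonoidStr M} {S T : ModMonoidal M} (hT : Realizes b T)
    (i : OverIso S T) : Realizes b S := by
  -- An isomorphism over `F` writes the constraints of `S` as those of `T` followed by module
  -- morphisms, along which the action formulas are carried over.
  have h : ∀ A B : RMod M, S.φ A B = T.φ A B ≫
      ofElem (X := (T.mon.tensor.obj (A, B)).X) (Y := (S.mon.tensor.obj (A, B)).X)
        ((forgetMod M).umap (i.iso.c A B)) := fun A B =>
    (congrArg (ofElem (X := A.X ∘ᵥ B.X) (Y := (S.mon.tensor.obj (A, B)).X))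
      (i.φ_comp A B)).trans (ofElem_ucomp _ _)
  have h₀ : S.φ₀ = T.φ₀ ≫
      ofElem (X := (T.mon.unit.obj ()).X) (Y := (S.mon.unit.obj ()).X)
        ((forgetMod M).umap i.iso.c₀) :=
    (congrArg (ofElem (X := vUnit F) (Y := (S.mon.unit.obj ()).X)) i.φ₀_comp).trans
      (ofElem_ucomp _ _)
  refine ⟨fun A B => ?_, ?_⟩
  · have e : (_ ≫ _ = _) := RMod.isHom_ofElem (i.iso.c A B)
    rw [h, comp_whiskerRight, Category.assoc]
    refine (congrArg (fun k => (T.φ A B ▷ M) ≫ k) e.symm).trans ?_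
    have := congrArg (fun k => k ≫ ofElem (X := (T.mon.tensor.obj (A, B)).X)
      (Y := (S.mon.tensor.obj (A, B)).X) ((forgetMod M).umap (i.iso.c A B))) (hT.tensor A B)
    simp only [Category.assoc] at this
    exact this
  · have e : (_ ≫ _ = _) := RMod.isHom_ofElem i.iso.c₀
    rw [h₀, comp_whiskerRight, Category.assoc]
    refine (congrArg (fun k => (T.φ₀ ▷ M) ≫ k) e.symm).trans ?_
    have := congrArg (fun k => k ≫ ofElem (X := (T.mon.unit.obj ()).X)
      (Y := (S.mon.unit.obj ()).X) ((forgetMod M).umap i.iso.c₀)) hT.unit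
    simp only [Category.assoc] at this
    exact this

end OfModMonoidal

/-! ### The monoidal structure of a bimonoid structure -/

section OfBimonoid

variable {F : Type u} [Category.{v} F] [MonoidalCategory F] [VerticalMonoidal F] [Duoidal F]
  [LeftClosed F] {M : F} [MonObj M] [HasModHoms M]

namespace BimonoidStr

variable (b : BimonoidStr M)

/-- The action of the tensor product of modules on hom-objects. -/
noncomputable def tensorMap (A A' B B' : RMod M) :
    modHom A A' ∘ᵥ modHom B B' ⟶ modHom (b.tensorMod A B) (b.tensorMod A' B') :=
  modLift ((modι A A' ∘ᵥₘ modι B B') ≫ vMap A.X A'.X B.X B'.X) (by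
    have h := unc_vMap F (𝟙 _) (modι A A') (modι B B')
    rw [id_whiskerRight, Category.id_comp, Category.id_comp] at h
    rw [h]
    exact b.tensor_isParamHom (modι_condition A A') (modι_condition B B'))

lemma tensorMap_ι (A A' B B' : RMod M) :
    b.tensorMap A A' B B' ≫ modι (b.tensorMod A B) (b.tensorMod A' B') =
      (modι A A' ∘ᵥₘ modι B B') ≫ vMap A.X A'.X B.X B'.X := modLift_ι _ _

/-- The tensor product of modules as a functor. -/
noncomputable def tensorFunctor : HFunctor F (RMod M × RMod M) (RMod M) where
  obj X := b.tensorMod X.1 X.2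
  map X Y := b.tensorMap X.1 Y.1 X.2 Y.2
  map_id X := by
    refine (cancel_mono (modι _ _)).1 ?_
    rw [Category.assoc, tensorMap_ι]
    -- Followed by `modι`, the assignment is that of `U_M ∘ U_M` followed by `∘̂`, which is already
    -- functorial.
    exact ((((forgetMod M).prod (forgetMod M)).comp (vTensor F)).map_id X).trans
      ((forgetMod M).map_id (b.tensorMod X.1 X.2)).symm
  map_comp X Y Z := by
    refine (cancel_mono (modι _ _)).1 ?_
    rw [Category.assoc, tensorMap_ι]
    refine ((((forgetMod M).prod (forgetMod M)).comp (vTensor F)).map_comp X Y Z).trans ?_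
    refine Eq.trans ?_ (congrArg (fun k => (b.tensorMap Y.1 Z.1 Y.2 Z.2 ⊗ₘ
      b.tensorMap X.1 Y.1 X.2 Y.2) ≫ k) ((forgetMod M).map_comp (b.tensorMod X.1 X.2)
        (b.tensorMod Y.1 Y.2) (b.tensorMod Z.1 Z.2)).symm) |>.trans (Category.assoc _ _ _).symm
    refine Eq.trans ?_ (tensorHom_comp_tensorHom_assoc _ _ _ _ _).symm
    exact congrArg₂ (fun k l => (k ⊗ₘ l) ≫ icomp _ _ _) (b.tensorMap_ι _ _ _ _).symm
      (b.tensorMap_ι _ _ _ _).symm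

/-- The action of the unit module on hom-objects. -/
noncomputable def unitMap : vUnit F ⟶ modHom b.unitMod b.unitMod :=
  modLift (curry (μ₁ F)) (by
    rw [unc_curry]
    exact b.unit_isParamHom)

lemma unitMap_ι : b.unitMap ≫ modι b.unitMod b.unitMod = curry (μ₁ F) := modLift_ι _ _

/-- The unit module as a functor. -/
noncomputable def unitFunctor : HFunctor F Unit (RMod M) where
  obj _ := b.unitMod
  map _ _ := b.unitMap
  map_id X := by
    refine (cancel_mono (modι _ _)).1 ?_
    rw [Category.assoc, unitMap_ι]
    exact ((vUnitFunctor F).map_id X).trans ((forgetMod M).map_id b.unitMod).symm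
  map_comp X Y Z := by
    refine (cancel_mono (modι _ _)).1 ?_
    rw [Category.assoc, unitMap_ι]
    refine ((vUnitFunctor F).map_comp X Y Z).trans ?_
    refine Eq.trans ?_ (congrArg (fun k => (b.unitMap ⊗ₘ b.unitMap) ≫ k)
      ((forgetMod M).map_comp b.unitMod b.unitMod b.unitMod).symm) |>.trans
        (Category.assoc _ _ _).symm
    refine Eq.trans ?_ (tensorHom_comp_tensorHom_assoc _ _ _ _ _).symm
    exact congrArg (fun k => (k ⊗ₘ k) ≫ icomp _ _ _) b.unitMap_ι.symm

/-- On underlying morphisms `U_M` preserves this tensor product strictly, so composites of module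
constraints can be computed in `F`. -/
lemma umap_tensorFunctor {A A' B B' : RMod M} (f : UHom F A A') (g : UHom F B B') :
    (forgetMod M).umap (b.tensorFunctor.umap₂ f g) =
      (vTensor F).umap₂ ((forgetMod M).umap f) ((forgetMod M).umap g) := by
  have h : (δJ F ≫ (f ∘ᵥₘ g)) ≫ b.tensorMap A A' B B' ≫ modι _ _ =
      (δJ F ≫ ((f ≫ modι A A') ∘ᵥₘ (g ≫ modι B B'))) ≫ vMap A.X A'.X B.X B'.X := by
    rw [tensorMap_ι, ← vHom_comp]
    simp only [Category.assoc]
  exact (Category.assoc _ _ _).trans h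

lemma umap_tensorFunctor_of {A A' B B' : RMod M} {f : UHom F A A'} {g : UHom F B B'}
    {f' : UHom F A.X A'.X} {g' : UHom F B.X B'.X} (hf : (forgetMod M).umap f = f')
    (hg : (forgetMod M).umap g = g') :
    (forgetMod M).umap (b.tensorFunctor.umap₂ f g) = (vTensor F).umap₂ f' g' :=
  (b.umap_tensorFunctor f g).trans (congrArg₂ (fun k l => (vTensor F).umap₂ k l) hf hg)

/-- Tensor products of modules are associative. -/
noncomputable def assocIso :
    HNatIso ((b.tensorFunctor.prod (HFunctor.id F (RMod M))).comp b.tensorFunctor)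
    ((HFunctor.associator F (RMod M) (RMod M) (RMod M)).comp
      (((HFunctor.id F (RMod M)).prod b.tensorFunctor).comp b.tensorFunctor)) :=
  HNatIso.lift (forgetMod M)
    (fun X => RMod.homElem (A := b.tensorMod (b.tensorMod X.1.1 X.1.2) X.2)
      (B := b.tensorMod X.1.1 (b.tensorMod X.1.2 X.2)) (vα X.1.1.X X.1.2.X X.2.X).hom
      (b.isHom_vα _ _ _))
    (fun X => RMod.homElem (A := b.tensorMod X.1.1 (b.tensorMod X.1.2 X.2))
      (B := b.tensorMod (b.tensorMod X.1.1 X.1.2) X.2) (vα X.1.1.X X.1.2.X X.2.X).inv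
      (RMod.IsHom.inv (b.isHom_vα _ _ _)))
    (fun X => elem (vα X.1.1.X X.1.2.X X.2.X).hom) (fun X => elem (vα X.1.1.X X.1.2.X X.2.X).inv)
    (fun X => RMod.umap_homElem _ _) (fun X => RMod.umap_homElem _ _)
    (fun X => elem_hom_inv _) (fun X => elem_inv_hom _)
    (fun X Y => by
      -- The square for modules is the square for `F` restricted along the inclusions `modι`; `e1`
      -- and `e2` identify the two functors with these restrictions.
      have h := (selfMonoidal F).assoc.naturality ((X.1.1.X, X.1.2.X), X.2.X)
        ((Y.1.1.X, Y.1.2.X), Y.2.X)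
      have h' := congrArg (fun k => ((modι X.1.1 Y.1.1 ∘ᵥₘ modι X.1.2 Y.1.2) ∘ᵥₘ
        modι X.2 Y.2) ≫ k) h
      have e1 : ((b.tensorMap X.1.1 Y.1.1 X.1.2 Y.1.2 ∘ᵥₘ 𝟙 (modHom X.2 Y.2)) ≫
          b.tensorMap (b.tensorMod X.1.1 X.1.2) (b.tensorMod Y.1.1 Y.1.2) X.2 Y.2) ≫ modι _ _ =
          ((modι X.1.1 Y.1.1 ∘ᵥₘ modι X.1.2 Y.1.2) ∘ᵥₘ modι X.2 Y.2) ≫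
            (vMap X.1.1.X Y.1.1.X X.1.2.X Y.1.2.X ∘ᵥₘ 𝟙 (ihom X.2.X Y.2.X)) ≫
              vMap (X.1.1.X ∘ᵥ X.1.2.X) (Y.1.1.X ∘ᵥ Y.1.2.X) X.2.X Y.2.X := by
        rw [Category.assoc, tensorMap_ι, ← Category.assoc, ← Category.assoc, vHom_comp, vHom_comp,
          tensorMap_ι, Category.id_comp, Category.comp_id]
      have e2 : ((vα (modHom X.1.1 Y.1.1) (modHom X.1.2 Y.1.2) (modHom X.2 Y.2)).hom ≫
          (𝟙 (modHom X.1.1 Y.1.1) ∘ᵥₘ b.tensorMap X.1.2 Y.1.2 X.2 Y.2) ≫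
          b.tensorMap X.1.1 Y.1.1 (b.tensorMod X.1.2 X.2) (b.tensorMod Y.1.2 Y.2)) ≫ modι _ _ =
          ((modι X.1.1 Y.1.1 ∘ᵥₘ modι X.1.2 Y.1.2) ∘ᵥₘ modι X.2 Y.2) ≫
            (vα (ihom X.1.1.X Y.1.1.X) (ihom X.1.2.X Y.1.2.X) (ihom X.2.X Y.2.X)).hom ≫
            (𝟙 (ihom X.1.1.X Y.1.1.X) ∘ᵥₘ vMap X.1.2.X Y.1.2.X X.2.X Y.2.X) ≫
              vMap X.1.1.X Y.1.1.X (X.1.2.X ∘ᵥ X.2.X) (Y.1.2.X ∘ᵥ Y.2.X) := by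
        rw [Category.assoc, Category.assoc, tensorMap_ι,
          ← Category.assoc (𝟙 (modHom X.1.1 Y.1.1) ∘ᵥₘ _), vHom_comp, tensorMap_ι,
          Category.id_comp, reassoc_of% (vα_nat (modι X.1.1 Y.1.1) (modι X.1.2 Y.1.2)
            (modι X.2 Y.2)), ← Category.assoc (_ ∘ᵥₘ _), vHom_comp, Category.comp_id]
      refine (congrArg (fun k => k ≫ _) e1).trans (Eq.trans ?_
        (congrArg (fun k => k ≫ _) e2).symm)
      exact (Category.assoc _ _ _).trans (h'.trans (Category.assoc _ _ _).symm))

/-- The unit module is a left unit. -/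
noncomputable def leftIso :
    HNatIso ((HFunctor.leftUnitorInv F (RMod M)).comp
      ((b.unitFunctor.prod (HFunctor.id F (RMod M))).comp b.tensorFunctor))
    (HFunctor.id F (RMod M)) :=
  HNatIso.lift (forgetMod M)
    (fun X => RMod.homElem (A := b.tensorMod b.unitMod X) (B := X) (vl X.X).hom (b.isHom_vl _))
    (fun X => RMod.homElem (A := X) (B := b.tensorMod b.unitMod X) (vl X.X).inv
      (RMod.IsHom.inv (b.isHom_vl _)))
    (fun X => elem (vl X.X).hom) (fun X => elem (vl X.X).inv)
    (fun X => RMod.umap_homElem _ _) (fun X => RMod.umap_homElem _ _)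
    (fun X => elem_hom_inv _) (fun X => elem_inv_hom _)
    (fun X Y => by
      have h := (selfMonoidal F).left.naturality X.X Y.X
      have h' := congrArg (fun k => modι X Y ≫ k) h
      have e1 : ((vl (modHom X Y)).inv ≫ (b.unitMap ∘ᵥₘ 𝟙 (modHom X Y)) ≫
          b.tensorMap b.unitMod b.unitMod X Y) ≫ modι _ _ =
          modι X Y ≫ (vl (ihom X.X Y.X)).inv ≫ (curry (μ₁ F) ∘ᵥₘ 𝟙 (ihom X.X Y.X)) ≫
            vMap (vUnit F) (vUnit F) X.X Y.X := by
        have e : modι X Y ≫ (vl (ihom X.X Y.X)).inv =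
            (vl (modHom X Y)).inv ≫ (𝟙 _ ∘ᵥₘ modι X Y) := by
          rw [Iso.eq_inv_comp, ← Category.assoc, Iso.comp_inv_eq, vl_nat]
        rw [reassoc_of% e, Category.assoc, Category.assoc, tensorMap_ι,
          ← Category.assoc (_ ∘ᵥₘ _), vHom_comp, unitMap_ι, ← Category.assoc (_ ∘ᵥₘ _),
          vHom_comp, Category.id_comp, Category.id_comp, Category.comp_id]
      have e2 : 𝟙 (modHom X Y) ≫ modι X Y = modι X Y ≫ 𝟙 _ := by simp
      refine (congrArg (fun k => k ≫ _) e1).trans (Eq.trans ?_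
        (congrArg (fun k => k ≫ _) e2).symm)
      exact (Category.assoc _ _ _).trans (h'.trans (Category.assoc _ _ _).symm))

/-- The unit module is a right unit. -/
noncomputable def rightIso :
    HNatIso ((HFunctor.rightUnitorInv F (RMod M)).comp
      (((HFunctor.id F (RMod M)).prod b.unitFunctor).comp b.tensorFunctor))
    (HFunctor.id F (RMod M)) :=
  HNatIso.lift (forgetMod M)
    (fun X => RMod.homElem (A := b.tensorMod X b.unitMod) (B := X) (vr X.X).hom (b.isHom_vr _))
    (fun X => RMod.homElem (A := X) (B := b.tensorMod X b.unitMod) (vr X.X).inv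
      (RMod.IsHom.inv (b.isHom_vr _)))
    (fun X => elem (vr X.X).hom) (fun X => elem (vr X.X).inv)
    (fun X => RMod.umap_homElem _ _) (fun X => RMod.umap_homElem _ _)
    (fun X => elem_hom_inv _) (fun X => elem_inv_hom _)
    (fun X Y => by
      have h := (selfMonoidal F).right.naturality X.X Y.X
      have h' := congrArg (fun k => modι X Y ≫ k) h
      have e1 : ((vr (modHom X Y)).inv ≫ (𝟙 (modHom X Y) ∘ᵥₘ b.unitMap) ≫
          b.tensorMap X Y b.unitMod b.unitMod) ≫ modι _ _ =
          modι X Y ≫ (vr (ihom X.X Y.X)).inv ≫ (𝟙 (ihom X.X Y.X) ∘ᵥₘ curry (μ₁ F)) ≫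
            vMap X.X Y.X (vUnit F) (vUnit F) := by
        have e : modι X Y ≫ (vr (ihom X.X Y.X)).inv =
            (vr (modHom X Y)).inv ≫ (modι X Y ∘ᵥₘ 𝟙 _) := by
          rw [Iso.eq_inv_comp, ← Category.assoc, Iso.comp_inv_eq, vr_nat]
        rw [reassoc_of% e, Category.assoc, Category.assoc, tensorMap_ι,
          ← Category.assoc (_ ∘ᵥₘ _), vHom_comp, unitMap_ι, ← Category.assoc (_ ∘ᵥₘ _),
          vHom_comp, Category.id_comp, Category.id_comp, Category.comp_id]
      have e2 : 𝟙 (modHom X Y) ≫ modι X Y = modι X Y ≫ 𝟙 _ := by simp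
      refine (congrArg (fun k => k ≫ _) e1).trans (Eq.trans ?_
        (congrArg (fun k => k ≫ _) e2).symm)
      exact (Category.assoc _ _ _).trans (h'.trans (Category.assoc _ _ _).symm))

lemma umap_assocIso (A B C : RMod M) :
    (forgetMod M).umap (b.assocIso.hom ((A, B), C)) = elem (vα A.X B.X C.X).hom :=
  RMod.umap_homElem _ (b.isHom_vα A B C)

lemma umap_leftIso (A : RMod M) : (forgetMod M).umap (b.leftIso.hom A) = elem (vl A.X).hom :=
  RMod.umap_homElem _ (b.isHom_vl A)

lemma umap_rightIso (A : RMod M) : (forgetMod M).umap (b.rightIso.hom A) = elem (vr A.X).hom :=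
  RMod.umap_homElem _ (b.isHom_vr A)

/-- The monoidal category of modules over a bimonoid. -/
noncomputable def modMonoidal : HMonoidal F (RMod M) where
  tensor := b.tensorFunctor
  unit := b.unitFunctor
  assoc := b.assocIso
  left := b.leftIso
  right := b.rightIso
  -- The image of each side under `U_M` is the corresponding side of the pentagon in `F`.
  pentagon X Y Z T := (forgetMod M).umap_injective (((forgetMod M).umap_ucomp_of
    (b.umap_tensorFunctor_of (b.umap_assocIso X Y Z) ((forgetMod M).umap_hId T))
    ((forgetMod M).umap_ucomp_of (b.umap_assocIso X (b.tensorMod Y Z) T)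
      (b.umap_tensorFunctor_of ((forgetMod M).umap_hId X) (b.umap_assocIso Y Z T)))).trans
    (((selfMonoidal F).pentagon X.X Y.X Z.X T.X).trans ((forgetMod M).umap_ucomp_of
      (b.umap_assocIso (b.tensorMod X Y) Z T) (b.umap_assocIso X Y (b.tensorMod Z T))).symm))
  triangle X Y := (forgetMod M).umap_injective (((forgetMod M).umap_ucomp_of
    (b.umap_assocIso X b.unitMod Y)
    (b.umap_tensorFunctor_of ((forgetMod M).umap_hId X) (b.umap_leftIso Y))).trans
    (((selfMonoidal F).triangle X.X Y.X).trans
      (b.umap_tensorFunctor_of (b.umap_rightIso X) ((forgetMod M).umap_hId Y)).symm))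

lemma self_tensor_id (X Y : F) : (vTensor F).umap₂ (hId F X) (hId F Y) = hId F (X ∘ᵥ Y) :=
  (selfMonoidal F).tensor_id X Y

/-- The monoidal structure on modules induced by a bimonoid structure, with identities as strong
monoidal constraints of the forgetful functor. -/
noncomputable def toModMonoidal : ModMonoidal M where
  mon := b.modMonoidal
  strong :=
    { φ :=
        { hom X := hId F (X.1.X ∘ᵥ X.2.X)
          inv X := hId F (X.1.X ∘ᵥ X.2.X)
          hom_inv _ := id_ucomp _
          inv_hom _ := id_ucomp _
          naturality X Y := by
            refine (congrArg (fun k => _ ≫ k) (post_id _ _)).trans (Eq.trans ?_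
              (congrArg (fun k => _ ≫ k) (pre_id _ _)).symm)
            -- With identity components, naturality is the equation defining `tensorMap` as a lift.
            exact congrArg (fun k => k ≫ 𝟙 _) (b.tensorMap_ι X.1 Y.1 X.2 Y.2).symm }
      φ₀ :=
        { hom _ := hId F (vUnit F)
          inv _ := hId F (vUnit F)
          hom_inv _ := id_ucomp _
          inv_hom _ := id_ucomp _
          naturality _ _ := by
            refine (congrArg (fun k => _ ≫ k) (post_id _ _)).trans (Eq.trans ?_
              (congrArg (fun k => _ ≫ k) (pre_id _ _)).symm)
            exact congrArg (fun k => k ≫ 𝟙 _) b.unitMap_ι.symm }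
      -- All constraints of `U_M` being identities, the axioms say that `U_M` sends the module
      -- constraints to the vertical ones.
      assoc X Y Z := by
        refine (congrArg₂ ucomp (self_tensor_id _ _) ((id_ucomp _).trans
          (b.umap_assocIso X Y Z))).trans ((id_ucomp _).trans ?_)
        refine Eq.trans ?_ (congrArg (fun k => ucomp (elem (vα X.X Y.X Z.X).hom) k)
          ((congrArg (fun k => ucomp k _) (self_tensor_id _ _)).trans (id_ucomp _))).symm
        exact (ucomp_id _).symm
      left X := (congrArg₂ ucomp (self_tensor_id _ _) ((id_ucomp _).trans
        (b.umap_leftIso X))).trans (id_ucomp _)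
      right X := (congrArg₂ ucomp (self_tensor_id _ _) ((id_ucomp _).trans
        (b.umap_rightIso X))).trans (id_ucomp _) }

lemma realizes_toModMonoidal : Realizes b b.toModMonoidal where
  tensor A B := by
    have h : b.toModMonoidal.φ A B = 𝟙 (A.X ∘ᵥ B.X) := ofElem_hId _
    rw [h]
    change (𝟙 (A.X ∘ᵥ B.X) ▷ M) ≫ RMod.tensorAct b.δ A B = _ ≫ _ ≫ _ ≫ 𝟙 (A.X ∘ᵥ B.X)
    rw [id_whiskerRight, Category.id_comp, Category.comp_id]
    rfl
  unit := by
    have h : b.toModMonoidal.φ₀ = 𝟙 (vUnit F) := ofElem_hId _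
    rw [h]
    change (𝟙 (vUnit F) ▷ M) ≫ (vUnit F ◁ b.ε) ≫ μ₁ F = _ ≫ _ ≫ 𝟙 (vUnit F)
    rw [id_whiskerRight, Category.id_comp, Category.comp_id]

end BimonoidStr

/-! ### The bijection -/

variable (M) in
/-- Bimonoid structures on `M` and isomorphism classes of monoidal structures on its modules over
the base. -/
noncomputable def bimonoidEquiv :
    BimonoidStr M ≃ Quotient (overSetoid (forgetMod M) (selfMonoidal F)) where
  toFun b := Quotient.mk _ b.toModMonoidal
  -- For isomorphic `S` and `T`, the bimonoid of `S` is also realized by `T`, hence equals that of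
  -- `T` by uniqueness.
  invFun := Quotient.lift ModMonoidal.toBimonoid (fun S T ⟨i⟩ =>
    (ModMonoidal.eq_toBimonoid T ((ModMonoidal.realizes_toBimonoid S).of_overIso
      ((overSetoid (forgetMod M) (selfMonoidal F)).symm ⟨i⟩).some)))
  left_inv b := (ModMonoidal.eq_toBimonoid _ b.realizes_toModMonoidal).symm
  right_inv := by
    rintro ⟨S⟩
    -- `S` and the structure rebuilt from its bimonoid realize the same bimonoid.
    exact Quotient.sound ⟨(BimonoidStr.realizes_toModMonoidal _).overIso
      (ModMonoidal.realizes_toBimonoid S)⟩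

lemma bimonoidEquiv_eq_iff (b : BimonoidStr M) (S : ModMonoidal M) :
    bimonoidEquiv M b = Quotient.mk (overSetoid (forgetMod M) (selfMonoidal F)) S ↔
      Realizes b S := by
  constructor
  · intro h
    obtain ⟨i⟩ := (overSetoid (forgetMod M) (selfMonoidal F)).symm (Quotient.exact h)
    exact b.realizes_toModMonoidal.of_overIso i
  · intro h
    exact Quotient.sound ⟨b.realizes_toModMonoidal.overIso h⟩

end OfBimonoid

end Duo

theorem mainTheorem1 {V : Type u'} [Category.{v'} V] [MonoidalCategory V] [SymmetricCategory V]
    {F : Type u} [Category.{v} F] [EnrichedOrdinaryCategory V F] [MonoidalCategory F]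
    [Duo.VerticalMonoidal F] [Duo.Duoidal F] [Duo.VDuoidal V F]
    [Duo.LeftClosed F] [Duo.VLeftClosed V F]
    (M : F) [MonObj M] [Duo.HasModHoms M] :
    ∃ e : Duo.BimonoidStr M ≃ Quotient (Duo.overSetoid (Duo.forgetMod M) (Duo.selfMonoidal F)),
      ∀ (b : Duo.BimonoidStr M) (S : Duo.ModMonoidal M),
        e b = Quotient.mk (Duo.overSetoid (Duo.forgetMod M) (Duo.selfMonoidal F)) S ↔
          Duo.Realizes b S :=
  ⟨Duo.bimonoidEquiv M, Duo.bimonoidEquiv_eq_iff⟩
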